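/- **Notation.** For $m\ge 0$ let $S_m$ be the space of complex binary forms $\sum_{i=0}^m\binom mi a_ix^{m-i}y^i$, with $\mathrm{SL}_2(\mathbb C)$ acting by $(g\cdot f)(\mathbf x)=f(g^{-1}\mathbf x)$, and let $\mathbf{Cov}(S_m)=\mathbb C[S_m\oplus\mathbb C^2]^{\mathrm{SL}_2(\mathbb C)}$, bigraded by degree (in the $a_i$) and order (in $x,y$). A covariant of order $0$ is an invariant. With $\Omega_{\alpha\beta}=\partial_{x_\alpha}\partial_{y_\beta}-\partial_{y_\alpha}\partial_{x_\beta}$, the $r$-th transvectant of forms $g,h$ of orders $m,l$ is $$(g,h)_r=(m-r)!\,(l-r)!\,\bigl[\Omega_{\alpha\beta}^r\,g(\mathbf x_\alpha)h(\mathbf x_\beta)\bigr]_{\mathbf x_\alpha=\mathbf x_\beta=\mathbf x}\quad(0\le r\le\min(m,l)),$$ and $(g,h)_r=0$ for other $r$. Fix $n$ and let $\mathbf f$ be the general form of $S_n$. * For a family $\mathrm S\subset\mathbf{Cov}(S_n)$ of covariants homogeneous in degree and order, $\mathbf{Cov}(\mathrm S)$ is the algebra generated by the smallest set containing $\mathrm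 S$ and closed under transvectants. * A molecule is a loopless digraph $D$ with edge weights $w$; its grade is its largest edge weight. If at each vertex $\alpha$ the free valence $v_\alpha$ ($n$ minus the sum of the weights of the edges at $\alpha$) is nonnegative, its molecular covariant is $\prod_\alpha v_\alpha!\,\bigl[\prod_{e:\alpha\to\beta}\Omega_{\alpha\beta}^{w(e)}\prod_\alpha \mathbf f(\mathbf x_\alpha)\bigr]_{\mathbf x_\alpha=\mathbf x}$; otherwise it is $0$. The Gordan ideal $I_r\subset\mathbf{Cov}(S_n)$ is generated by the molecular covariants of molecules of grade at least $r$. * A finite family $\mathrm S$ of homogeneous covariants is relatively complete modulo an ideal $I$ of $\mathbf{Cov}(S_n)$ if every $h\in\mathbf{Cov}(\mathrm S)$ that is homogeneous of degree $d$ can be written $h=P+h_I$ with $P\in\mathbb C[\mathrm S]$ and $h_I\in I$, both homogeneous of degree $d$. **Data.** Let $k$ be an integer with $0\le p:=2n-4k<n$, and let $\mathbf H_{2k}=(\mathbf f,\mathbf f)_{2k}$, a form of order $p$. Let $J_{2k+2}$ be $I_{2k+2}$ or $I_{2k+2}+\langle\Delta\rangle$ for some invariant $\Delta\in\mathbf{Cov}(S_n)$.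 Let $\mathrm A=\{\mathbf f_1,\dots,\mathbf f_s\}\subset\mathbf{Cov}(S_n)$ be a finite family of homogeneous covariants, of orders $a_1,\dots,a_s$, that contains $\mathbf f$ and is relatively complete modulo $I_{2k}$. Let $x_1,\dots,x_q$ be homogeneous generators of the algebra $\mathbf{Cov}(S_p)$, of orders $b_1,\dots,b_q$, and let $\mathrm B=\{\mathbf g_1,\dots,\mathbf g_q\}$, where $\mathbf g_j=x_j(\mathbf H_{2k})\in\mathbf{Cov}(S_n)$ is obtained by substituting $\mathbf H_{2k}$ for the general form of $S_p$. Suppose that the following relations hold in $\mathbf{Cov}(S_p)$: * for each $i$ in a set $I\subset\{1,\dots,q-1\}$, a relation $x_i^{e_i}=\sum_{l=0}^{e_i-1}x_i^l\,P_{i,l}(x_{i+1},\dots,x_q)$ with $e_i\ge1$; put $\mathbf m_i=x_i^{e_i}$; * for each $j$ in a finite set $\mathcal J$, a relation $x_{j_b}^{\beta_j}x_{j_c}^{\gamma_j}=P_j(x_{j_c+1},\dots,x_q)$ with $j_b<j_c$ and $\beta_j,\gamma_j\ge1$; put $\mathbf m'_j=x_{j_b}^{\beta_j}x_{j_c}^{\gamma_j}$;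 where the $P_{i,l}$ and $P_j$ are polynomials with complex coefficients. Consider the solutions $(\alpha,\beta,u,v,r)\in\mathbb N^{s}\times\mathbb N^{q}\times\mathbb N^3$ of $$\sum_i a_i\alpha_i=u+r,\qquad \sum_j b_j\beta_j=v+r.$$ A nonzero solution is irreducible if it is not the sum of two nonzero solutions. To each solution is attached the transvectant $(\mathbf U,\mathbf V)_r$ with $\mathbf U=\prod_i\mathbf f_i^{\alpha_i}$ and $\mathbf V=\prod_j\mathbf g_j^{\beta_j}$. Let $\mathrm C$ be the family of transvectants of the irreducible solutions, and let $\tilde{\mathrm C}\subset\mathrm C$ consist of those attached to the irreducible solutions for which the formal monomial $\prod_j x_j^{\beta_j}$ is divisible by no $\mathbf m_i$ ($i\in I$) and by no $\mathbf m'_j$ ($j\in\mathcal J$). **Theorem.** The family $\tilde{\mathrm C}$ is relatively complete modulo $J_{2k+2}$ (in particular it is finite), and $$\mathbf{Cov}(\tilde{\mathrm C})=\mathbf{Cov}(\mathrm A\cup\mathrm B)=\mathbf{Cov}(S_n).$$ -/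

import Mathlib

open MvPolynomial
open scoped Nat

noncomputable section

namespace BinaryCov

/-! ### Binary forms and the algebra of covariants -/

/-- The binary form `∑ i, (n choose i) * a i * x ^ (n - i) * y ^ i` of degree `n` with coefficients
`a 0, …, a n` in `R`; the variables `x, y` are `X 0, X 1`. -/
def binaryForm {R : Type*} [CommRing R] (n : ℕ) (a : Fin (n + 1) → R) : MvPolynomial (Fin 2) R :=
  ∑ i : Fin (n + 1), C ((n.choose (i : ℕ) : R) * a i) * X 0 ^ (n - (i : ℕ)) * X 1 ^ (i : ℕ)

/-- The coefficients `a i` of a binary form `∑ i, (n choose i) * a i * x ^ (n - i) * y ^ i`. -/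
def formCoeff {R : Type*} [CommRing R] [Algebra ℂ R] (n : ℕ) (F : MvPolynomial (Fin 2) R)
    (i : Fin (n + 1)) : R :=
  ((n.choose (i : ℕ) : ℂ)⁻¹) •
    coeff (Finsupp.single 0 (n - (i : ℕ)) + Finsupp.single 1 (i : ℕ)) F

/-- The coordinate ring `ℂ[S_n ⊕ ℂ²] = ℂ[a_0, …, a_n][x, y]`. -/
abbrev CoordRing (n : ℕ) : Type := MvPolynomial (Fin 2) (MvPolynomial (Fin (n + 1)) ℂ)

/-- The value of an element of `ℂ[S_n ⊕ ℂ²]` at the form with coefficients `a` and the vector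
`v`. -/
def evalAt {n : ℕ} (a : Fin (n + 1) → ℂ) (v : Fin 2 → ℂ) : CoordRing n →+* ℂ :=
  (eval v).comp (map (eval a))

/-- The action of `SL₂(ℂ)` on `S_n`, in coefficients: `(g • f)(x) = f(g⁻¹ x)`. -/
def slAct {n : ℕ} (g : Matrix.SpecialLinearGroup (Fin 2) ℂ) (a : Fin (n + 1) → ℂ) :
    Fin (n + 1) → ℂ :=
  formCoeff n (aeval (fun i : Fin 2 => ∑ j : Fin 2,
      C (((g⁻¹ : Matrix.SpecialLinearGroup (Fin 2) ℂ) : Matrix (Fin 2) (Fin 2) ℂ) i j) *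
        (X j : MvPolynomial (Fin 2) ℂ))
    (binaryForm n a))

/-- The covariant algebra `Cov(S_n) = ℂ[S_n ⊕ ℂ²]^{SL₂(ℂ)}`. -/
def Cov (n : ℕ) : Subalgebra ℂ (CoordRing n) where
  carrier := {P | ∀ (g : Matrix.SpecialLinearGroup (Fin 2) ℂ) (a : Fin (n + 1) → ℂ)
    (v : Fin 2 → ℂ),
    evalAt (slAct g a) ((g : Matrix (Fin 2) (Fin 2) ℂ).mulVec v) P = evalAt a v P}
  mul_mem' := by
    intro P Q hP hQ g a v
    simp only [map_mul, hP g a v, hQ g a v]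
  add_mem' := by
    intro P Q hP hQ g a v
    simp only [map_add, hP g a v, hQ g a v]
  algebraMap_mem' := by
    intro c g a v
    simp [evalAt, MvPolynomial.algebraMap_eq, MvPolynomial.algebraMap_apply]

/-- `P` is homogeneous of degree `d` in the coefficients of the form. The *order*, that is, the
degree in `x, y`, is expressed by `MvPolynomial.IsHomogeneous`. -/
def IsDegree {n : ℕ} (d : ℕ) (P : CoordRing n) : Prop :=
  ∀ m : Fin 2 →₀ ℕ, (coeff m P).IsHomogeneous d

/-- An invariant is a covariant of order `0`. -/
def IsInvariant {n : ℕ} (P : Cov n) : Prop := (P : CoordRing n).IsHomogeneous 0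

/-- The general form `f` of `S_n`, viewed as a covariant. -/
def genericForm (n : ℕ) : CoordRing n := binaryForm n X

/-- The substitution of a form `H` of degree `p` into an element `G` of `ℂ[S_p ⊕ ℂ²]`: the
coefficients `a_0, …, a_p` in `G` are replaced by those of `H`, and `x, y` are kept. -/
def substForm {n p : ℕ} (H : CoordRing n) (G : CoordRing p) : CoordRing n :=
  map (aeval (formCoeff p H)).toRingHom G

/-! ### Cayley operators, transvectants and molecular covariants -/

section Operators

variable {R : Type*} [CommRing R] {ι : Type*}

/-- The form `F` in the variables `x_α, y_α` of the slot `α`. -/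
def inSlot (α : ι) (F : MvPolynomial (Fin 2) R) : MvPolynomial (ι × Fin 2) R :=
  rename (fun c => (α, c)) F

/-- The Cayley operator `Ω_{αβ} = ∂/∂x_α ∂/∂y_β - ∂/∂y_α ∂/∂x_β`. -/
def cayley (α β : ι) : Module.End R (MvPolynomial (ι × Fin 2) R) :=
  (pderiv (α, 0)).toLinearMap * (pderiv (β, 1)).toLinearMap -
    (pderiv (α, 1)).toLinearMap * (pderiv (β, 0)).toLinearMap

/-- The restriction to the diagonal, where all `(x_α, y_α)` are equal to `(x, y)`. -/
def diag (P : MvPolynomial (ι × Fin 2) R) : MvPolynomial (Fin 2) R :=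
  rename Prod.snd P

end Operators

/-- The transvectant `(F, G)_r` of two forms of orders `m` and `p`. The polarization
`σ_α = x ∂/∂x_α + y ∂/∂y_α`, iterated `s` times on a form of degree `s` in `x_α, y_α`, multiplies
it by `s!` and replaces `x_α, y_α` by `x, y`; so `Ω^r σ_α^(m-r) σ_β^(p-r) (F(x_α) G(x_β))` is
`(m-r)! (p-r)! [Ω^r F(x_α) G(x_β)]` restricted to the diagonal. -/
def transvectant {R : Type*} [CommRing R] (m p r : ℕ) (F G : MvPolynomial (Fin 2) R) :
    MvPolynomial (Fin 2) R :=
  if r ≤ m ∧ r ≤ p then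
    ((m - r)! * (p - r)!) •
      diag ((cayley (0 : Fin 2) 1 ^ r) (inSlot (0 : Fin 2) F * inSlot (1 : Fin 2) G))
  else 0

/-- A molecule: a digraph without loops on finitely many atoms, whose edges carry weights (weight
`0` means that there is no edge). -/
structure Molecule where
  atoms : ℕ
  w : Fin atoms → Fin atoms → ℕ
  loopless : ∀ α, w α α = 0

namespace Molecule

/-- The sum of the weights of the edges that start or end at the atom `α`. -/
def used (D : Molecule) (α : Fin D.atoms) : ℕ := ∑ β, (D.w α β + D.w β α)

/-- The grade: the maximal weight of an edge. -/
def grade (D : Molecule) : ℕ := Finset.univ.sup fun e : Fin D.atoms × Fin D.atoms => D.w e.1 e.2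

/-- The product of the commuting operators `Ω_{αβ} ^ w(α, β)` over all edges. -/
def edgeOp (R : Type*) [CommRing R] (D : Molecule) :
    Module.End R (MvPolynomial (Fin D.atoms × Fin 2) R) :=
  (((List.finRange D.atoms).product (List.finRange D.atoms)).map
    fun e => cayley (R := R) e.1 e.2 ^ D.w e.1 e.2).prod

/-- The molecular covariant of `S_n` given by a molecule all of whose atoms are the general form
`f` of valence `n`: the product of the `Ω_{αβ} ^ w(α, β)` and of the polarizations, with exponents
the free valences, applied to `∏ f(x_α)`; it is `0` if a free valence is negative. -/
def covariant (n : ℕ) (D : Molecule) : CoordRing n :=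
  if ∀ α, D.used α ≤ n then
    (∏ α, (n - D.used α)!) •
      diag (D.edgeOp (MvPolynomial (Fin (n + 1)) ℂ) (∏ α, inSlot α (genericForm n)))
  else 0

end Molecule

/-- Gordan's ideal `I_r` of `Cov(S_n)`, generated by the molecular covariants of molecules of grade
at least `r`. -/
def gordanIdeal (n r : ℕ) : Ideal (Cov n) :=
  Ideal.span {P | ∃ D : Molecule, r ≤ D.grade ∧ (P : CoordRing n) = D.covariant n}

/-- `H_{2k} = (f, f)_{2k}`. -/
def hessian (n k : ℕ) : CoordRing n :=
  transvectant n n (2 * k) (genericForm n) (genericForm n)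

/-! ### Relatively complete families -/

/-- `TransClosed S m F`: `F`, of order `m`, belongs to the smallest set that contains `S` and is
closed under transvectants. -/
inductive TransClosed {n : ℕ} (S : Set (CoordRing n)) : ℕ → CoordRing n → Prop
  | base {m : ℕ} {F : CoordRing n} (hF : F ∈ S) (hm : F.IsHomogeneous m) : TransClosed S m F
  | step {m p : ℕ} {F G : CoordRing n} (r : ℕ) (hF : TransClosed S m F) (hG : TransClosed S p G) :
      TransClosed S (m + p - 2 * r) (transvectant m p r F G)

/-- `Cov(S)` for a family `S` of covariants: the algebra generated by the smallest set that contains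
`S` and is closed under transvectants. -/
def covAlg {n : ℕ} (S : Set (CoordRing n)) : Subalgebra ℂ (CoordRing n) :=
  Algebra.adjoin ℂ {F | ∃ m, TransClosed S m F}

/-- The finite family `S` of homogeneous covariants is relatively complete modulo the ideal `I`. -/
def IsRelComplete {n : ℕ} (S : Set (CoordRing n)) (I : Ideal (Cov n)) : Prop :=
  S.Finite ∧
  (∀ F ∈ S, F ∈ Cov n ∧ (∃ d, IsDegree d F) ∧ ∃ m, F.IsHomogeneous m) ∧
  ∀ (d : ℕ) (h : CoordRing n), h ∈ covAlg S → IsDegree d h →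
    ∃ P ∈ Algebra.adjoin ℂ S, ∃ hI ∈ I,
      IsDegree d P ∧ IsDegree d (hI : CoordRing n) ∧ h = P + (hI : CoordRing n)

/-! ### The Diophantine system -/

/-- A tuple `(α, β, u, v, r)` of natural numbers. -/
abbrev Tuple (s q : ℕ) : Type := (Fin s → ℕ) × (Fin q → ℕ) × ℕ × ℕ × ℕ

/-- The system `∑ a_i α_i = u + r`, `∑ b_j β_j = v + r`, where `a` and `b` are the orders of the
members of the two families. -/
def IsSol {s q : ℕ} (a : Fin s → ℕ) (b : Fin q → ℕ) : Tuple s q → Prop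
  | (α, β, u, v, r) => ∑ i, a i * α i = u + r ∧ ∑ j, b j * β j = v + r

/-- A nonzero solution that is not the sum of two nonzero solutions. -/
def IsIrredSol {s q : ℕ} (a : Fin s → ℕ) (b : Fin q → ℕ) (κ : Tuple s q) : Prop :=
  IsSol a b κ ∧ κ ≠ 0 ∧
    ∀ κ₁ κ₂ : Tuple s q, IsSol a b κ₁ → IsSol a b κ₂ → κ = κ₁ + κ₂ → κ₁ = 0 ∨ κ₂ = 0

/-- The transvectant `(U, V)_r` with `U = ∏ F_i ^ α_i`, `V = ∏ G_j ^ β_j` attached to the tuple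
`(α, β, u, v, r)`. -/
def solTransvectant {n s q : ℕ} (F : Fin s → CoordRing n) (a : Fin s → ℕ)
    (G : Fin q → CoordRing n) (b : Fin q → ℕ) : Tuple s q → CoordRing n
  | (α, β, _, _, r) => transvectant (∑ i, a i * α i) (∑ j, b j * β j) r
      (∏ i, F i ^ α i) (∏ j, G j ^ β j)

/-! ### Relations between the generators -/

section Relations

variable {R : Type*} [CommRing R] [Algebra ℂ R] {q t : ℕ}

/-- For every `i ∈ I`, where `I ⊆ {1, …, q-1}` (the indices of `Fin q` other than the last one), a
relation `x_i ^ e_i = ∑_{k < e_i} x_i ^ k * p_k(x_{i+1}, …, x_q)` with `e_i ≥ 1`. -/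
def PowerRelations (x : Fin q → R) (I : Finset (Fin q)) (e : Fin q → ℕ) : Prop :=
  ∀ i ∈ I, (i : ℕ) + 1 < q ∧ 1 ≤ e i ∧
    ∃ P : ℕ → MvPolynomial {j : Fin q // i < j} ℂ,
      x i ^ e i = ∑ k ∈ Finset.range (e i), x i ^ k * aeval (fun j => x j.1) (P k)

/-- For every `j : Fin t` a relation `x_{jb} ^ eb * x_{jc} ^ ec = p(x_{jc+1}, …, x_q)` with
`jb < jc` (that is, `x_{jb} > x_{jc}`) and `eb, ec ≥ 1`. -/
def PairRelations (x : Fin q → R) (jb jc : Fin t → Fin q) (eb ec : Fin t → ℕ) : Prop :=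
  ∀ j, jb j < jc j ∧ 1 ≤ eb j ∧ 1 ≤ ec j ∧
    ∃ P : MvPolynomial {l : Fin q // jc j < l} ℂ,
      x (jb j) ^ eb j * x (jc j) ^ ec j = aeval (fun l => x l.1) P

/-- The monomial with exponents `β` is divisible by none of the monomials `x_i ^ e_i`, `i ∈ I`, and
by none of the monomials `x_{jb} ^ eb * x_{jc} ^ ec`. -/
def IsReduced (I : Finset (Fin q)) (e : Fin q → ℕ) (jb jc : Fin t → Fin q) (eb ec : Fin t → ℕ)
    (β : Fin q → ℕ) : Prop :=
  (∀ i ∈ I, ¬ Pi.single i (e i) ≤ β) ∧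
    ∀ j, ¬ Pi.single (jb j) (eb j) + Pi.single (jc j) (ec j) ≤ β

end Relations

end BinaryCov

end

/-! Everything follows from one statement on transvectants (`tau_mem_adjoinSup`): if `U` is a
covariant of `S_n` homogeneous of degree `D` and `V` is a covariant of `H = H_{2k}`, then every
transvectant of `U` with `V` is a polynomial in the reduced family plus an element of `I_{2k+2}`.
The case `V = 1`, index `0`, is relative completeness.

The proof is an induction on `D`, then on the index `r`. Since `A` is relatively complete modulo
`I_{2k}`, `U = P + Q` with `P` a polynomial in `A` and `Q` in `I_{2k}`. Modulo `I_{2k+2}`, a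
molecular covariant with an edge of weight `2k` is a combination of transvectants of `H` with
covariants `M` of smaller degree, because one more `Ω` between two copies of `f` gives zero by
antisymmetry and two more land in `I_{2k+2}` (`gordanSpanDeg_le`). Regrouping the three factors
expresses `((H, M)_t, V)_r` through transvectants of `M` with `(H, V)_c` (`tau_tau_mem_span`). The
latter is again a covariant of `H`, so the degree has dropped.

For `P` one may take a monomial in the `f_i`, and for `V` a monomial in the `g_j`; the relations
make the second one reduced, the exponents decreasing lexicographically
(`prod_pow_mem_span_isReduced`). Together with the index, these exponents form a solution of the
Diophantine system. If it is irreducible, the transvectant belongs to the family up to a factor. If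
it is a sum of two solutions, the transvectant is a multiple of the product of the two smaller ones,
up to transvectants of lower index (`exists_tau_mul_sub_mem`), and divisors of reduced monomials are
reduced. The family is finite because irreducible solutions form an antichain.

The tool throughout is the symbolic method. An umbral evaluation turns polynomials in brackets and
linear forms into covariants, and every regrouping comes from one fact: a bracket polynomial in two
groups of letters is a combination of transvectants between the groups (`crossLT_le_tauLT`), a
consequence of Plücker exchanges (`tau_sgProd_exchange`). The first fundamental theorem
(`mem_molSpan_of_isDegree`), proved by Cayley's `Ω`-process, says that all covariants arise in this
way. Hence `Cov n` is closed under transvectants and generated from any nonzero multiple of `f`. The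
reduced family contains such a multiple, which gives the equality of algebras. -/

open MvPolynomial
open scoped Nat

noncomputable section

namespace BinaryCov

/-! ### Coefficientwise linear maps -/

section MapCoeff

variable {R S A : Type*} [CommRing R] [Algebra ℂ R] [CommRing S] [Algebra ℂ S]
  [CommRing A] [Algebra ℂ A] {τ τ' : Type*}

/-- The linear map on polynomials which applies a linear map to every coefficient. -/
def mapCoeff (E : R →ₗ[ℂ] A) : MvPolynomial τ R →ₗ[ℂ] MvPolynomial τ A where
  toFun p := AddMonoidAlgebra.map E.toAddMonoidHom p
  map_add' p q := by ext m; simp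
  map_smul' c p := by ext m; simp

@[simp] lemma coeff_mapCoeff (E : R →ₗ[ℂ] A) (p : MvPolynomial τ R) (m : τ →₀ ℕ) :
    coeff m (mapCoeff E p) = E (coeff m p) := rfl

@[simp] lemma mapCoeff_monomial (E : R →ₗ[ℂ] A) (m : τ →₀ ℕ) (r : R) :
    mapCoeff E (monomial m r) = monomial m (E r) := by
  classical
  ext m'
  simp only [coeff_mapCoeff, coeff_monomial]
  split_ifs <;> simp

@[simp] lemma mapCoeff_C (E : R →ₗ[ℂ] A) (r : R) :
    mapCoeff E (C r : MvPolynomial τ R) = C (E r) := mapCoeff_monomial E 0 r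

lemma mapCoeff_rename (E : R →ₗ[ℂ] A) (f : τ → τ') (p : MvPolynomial τ R) :
    mapCoeff E (rename f p) = rename f (mapCoeff E p) := by
  induction p using MvPolynomial.induction_on' with
  | monomial m r => simp [rename_monomial]
  | add p q hp hq => simp [hp, hq]

lemma mapCoeff_pderiv (E : R →ₗ[ℂ] A) (i : τ) (p : MvPolynomial τ R) :
    mapCoeff E (pderiv i p) = pderiv i (mapCoeff E p) := by
  ext m
  rw [coeff_mapCoeff, coeff_pderiv, coeff_pderiv, coeff_mapCoeff, mul_comm, mul_comm (E _)]
  have h := map_nsmul E (m i + 1) (coeff (m + Finsupp.single i 1) p)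
  rw [nsmul_eq_mul, nsmul_eq_mul] at h
  exact_mod_cast h

lemma mapCoeff_C_mul_map (E : R →ₗ[ℂ] A) (r : R) (q : MvPolynomial τ ℂ) :
    mapCoeff E (C r * map (algebraMap ℂ R) q) = C (E r) * map (algebraMap ℂ A) q := by
  ext m
  simp only [coeff_mapCoeff, coeff_C_mul, coeff_map]
  rw [mul_comm r, ← Algebra.smul_def, map_smul, Algebra.smul_def, mul_comm]

/-- A coefficientwise map commutes with the substitution of polynomials with complex
coefficients for the variables. -/
lemma mapCoeff_aeval (E : R →ₗ[ℂ] A) (s : τ → MvPolynomial τ' ℂ) (p : MvPolynomial τ R) :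
    mapCoeff E (aeval (fun i => map (algebraMap ℂ R) (s i)) p) =
      aeval (fun i => map (algebraMap ℂ A) (s i)) (mapCoeff E p) := by
  induction p using MvPolynomial.induction_on' with
  | monomial m r =>
    simp only [mapCoeff_monomial, aeval_monomial, Finsupp.prod, ← map_pow, ← map_prod,
      MvPolynomial.algebraMap_eq]
    exact mapCoeff_C_mul_map E r _
  | add p q hp hq => simp only [map_add, hp, hq]

/-- The umbral evaluation is not a ring homomorphism: it is multiplicative only on factors in
disjoint sets of letters. Separate maps `E₁`, `E₂` on the two factors are what is needed to make it
commute with transvectants. -/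
lemma mapCoeff_mul_of (E : S →ₗ[ℂ] A) {R₁ R₂ : Type*} [CommRing R₁] [Algebra ℂ R₁] [CommRing R₂]
    [Algebra ℂ R₂] (E₁ : R₁ →ₗ[ℂ] A) (E₂ : R₂ →ₗ[ℂ] A) (g₁ : R₁ →ₐ[ℂ] S) (g₂ : R₂ →ₐ[ℂ] S)
    (h : ∀ r s, E (g₁ r * g₂ s) = E₁ r * E₂ s) (p : MvPolynomial τ R₁) (q : MvPolynomial τ R₂) :
    mapCoeff E (map g₁.toRingHom p * map g₂.toRingHom q) = mapCoeff E₁ p * mapCoeff E₂ q := by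
  induction p using MvPolynomial.induction_on' with
  | monomial m r =>
    induction q using MvPolynomial.induction_on' with
    | monomial m' s => simp [map_monomial, monomial_mul, h]
    | add p q hp hq => simp only [map_add, mul_add, hp, hq]
  | add p q hp hq => simp only [map_add, add_mul, hp, hq]

lemma mapCoeff_homogeneousComponent (E : R →ₗ[ℂ] A) (m : ℕ) (p : MvPolynomial τ R) :
    mapCoeff E (homogeneousComponent m p) = homogeneousComponent m (mapCoeff E p) := by
  ext d
  simp only [coeff_mapCoeff, coeff_homogeneousComponent]
  split_ifs <;> simp

end MapCoeff

/-! ### Unnormalized transvectants -/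

section Tau

variable {R A : Type*} [CommRing R] [CommRing A] {ι : Type*}

lemma cayley_apply (α β : ι) (P : MvPolynomial (ι × Fin 2) R) :
    cayley α β P = pderiv (α, 0) (pderiv (β, 1) P) - pderiv (α, 1) (pderiv (β, 0) P) := rfl

lemma mapCoeff_cayley [Algebra ℂ R] [Algebra ℂ A] (E : R →ₗ[ℂ] A) (α β : ι)
    (P : MvPolynomial (ι × Fin 2) R) :
    mapCoeff E (cayley α β P) = cayley α β (mapCoeff E P) := by
  simp only [cayley_apply, map_sub, mapCoeff_pderiv]

lemma mapCoeff_cayley_pow [Algebra ℂ R] [Algebra ℂ A] (E : R →ₗ[ℂ] A) (α β : ι) (t : ℕ)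
    (P : MvPolynomial (ι × Fin 2) R) :
    mapCoeff E ((cayley α β ^ t) P) = (cayley α β ^ t) (mapCoeff E P) := by
  induction t with
  | zero => rfl
  | succ t ih => rw [pow_succ', pow_succ', Module.End.mul_apply, Module.End.mul_apply,
      mapCoeff_cayley, ih]

lemma map_cayley_pow (g : R →+* A) (α β : ι) (t : ℕ) (P : MvPolynomial (ι × Fin 2) R) :
    map g ((cayley α β ^ t) P) = (cayley α β ^ t) (map g P) := by
  induction t with
  | zero => rfl
  | succ t ih =>
    rw [pow_succ', pow_succ', Module.End.mul_apply, Module.End.mul_apply, ← ih]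
    simp only [cayley_apply, map_sub, pderiv_map]

lemma cayley_pow_C_mul (α β : ι) (c : R) (t : ℕ) (P : MvPolynomial (ι × Fin 2) R) :
    (cayley α β ^ t) (C c * P) = C c * (cayley α β ^ t) P := by
  rw [← smul_eq_C_mul, map_smul, smul_eq_C_mul]

variable [Algebra ℂ R] [Algebra ℂ A]

/-- The operation `(F, G) ↦ [Ω ^ t F(x_α) G(x_β)]` restricted to the diagonal. -/
def tau (t : ℕ) :
    MvPolynomial (Fin 2) R →ₗ[ℂ] MvPolynomial (Fin 2) R →ₗ[ℂ] MvPolynomial (Fin 2) R :=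
  LinearMap.mk₂ ℂ
    (fun F G => diag ((cayley (0 : Fin 2) 1 ^ t) (inSlot (0 : Fin 2) F * inSlot (1 : Fin 2) G)))
    (fun F F' G => by simp only [inSlot, diag, map_add, add_mul])
    (fun c F G => by
      simp only [inSlot, diag, ← algebraMap_smul R c, map_smul, smul_mul_assoc])
    (fun F G G' => by simp only [inSlot, diag, map_add, mul_add])
    (fun c F G => by
      simp only [inSlot, diag, ← algebraMap_smul R c, map_smul, mul_smul_comm])

lemma tau_apply (t : ℕ) (F G : MvPolynomial (Fin 2) R) :
    tau t F G =
      diag ((cayley (0 : Fin 2) 1 ^ t) (inSlot (0 : Fin 2) F * inSlot (1 : Fin 2) G)) := rfl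

@[simp] lemma tau_zero_apply (F G : MvPolynomial (Fin 2) R) : tau 0 F G = F * G := by
  rw [tau_apply, pow_zero, Module.End.one_apply, diag, map_mul, inSlot, inSlot, rename_rename,
    rename_rename]
  have h (c : Fin 2) : (Prod.snd ∘ fun i : Fin 2 => (c, i)) = id := rfl
  rw [h, h, rename_id_apply, rename_id_apply]

lemma tau_C_mul_left (t : ℕ) (c : R) (F G : MvPolynomial (Fin 2) R) :
    tau t (C c * F) G = C c * tau t F G := by
  simp only [tau_apply, inSlot, map_mul, rename_C, mul_assoc, cayley_pow_C_mul, diag]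

lemma tau_C_mul_right (t : ℕ) (c : R) (F G : MvPolynomial (Fin 2) R) :
    tau t F (C c * G) = C c * tau t F G := by
  simp only [tau_apply, inSlot, map_mul, rename_C, mul_left_comm _ (C c), cayley_pow_C_mul, diag]

lemma map_tau (g : R →+* A) (t : ℕ) (F G : MvPolynomial (Fin 2) R) :
    map g (tau t F G) = tau t (map g F) (map g G) := by
  simp only [tau_apply, diag, inSlot, map_rename, map_cayley_pow, map_mul]

/-- `tau` omits the factorials and the bounds on the index, so it is bilinear and makes no reference
to orders. The nonzero factor is restored only when the actual family of transvectants is needed. -/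
lemma tau_eq_transvectant {m p t : ℕ} (hm : t ≤ m) (hp : t ≤ p) (F G : MvPolynomial (Fin 2) R) :
    transvectant m p t F G = (((m - t)! * (p - t)! : ℕ) : ℂ) • tau t F G := by
  rw [transvectant, if_pos ⟨hm, hp⟩, tau_apply, Nat.cast_smul_eq_nsmul]

lemma transvectant_eq_smul_tau (m p t : ℕ) (F G : MvPolynomial (Fin 2) R) :
    ∃ c : ℂ, transvectant m p t F G = c • tau t F G := by
  by_cases h : t ≤ m ∧ t ≤ p
  · exact ⟨_, tau_eq_transvectant h.1 h.2 F G⟩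
  · exact ⟨0, by rw [transvectant, if_neg h, zero_smul]⟩

lemma mapCoeff_tau (E : R →ₗ[ℂ] A) {R₁ R₂ : Type*} [CommRing R₁] [Algebra ℂ R₁] [CommRing R₂]
    [Algebra ℂ R₂] (E₁ : R₁ →ₗ[ℂ] A) (E₂ : R₂ →ₗ[ℂ] A) (g₁ : R₁ →ₐ[ℂ] R) (g₂ : R₂ →ₐ[ℂ] R)
    (h : ∀ r s, E (g₁ r * g₂ s) = E₁ r * E₂ s) (t : ℕ) (p : MvPolynomial (Fin 2) R₁)
    (q : MvPolynomial (Fin 2) R₂) :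
    mapCoeff E (tau t (map g₁.toRingHom p) (map g₂.toRingHom q)) =
      tau t (mapCoeff E₁ p) (mapCoeff E₂ q) := by
  simp only [tau_apply, diag, inSlot, mapCoeff_rename, mapCoeff_cayley_pow, ← map_rename]
  rw [mapCoeff_mul_of E E₁ E₂ g₁ g₂ h, mapCoeff_rename, mapCoeff_rename]

end Tau

/-! ### Products of linear forms and bracket algebras -/

section Brackets

variable {R A : Type*} [CommRing R] [CommRing A]

/-- The linear form `v 0 * x + v 1 * y`. -/
def sg (v : Fin 2 → R) : MvPolynomial (Fin 2) R := C (v 0) * X 0 + C (v 1) * X 1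

/-- The bracket `v 0 * w 1 - v 1 * w 0`, as a constant polynomial. -/
def dt (v w : Fin 2 → R) : MvPolynomial (Fin 2) R := C (v 0 * w 1 - v 1 * w 0)

lemma dt_eq (v w : Fin 2 → R) : dt v w = C (v 0) * C (w 1) - C (v 1) * C (w 0) := by
  simp [dt]

lemma dt_self (v : Fin 2 → R) : dt v v = 0 := by
  rw [dt_eq]; ring

lemma dt_swap (v w : Fin 2 → R) : dt v w = -dt w v := by
  simp only [dt_eq]; ring

lemma map_sg (g : R →+* A) (v : Fin 2 → R) : map g (sg v) = sg (fun c => g (v c)) := by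
  simp [sg]

lemma map_dt (g : R →+* A) (v w : Fin 2 → R) :
    map g (dt v w) = dt (fun c => g (v c)) (fun c => g (w c)) := by
  simp [dt]

lemma pderiv_sg (c : Fin 2) (v : Fin 2 → R) : pderiv c (sg v) = C (v c) := by
  fin_cases c <;> simp [sg, pderiv_X]

variable {ι κ : Type*}

/-- The product of the linear forms attached to a multiset of letters. -/
def sgProd (v : ι → Fin 2 → R) (s : Multiset ι) : MvPolynomial (Fin 2) R :=
  (s.map fun a => sg (v a)).prod

@[simp] lemma sgProd_zero (v : ι → Fin 2 → R) : sgProd v 0 = 1 := by simp [sgProd]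

@[simp] lemma sgProd_cons (v : ι → Fin 2 → R) (a : ι) (s : Multiset ι) :
    sgProd v (a ::ₘ s) = sg (v a) * sgProd v s := by simp [sgProd]

lemma sgProd_add (v : ι → Fin 2 → R) (s s' : Multiset ι) :
    sgProd v (s + s') = sgProd v s * sgProd v s' := by simp [sgProd]

lemma sgProd_replicate (v : ι → Fin 2 → R) (a : ι) (m : ℕ) :
    sgProd v (Multiset.replicate m a) = sg (v a) ^ m := by simp [sgProd]

lemma pderiv_sgProd [DecidableEq ι] (v : ι → Fin 2 → R) (c : Fin 2) (s : Multiset ι) :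
    pderiv c (sgProd v s) = (s.map fun a => C (v a c) * sgProd v (s.erase a)).sum := by
  induction s using Multiset.induction with
  | empty => simp
  | cons a s ih =>
    rw [sgProd_cons, pderiv_mul, pderiv_sg, ih, Multiset.map_cons, Multiset.sum_cons,
      Multiset.erase_cons_head, ← Multiset.sum_map_mul_left]
    congr 2
    refine Multiset.map_congr rfl fun b hb => ?_
    rw [Multiset.erase_cons_tail_of_mem hb, sgProd_cons]
    ring

variable [Algebra ℂ R]

/-- The two factors live in separate variables, so each derivative in `Ω` hits only one of them.
This recursion in the index, free of slots, is the basis of the later inductions. -/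
lemma tau_succ (t : ℕ) (F G : MvPolynomial (Fin 2) R) :
    tau (t + 1) F G =
      tau t (pderiv 0 F) (pderiv 1 G) - tau t (pderiv 1 F) (pderiv 0 G) := by
  have h0 (a b : Fin 2) (P : MvPolynomial (Fin 2) R) :
      pderiv (a, b) (inSlot a P) = inSlot a (pderiv b P) :=
    (pderiv_rename (f := fun c : Fin 2 => (a, c)) (fun x y h => (Prod.mk.inj h).2) b P)
  have h1 (a a' b : Fin 2) (h : a' ≠ a) (P : MvPolynomial (Fin 2) R) :
      pderiv (a', b) (inSlot a P) = 0 := by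
    apply pderiv_eq_zero_of_notMem_vars
    classical
    intro hm
    have := vars_rename _ _ hm
    simp only [Finset.mem_image, Prod.mk.injEq] at this
    obtain ⟨c, -, hc, -⟩ := this
    exact h hc.symm
  simp only [tau_apply, pow_succ, Module.End.mul_apply, cayley_apply, pderiv_mul, h0,
    h1 0 1 _ (by decide), h1 1 0 _ (by decide), mul_zero, zero_mul, add_zero, zero_add, diag,
    map_sub]

lemma tau_smul_sum {α β : Type*} (t : ℕ) (s : Multiset α) (s' : Multiset β) (c : α → R) (d : β → R)
    (f : α → MvPolynomial (Fin 2) R) (g : β → MvPolynomial (Fin 2) R) :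
    tau t (s.map fun a => C (c a) * f a).sum (s'.map fun b => C (d b) * g b).sum =
      (s.map fun a => (s'.map fun b => C (c a) * C (d b) * tau t (f a) (g b)).sum).sum := by
  have h1 (s : Multiset α) (G : MvPolynomial (Fin 2) R) :
      tau t (s.map fun a => C (c a) * f a).sum G =
        (s.map fun a => C (c a) * tau t (f a) G).sum := by
    induction s using Multiset.induction with
    | empty => simp
    | cons a s ih => simp [ih, tau_C_mul_left]
  have h2 (s' : Multiset β) (F : MvPolynomial (Fin 2) R) :
      tau t F (s'.map fun b => C (d b) * g b).sum =
        (s'.map fun b => C (d b) * tau t F (g b)).sum := by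
    induction s' using Multiset.induction with
    | empty => simp
    | cons a s ih => simp [ih, tau_C_mul_right]
  simp only [h1, h2, mul_assoc, Multiset.sum_map_mul_left]

lemma tau_succ_sgProd [DecidableEq ι] [DecidableEq κ] (v : ι → Fin 2 → R) (w : κ → Fin 2 → R)
    (t : ℕ) (s : Multiset ι) (s' : Multiset κ) :
    tau (t + 1) (sgProd v s) (sgProd w s') =
      (s.map fun a => (s'.map fun b =>
        dt (v a) (w b) * tau t (sgProd v (s.erase a)) (sgProd w (s'.erase b))).sum).sum := by
  simp only [tau_succ, pderiv_sgProd, tau_smul_sum, ← Multiset.sum_map_sub, dt_eq, sub_mul]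

/-- The algebra generated by the brackets of a family of letters and by their linear forms. -/
def brAlg (v : ι → Fin 2 → R) : Subalgebra ℂ (MvPolynomial (Fin 2) R) :=
  Algebra.adjoin ℂ
    (Set.range (fun p : ι × ι => dt (v p.1) (v p.2)) ∪ Set.range fun i => sg (v i))

lemma dt_mem_brAlg (v : ι → Fin 2 → R) (i j : ι) : dt (v i) (v j) ∈ brAlg v :=
  Algebra.subset_adjoin (Or.inl ⟨(i, j), rfl⟩)

lemma sg_mem_brAlg (v : ι → Fin 2 → R) (i : ι) : sg (v i) ∈ brAlg v :=
  Algebra.subset_adjoin (Or.inr ⟨i, rfl⟩)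

lemma sgProd_mem_brAlg (v : ι → Fin 2 → R) (s : Multiset ι) : sgProd v s ∈ brAlg v :=
  multiset_prod_mem _ fun x hx => by
    obtain ⟨a, -, rfl⟩ := Multiset.mem_map.1 hx
    exact sg_mem_brAlg v a

/-- The span of the products of an element of `brAlg v ⊔ brAlg w` with fewer than `t` brackets of
a letter of `v` and a letter of `w`. -/
def crossLT (v : ι → Fin 2 → R) (w : κ → Fin 2 → R) (t : ℕ) :
    Submodule ℂ (MvPolynomial (Fin 2) R) :=
  Submodule.span ℂ {x | ∃ c ∈ brAlg v ⊔ brAlg w, ∃ L : List (ι × κ), L.length < t ∧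
    x = c * (L.map fun p => dt (v p.1) (w p.2)).prod}

variable (v : ι → Fin 2 → R) (w : κ → Fin 2 → R)

lemma crossLT_mono {t t' : ℕ} (h : t ≤ t') : crossLT v w t ≤ crossLT v w t' :=
  Submodule.span_mono fun _ ⟨c, hc, L, hL, hx⟩ => ⟨c, hc, L, hL.trans_le h, hx⟩

variable {v w}

lemma mem_crossLT_of_mem {c : MvPolynomial (Fin 2) R} (hc : c ∈ brAlg v ⊔ brAlg w) (t : ℕ) :
    c ∈ crossLT v w (t + 1) :=
  Submodule.subset_span ⟨c, hc, [], by simp, by simp⟩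

lemma mul_mem_crossLT {c x : MvPolynomial (Fin 2) R} {t : ℕ} (hc : c ∈ brAlg v ⊔ brAlg w)
    (hx : x ∈ crossLT v w t) : c * x ∈ crossLT v w t := by
  induction hx using Submodule.span_induction with
  | mem x h =>
    obtain ⟨d, hd, L, hL, rfl⟩ := h
    exact Submodule.subset_span ⟨c * d, mul_mem hc hd, L, hL, (mul_assoc _ _ _).symm⟩
  | zero => simp
  | add x y _ _ hx hy => rw [mul_add]; exact add_mem hx hy
  | smul r x _ hx => rw [mul_smul_comm]; exact Submodule.smul_mem _ _ hx

lemma dt_mul_mem_crossLT {x : MvPolynomial (Fin 2) R} {t : ℕ} (a : ι) (b : κ)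
    (hx : x ∈ crossLT v w t) : dt (v a) (w b) * x ∈ crossLT v w (t + 1) := by
  induction hx using Submodule.span_induction with
  | mem x h =>
    obtain ⟨d, hd, L, hL, rfl⟩ := h
    exact Submodule.subset_span ⟨d, hd, (a, b) :: L, by simpa using hL, by simp; ring⟩
  | zero => simp
  | add x y _ _ hx hy => rw [mul_add]; exact add_mem hx hy
  | smul r x _ hx => rw [mul_smul_comm]; exact Submodule.smul_mem _ _ hx

/-- Used when all the terms of an expansion agree modulo `W`: the sum is then the number of terms
times any one of them. -/
lemma sum_sub_card_mem {M : Type*} [AddCommGroup M] [Module ℂ M] (W : Submodule ℂ M) {α : Type*}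
    (s : Multiset α) (f : α → M) (x : M) (h : ∀ a ∈ s, f a - x ∈ W) :
    (s.map f).sum - (Multiset.card s : ℂ) • x ∈ W := by
  induction s using Multiset.induction with
  | empty => simp
  | cons a s ih =>
    have h1 := h a (Multiset.mem_cons_self a s)
    have h2 := ih fun b hb => h b (Multiset.mem_cons_of_mem hb)
    convert add_mem h1 h2 using 1
    simp only [Multiset.map_cons, Multiset.sum_cons, Multiset.card_cons, Nat.cast_add,
      Nat.cast_one, add_smul, one_smul]
    abel

lemma sgProd_mem_sup_left (s : Multiset ι) : sgProd v s ∈ brAlg v ⊔ brAlg w :=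
  (le_sup_left : brAlg v ≤ brAlg v ⊔ brAlg w) (sgProd_mem_brAlg v s)

lemma sgProd_mem_sup_right (s : Multiset κ) : sgProd w s ∈ brAlg v ⊔ brAlg w :=
  (le_sup_right : brAlg w ≤ brAlg v ⊔ brAlg w) (sgProd_mem_brAlg w s)

/-- Each application of `Ω` creates exactly one cross bracket. -/
lemma tau_sgProd_mem_crossLT (t : ℕ) (s : Multiset ι) (s' : Multiset κ) :
    tau t (sgProd v s) (sgProd w s') ∈ crossLT v w (t + 1) := by
  classical
  induction t generalizing s s' with
  | zero =>
    rw [tau_zero_apply]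
    exact mem_crossLT_of_mem (mul_mem (sgProd_mem_sup_left s) (sgProd_mem_sup_right s')) 0
  | succ t ih =>
    rw [tau_succ_sgProd]
    refine multiset_sum_mem _ fun x hx => ?_
    obtain ⟨a, -, rfl⟩ := Multiset.mem_map.1 hx
    refine multiset_sum_mem _ fun x hx => ?_
    obtain ⟨b, -, rfl⟩ := Multiset.mem_map.1 hx
    exact dt_mul_mem_crossLT a b (ih _ _)

/-- Exchanging letters in a transvectant of products of linear forms only produces terms with fewer
cross brackets; the three statements are proved by a common induction. -/
lemma tau_sgProd_exchange (t : ℕ) :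
    (∀ (s : Multiset ι) (s' : Multiset κ) (a a' : ι) (b : κ),
      dt (v a) (w b) * tau t (sgProd v (a' ::ₘ s)) (sgProd w s') -
        dt (v a') (w b) * tau t (sgProd v (a ::ₘ s)) (sgProd w s') ∈ crossLT v w (t + 1)) ∧
    (∀ (s : Multiset ι) (s' : Multiset κ) (a : ι) (b b' : κ),
      dt (v a) (w b) * tau t (sgProd v s) (sgProd w (b' ::ₘ s')) -
        dt (v a) (w b') * tau t (sgProd v s) (sgProd w (b ::ₘ s')) ∈ crossLT v w (t + 1)) ∧
    (∀ (s : Multiset ι) (s' : Multiset κ) (a : ι) (b : κ),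
      tau (t + 1) (sgProd v (a ::ₘ s)) (sgProd w (b ::ₘ s')) -
        (((Multiset.card s + 1) * (Multiset.card s' + 1) : ℕ) : ℂ) •
          (dt (v a) (w b) * tau t (sgProd v s) (sgProd w s')) ∈ crossLT v w (t + 1)) := by
  classical
  -- The third statement follows from the first two at the same index: expanding one `Ω` gives
  -- `(card s + 1) * (card s' + 1)` terms, and exchanging the letter on either side carries each of
  -- them to the term of `a` and `b`.
  have key : ∀ t : ℕ, (∀ (s : Multiset ι) (s' : Multiset κ) (a a' : ι) (b : κ),
      dt (v a) (w b) * tau t (sgProd v (a' ::ₘ s)) (sgProd w s') -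
        dt (v a') (w b) * tau t (sgProd v (a ::ₘ s)) (sgProd w s') ∈ crossLT v w (t + 1)) →
    (∀ (s : Multiset ι) (s' : Multiset κ) (a : ι) (b b' : κ),
      dt (v a) (w b) * tau t (sgProd v s) (sgProd w (b' ::ₘ s')) -
        dt (v a) (w b') * tau t (sgProd v s) (sgProd w (b ::ₘ s')) ∈ crossLT v w (t + 1)) →
    (∀ (s : Multiset ι) (s' : Multiset κ) (a : ι) (b : κ),
      tau (t + 1) (sgProd v (a ::ₘ s)) (sgProd w (b ::ₘ s')) -
        (((Multiset.card s + 1) * (Multiset.card s' + 1) : ℕ) : ℂ) •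
          (dt (v a) (w b) * tau t (sgProd v s) (sgProd w s')) ∈ crossLT v w (t + 1)) := by
    intro t hl hr s s' a b
    rw [tau_succ_sgProd]
    have e : (((Multiset.card s + 1) * (Multiset.card s' + 1) : ℕ) : ℂ) =
        (Multiset.card (a ::ₘ s) : ℂ) * (Multiset.card (b ::ₘ s') : ℂ) := by
      push_cast [Multiset.card_cons]; ring
    rw [e, mul_smul]
    refine sum_sub_card_mem _ _ _ _ fun x hx => ?_
    refine sum_sub_card_mem _ _ _ _ fun y hy => ?_
    have h1 : dt (v x) (w y) * tau t (sgProd v ((a ::ₘ s).erase x))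
        (sgProd w ((b ::ₘ s').erase y)) - dt (v a) (w y) * tau t (sgProd v s)
        (sgProd w ((b ::ₘ s').erase y)) ∈ crossLT v w (t + 1) := by
      by_cases hxa : x = a
      · subst hxa; simp
      · obtain ⟨s₁, rfl⟩ := Multiset.exists_cons_of_mem
          ((Multiset.mem_cons.1 hx).resolve_left hxa)
        rw [Multiset.erase_cons_tail _ (Ne.symm hxa), Multiset.erase_cons_head]
        exact hl _ _ _ _ _
    have h2 : dt (v a) (w y) * tau t (sgProd v s) (sgProd w ((b ::ₘ s').erase y)) -
        dt (v a) (w b) * tau t (sgProd v s) (sgProd w s') ∈ crossLT v w (t + 1) := by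
      by_cases hyb : y = b
      · subst hyb; simp
      · obtain ⟨s₁, rfl⟩ := Multiset.exists_cons_of_mem
          ((Multiset.mem_cons.1 hy).resolve_left hyb)
        rw [Multiset.erase_cons_tail _ (Ne.symm hyb), Multiset.erase_cons_head]
        exact hr _ _ _ _ _
    simpa using add_mem h1 h2
  suffices h : (∀ (s : Multiset ι) (s' : Multiset κ) (a a' : ι) (b : κ),
      dt (v a) (w b) * tau t (sgProd v (a' ::ₘ s)) (sgProd w s') -
        dt (v a') (w b) * tau t (sgProd v (a ::ₘ s)) (sgProd w s') ∈ crossLT v w (t + 1)) ∧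
    (∀ (s : Multiset ι) (s' : Multiset κ) (a : ι) (b b' : κ),
      dt (v a) (w b) * tau t (sgProd v s) (sgProd w (b' ::ₘ s')) -
        dt (v a) (w b') * tau t (sgProd v s) (sgProd w (b ::ₘ s')) ∈ crossLT v w (t + 1)) from
    ⟨h.1, h.2, key t h.1 h.2⟩
  have hdl (a a' : ι) : dt (v a) (v a') ∈ brAlg v ⊔ brAlg w :=
    (le_sup_left : brAlg v ≤ brAlg v ⊔ brAlg w) (dt_mem_brAlg v a a')
  have hdr (a a' : κ) : dt (w a) (w a') ∈ brAlg v ⊔ brAlg w :=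
    (le_sup_right : brAlg w ≤ brAlg v ⊔ brAlg w) (dt_mem_brAlg w a a')
  have hsl (a : ι) : sg (v a) ∈ brAlg v ⊔ brAlg w :=
    (le_sup_left : brAlg v ≤ brAlg v ⊔ brAlg w) (sg_mem_brAlg v a)
  have hsr (a : κ) : sg (w a) ∈ brAlg v ⊔ brAlg w :=
    (le_sup_right : brAlg w ≤ brAlg v ⊔ brAlg w) (sg_mem_brAlg w a)
  induction t with
  | zero =>
    constructor
    · intro s s' a a' b
      simp only [tau_zero_apply, sgProd_cons]
      -- The Plücker identity `[a b] a'_x - [a' b] a_x = [a a'] b_x`: the right side has no cross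
      -- bracket.
      convert mem_crossLT_of_mem (v := v) (w := w) (mul_mem (mul_mem (hdl a a') (hsr b))
        (mul_mem (sgProd_mem_sup_left s) (sgProd_mem_sup_right s'))) 0 using 1
      simp only [dt_eq, sg]
      ring
    · intro s s' a b b'
      simp only [tau_zero_apply, sgProd_cons]
      convert mem_crossLT_of_mem (v := v) (w := w) (mul_mem (mul_mem (hdr b' b) (hsl a))
        (mul_mem (sgProd_mem_sup_left s) (sgProd_mem_sup_right s'))) 0 using 1
      simp only [dt_eq, sg]
      ring
  | succ t ih =>
    have hc := key t ih.1 ih.2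
    constructor
    · intro s s' a a' b
      rcases Multiset.empty_or_exists_mem s' with rfl | ⟨b', hb'⟩
      · simp [tau_succ]
      · obtain ⟨s₁, rfl⟩ := Multiset.exists_cons_of_mem hb'
        -- One further cross bracket is extracted from each transvectant. The leading terms then
        -- differ by `[a b][a' b'] - [a' b][a b'] = [a a'][b b']`, free of cross brackets, times a
        -- transvectant of index `t`.
        have h1 := dt_mul_mem_crossLT a b (hc s s₁ a' b')
        have h2 := dt_mul_mem_crossLT a' b (hc s s₁ a b')
        have h3 := crossLT_mono v w (Nat.le_succ _) (mul_mem_crossLT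
          (mul_mem (hdl a a') (hdr b b')) (tau_sgProd_mem_crossLT t s s₁))
        have h4 := Submodule.smul_mem _
          (((Multiset.card s + 1) * (Multiset.card s₁ + 1) : ℕ) : ℂ) h3
        convert add_mem (sub_mem h1 h2) h4 using 1
        simp only [mul_sub, dt_eq, Algebra.smul_def]
        ring
    · intro s s' a b b'
      rcases Multiset.empty_or_exists_mem s with rfl | ⟨a', ha'⟩
      · simp [tau_succ]
      · obtain ⟨s₁, rfl⟩ := Multiset.exists_cons_of_mem ha'
        have h1 := dt_mul_mem_crossLT a b (hc s₁ s' a' b')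
        have h2 := dt_mul_mem_crossLT a b' (hc s₁ s' a' b)
        have h3 := crossLT_mono v w (Nat.le_succ _) (mul_mem_crossLT
          (mul_mem (hdl a a') (hdr b b')) (tau_sgProd_mem_crossLT t s₁ s'))
        have h4 := Submodule.smul_mem _
          (((Multiset.card s₁ + 1) * (Multiset.card s' + 1) : ℕ) : ℂ) h3
        convert add_mem (sub_mem h1 h2) h4 using 1
        simp only [mul_sub, dt_eq, Algebra.smul_def]
        ring

/-- Up to a nonzero factor and modulo terms with fewer cross brackets, the transvectant of two
products of linear forms is any of its terms. -/
lemma exists_tau_sub_mem_crossLT (L : List (ι × κ)) (s : Multiset ι) (s' : Multiset κ) :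
    ∃ N : ℂ, N ≠ 0 ∧
      tau L.length (sgProd v (L.map Prod.fst + s)) (sgProd w (L.map Prod.snd + s')) -
        N • ((L.map fun p => dt (v p.1) (w p.2)).prod * (sgProd v s * sgProd w s')) ∈
      crossLT v w L.length := by
  induction L with
  | nil => exact ⟨1, one_ne_zero, by simp⟩
  | cons p L ih =>
    obtain ⟨N, hN, h⟩ := ih
    have h1 := (tau_sgProd_exchange (v := v) (w := w) L.length).2.2
      ((L.map Prod.fst : Multiset ι) + s) ((L.map Prod.snd : Multiset κ) + s') p.1 p.2
    have h2 := dt_mul_mem_crossLT p.1 p.2 h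
    rw [← Multiset.cons_add, ← Multiset.cons_add, Multiset.cons_coe, Multiset.cons_coe] at h1
    generalize hM : (((Multiset.card ((L.map Prod.fst : Multiset ι) + s) + 1) *
      (Multiset.card ((L.map Prod.snd : Multiset κ) + s') + 1) : ℕ) : ℂ) = M at h1
    refine ⟨M * N, mul_ne_zero ?_ hN, ?_⟩
    · rw [← hM]
      exact Nat.cast_ne_zero.2 (by positivity)
    · rw [List.length_cons, List.map_cons, List.map_cons, List.map_cons, List.prod_cons]
      convert add_mem h1 (Submodule.smul_mem _ M h2) using 1
      simp only [mul_sub, smul_sub, mul_smul,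
        mul_smul_comm, mul_assoc]
      abel

end Brackets

/-! ### Bracket polynomials as combinations of transvectants -/

section BracketSpans

variable {R A : Type*} [CommRing R] [CommRing A] [Algebra ℂ R] [Algebra ℂ A] {ι κ : Type*}

/-- The span of the `[Ω ^ u F(x_α) G(x_β)]` with `u < t`, `F ∈ M` and `G ∈ N`. -/
def tauLT (t : ℕ) (M N : Submodule ℂ (MvPolynomial (Fin 2) R)) :
    Submodule ℂ (MvPolynomial (Fin 2) R) :=
  Submodule.span ℂ {x | ∃ u < t, ∃ F ∈ M, ∃ G ∈ N, x = tau u F G}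

lemma tau_mem_tauLT {t u : ℕ} (h : u < t) {M N : Submodule ℂ (MvPolynomial (Fin 2) R)}
    {F G : MvPolynomial (Fin 2) R} (hF : F ∈ M) (hG : G ∈ N) : tau u F G ∈ tauLT t M N :=
  Submodule.subset_span ⟨u, h, F, hF, G, hG, rfl⟩

lemma tauLT_mono {t t' : ℕ} (h : t ≤ t') (M N : Submodule ℂ (MvPolynomial (Fin 2) R)) :
    tauLT t M N ≤ tauLT t' M N :=
  Submodule.span_mono fun _ ⟨u, hu, r⟩ => ⟨u, hu.trans_le h, r⟩

lemma tauLT_le {t : ℕ} {M N W : Submodule ℂ (MvPolynomial (Fin 2) R)}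
    (h : ∀ u < t, ∀ F ∈ M, ∀ G ∈ N, tau u F G ∈ W) : tauLT t M N ≤ W :=
  Submodule.span_le.2 fun _ ⟨u, hu, F, hF, G, hG, hx⟩ => hx ▸ h u hu F hF G hG

lemma tau_mem_of_span {t : ℕ} {s s' : Set (MvPolynomial (Fin 2) R)}
    {W : Submodule ℂ (MvPolynomial (Fin 2) R)}
    (h : ∀ F ∈ s, ∀ G ∈ s', tau t F G ∈ W) {F G : MvPolynomial (Fin 2) R}
    (hF : F ∈ Submodule.span ℂ s) (hG : G ∈ Submodule.span ℂ s') : tau t F G ∈ W := by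
  have h1 : Submodule.map₂ (tau t) (Submodule.span ℂ s) (Submodule.span ℂ s') ≤ W := by
    rw [Submodule.map₂_span_span, Submodule.span_le]
    rintro _ ⟨F, hF, G, hG, rfl⟩
    exact h F hF G hG
  exact h1 (Submodule.apply_mem_map₂ _ hF hG)

lemma brAlg_le_span (v : ι → Fin 2 → R) :
    Subalgebra.toSubmodule (brAlg v) ≤
      Submodule.span ℂ {x | ∃ r : R, C r ∈ brAlg v ∧ ∃ s : Multiset ι, x = C r * sgProd v s} := by
  rw [brAlg, Algebra.adjoin_eq_span, Submodule.span_le]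
  intro x hx
  refine Submodule.subset_span ?_
  induction hx using Submonoid.closure_induction with
  | mem x h =>
    rcases h with ⟨⟨i, j⟩, rfl⟩ | ⟨i, rfl⟩
    · exact ⟨_, dt_mem_brAlg v i j, 0, by simp [dt]⟩
    · exact ⟨1, by simp, {i}, by simp [sgProd]⟩
  | one => exact ⟨1, by simp, 0, by simp⟩
  | mul x y _ _ hx hy =>
    obtain ⟨r, hr, s, rfl⟩ := hx
    obtain ⟨r', hr', s', rfl⟩ := hy
    refine ⟨r * r', by rw [C_mul]; exact mul_mem hr hr', s + s', ?_⟩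
    rw [sgProd_add, C_mul]
    ring

variable {v : ι → Fin 2 → R} {w : κ → Fin 2 → R}

/-- Strong induction on the number of cross brackets. A bracket monomial is a term of the
transvectant whose index is its number of cross brackets, hence equals that transvectant up to a
nonzero factor and up to monomials with fewer cross brackets. -/
lemma crossLT_le_tauLT (t : ℕ) :
    crossLT v w t ≤
      tauLT t (Subalgebra.toSubmodule (brAlg v)) (Subalgebra.toSubmodule (brAlg w)) := by
  induction t using Nat.strong_induction_on with
  | _ t ih =>
  refine Submodule.span_le.2 ?_
  rintro _ ⟨c, hc, L, hL, rfl⟩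
  set W := tauLT t (Subalgebra.toSubmodule (brAlg v)) (Subalgebra.toSubmodule (brAlg w))
  rw [← Subalgebra.mem_toSubmodule, ← Subalgebra.mul_toSubmodule] at hc
  suffices h : ∀ c ∈ Subalgebra.toSubmodule (brAlg v), ∀ d ∈ Subalgebra.toSubmodule (brAlg w),
      c * d * (L.map fun p => dt (v p.1) (w p.2)).prod ∈ W by
    induction hc using Submodule.mul_induction_on' with
    | mem_mul_mem c hc d hd => exact h c hc d hd
    | add x _ y _ hx hy => rw [add_mul]; exact add_mem hx hy
  intro c hc d hd
  have hc' := brAlg_le_span v hc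
  have hd' := brAlg_le_span w hd
  clear hc hd
  induction hc' using Submodule.span_induction with
  | zero => simp
  | add x y _ _ hx hy => rw [add_mul, add_mul]; exact add_mem hx hy
  | smul r x _ hx => rw [smul_mul_assoc, smul_mul_assoc]; exact Submodule.smul_mem _ _ hx
  | mem x hx =>
    induction hd' using Submodule.span_induction with
    | zero => simp
    | add x y _ _ hx hy => rw [mul_add, add_mul]; exact add_mem hx hy
    | smul r x _ hx => rw [mul_smul_comm, smul_mul_assoc]; exact Submodule.smul_mem _ _ hx
    | mem y hy =>
      obtain ⟨r, hr, s, rfl⟩ := hx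
      obtain ⟨r', hr', s', rfl⟩ := hy
      -- The transvectant is formed by returning the letters consumed by the brackets of `L` to the
      -- two products of linear forms.
      obtain ⟨N, hN, h⟩ := exists_tau_sub_mem_crossLT (v := v) (w := w) L s s'
      have hrr : C r * C r' ∈ brAlg v ⊔ brAlg w :=
        mul_mem ((le_sup_left : brAlg v ≤ _) hr) ((le_sup_right : brAlg w ≤ _) hr')
      have h1 := tauLT_mono hL.le _ _ (ih _ hL (mul_mem_crossLT hrr h))
      have h2 : tau L.length (C r * sgProd v ((L.map Prod.fst : Multiset ι) + s))
          (C r' * sgProd w ((L.map Prod.snd : Multiset κ) + s')) ∈ W :=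
        tau_mem_tauLT hL (Subalgebra.mul_mem _ hr (sgProd_mem_brAlg _ _))
          (Subalgebra.mul_mem _ hr' (sgProd_mem_brAlg _ _))
      rw [tau_C_mul_left, tau_C_mul_right] at h2
      convert Submodule.smul_mem _ N⁻¹ (sub_mem h2 h1) using 1
      rw [mul_sub, ← mul_assoc (C r) (C r'), sub_sub_cancel, mul_smul_comm, smul_smul,
        inv_mul_cancel₀ hN, one_smul]
      ring

lemma mul_mem_crossLT_add {x y : MvPolynomial (Fin 2) R} {t u : ℕ} (hx : x ∈ crossLT v w t)
    (hy : y ∈ crossLT v w u) : x * y ∈ crossLT v w (t + u) := by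
  induction hx using Submodule.span_induction with
  | zero => simp
  | add x y _ _ hx hy => rw [add_mul]; exact add_mem hx hy
  | smul r x _ hx => rw [smul_mul_assoc]; exact Submodule.smul_mem _ _ hx
  | mem x hx =>
    induction hy using Submodule.span_induction with
    | zero => simp
    | add x y _ _ hx hy => rw [mul_add]; exact add_mem hx hy
    | smul r x _ hx => rw [mul_smul_comm]; exact Submodule.smul_mem _ _ hx
    | mem y hy =>
      obtain ⟨c, hc, L, hL, rfl⟩ := hx
      obtain ⟨d, hd, L', hL', rfl⟩ := hy
      refine Submodule.subset_span ⟨c * d, mul_mem hc hd, L ++ L', ?_, ?_⟩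
      · rw [List.length_append]; omega
      · rw [List.map_append, List.prod_append]; ring

lemma exists_mem_crossLT {x : MvPolynomial (Fin 2) R} (hx : x ∈ brAlg (Sum.elim v w)) :
    ∃ t, x ∈ crossLT v w t := by
  induction hx using Algebra.adjoin_induction with
  | mem x h =>
    have hl : brAlg v ≤ brAlg v ⊔ brAlg w := le_sup_left
    have hr : brAlg w ≤ brAlg v ⊔ brAlg w := le_sup_right
    have hlr (a : ι) (b : κ) : dt (v a) (w b) ∈ crossLT v w 2 := by
      simpa using dt_mul_mem_crossLT a b (mem_crossLT_of_mem (one_mem (brAlg v ⊔ brAlg w)) 0)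
    rcases h with ⟨⟨i | i, j | j⟩, rfl⟩ | ⟨i | i, rfl⟩
    · exact ⟨1, mem_crossLT_of_mem (hl (dt_mem_brAlg v i j)) 0⟩
    · exact ⟨2, hlr i j⟩
    · refine ⟨2, ?_⟩
      dsimp only
      rw [dt_swap]
      exact neg_mem (hlr j i)
    · exact ⟨1, mem_crossLT_of_mem (hr (dt_mem_brAlg w i j)) 0⟩
    · exact ⟨1, mem_crossLT_of_mem (hl (sg_mem_brAlg v i)) 0⟩
    · exact ⟨1, mem_crossLT_of_mem (hr (sg_mem_brAlg w i)) 0⟩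
  | algebraMap r => exact ⟨1, mem_crossLT_of_mem (Subalgebra.algebraMap_mem _ r) 0⟩
  | add x y _ _ hx hy =>
    obtain ⟨t, ht⟩ := hx
    obtain ⟨u, hu⟩ := hy
    exact ⟨max t u, add_mem (crossLT_mono _ _ (le_max_left _ _) ht)
      (crossLT_mono _ _ (le_max_right _ _) hu)⟩
  | mul x y _ _ hx hy =>
    obtain ⟨t, ht⟩ := hx
    obtain ⟨u, hu⟩ := hy
    exact ⟨t + u, mul_mem_crossLT_add ht hu⟩

lemma brAlg_comp_le (u : κ → Fin 2 → R) (f : ι → κ) : brAlg (u ∘ f) ≤ brAlg u := by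
  refine Algebra.adjoin_le ?_
  rintro _ (⟨⟨i, j⟩, rfl⟩ | ⟨i, rfl⟩)
  · exact dt_mem_brAlg u (f i) (f j)
  · exact sg_mem_brAlg u (f i)

lemma crossLT_le_brAlg (t : ℕ) :
    crossLT v w t ≤ Subalgebra.toSubmodule (brAlg (Sum.elim v w)) := by
  refine Submodule.span_le.2 ?_
  rintro _ ⟨c, hc, L, -, rfl⟩
  refine Subalgebra.mul_mem (brAlg (Sum.elim v w)) ?_ (list_prod_mem fun x hx => ?_)
  · exact sup_le (brAlg_comp_le (Sum.elim v w) Sum.inl) (brAlg_comp_le (Sum.elim v w) Sum.inr) hc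
  · obtain ⟨p, -, rfl⟩ := List.mem_map.1 hx
    exact dt_mem_brAlg (Sum.elim v w) (Sum.inl p.1) (Sum.inr p.2)

lemma tau_mem_brAlg (t : ℕ) {F G : MvPolynomial (Fin 2) R} (hF : F ∈ brAlg v) (hG : G ∈ brAlg w) :
    tau t F G ∈ brAlg (Sum.elim v w) := by
  refine tau_mem_of_span (W := Subalgebra.toSubmodule (brAlg (Sum.elim v w))) ?_
    (brAlg_le_span v hF) (brAlg_le_span w hG)
  rintro _ ⟨r, hr, s, rfl⟩ _ ⟨r', hr', s', rfl⟩
  rw [tau_C_mul_left, tau_C_mul_right]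
  exact Subalgebra.mul_mem _ (brAlg_comp_le (Sum.elim v w) Sum.inl hr)
    (Subalgebra.mul_mem _ (brAlg_comp_le (Sum.elim v w) Sum.inr hr')
      (crossLT_le_brAlg _ (tau_sgProd_mem_crossLT t s s')))

lemma brAlg_sumElim_le_tau {x : MvPolynomial (Fin 2) R} (hx : x ∈ brAlg (Sum.elim v w)) :
    ∃ t, x ∈ tauLT t (Subalgebra.toSubmodule (brAlg v)) (Subalgebra.toSubmodule (brAlg w)) := by
  obtain ⟨t, ht⟩ := exists_mem_crossLT hx
  exact ⟨t, crossLT_le_tauLT t ht⟩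

lemma brAlg_map (g : R →ₐ[ℂ] A) (v : ι → Fin 2 → R) :
    (brAlg v).map (mapAlgHom g) = brAlg fun i c => g (v i c) := by
  rw [brAlg, AlgHom.map_adjoin, brAlg, Set.image_union, ← Set.range_comp, ← Set.range_comp]
  congr 2
  · congr 1
    funext p
    exact map_dt g.toRingHom _ _
  · congr 1
    funext p
    exact map_sg g.toRingHom _

end BracketSpans

/-! ### Umbral evaluation -/

section Umbral

variable {A : Type*} [CommRing A] [Algebra ℂ A] {ι κ ζ : Type*} [Fintype ι] [Fintype κ] [Fintype ζ]

/-- The umbral evaluation of polynomials in the letters `ξ_i, η_i`: it sends `∏ ξ_i ^ c_i η_i ^ d_i`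
to the value at the origin of `∏ ∂_x ^ c_i ∂_y ^ d_i F_i`. -/
def umbral (F : ι → MvPolynomial (Fin 2) A) : MvPolynomial (ι × Fin 2) ℂ →ₗ[ℂ] A :=
  (basisMonomials (ι × Fin 2) ℂ).constr ℂ fun m => ∏ i, (((m (i, 0))! * (m (i, 1))! : ℕ) : ℂ) •
    coeff (Finsupp.single 0 (m (i, 0)) + Finsupp.single 1 (m (i, 1))) (F i)

lemma umbral_monomial (F : ι → MvPolynomial (Fin 2) A) (m : ι × Fin 2 →₀ ℕ) :
    umbral F (monomial m 1) = ∏ i, (((m (i, 0))! * (m (i, 1))! : ℕ) : ℂ) •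
      coeff (Finsupp.single 0 (m (i, 0)) + Finsupp.single 1 (m (i, 1))) (F i) := by
  have h := (basisMonomials (ι × Fin 2) ℂ).constr_basis ℂ (fun m => ∏ i,
    (((m (i, 0))! * (m (i, 1))! : ℕ) : ℂ) •
      coeff (Finsupp.single 0 (m (i, 0)) + Finsupp.single 1 (m (i, 1))) (F i)) m
  rwa [coe_basisMonomials] at h

lemma linearMap_ext_monomial {σ M : Type*} [AddCommGroup M] [Module ℂ M]
    {f g : MvPolynomial σ ℂ →ₗ[ℂ] M} (h : ∀ m, f (monomial m 1) = g (monomial m 1)) : f = g :=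
  (basisMonomials σ ℂ).ext fun m => by simpa using h m

/-- The embedding of the letters of some slots into those of more slots. -/
def slotMap (f : ι → ζ) : MvPolynomial (ι × Fin 2) ℂ →ₐ[ℂ] MvPolynomial (ζ × Fin 2) ℂ :=
  rename (Prod.map f id)

lemma umbral_slotMap (e : ι ≃ ζ) (F : ζ → MvPolynomial (Fin 2) A) (r : MvPolynomial (ι × Fin 2) ℂ) :
    umbral F (slotMap e r) = umbral (F ∘ e) r := by
  suffices h : umbral F ∘ₗ (slotMap e).toLinearMap = umbral (F ∘ e) from LinearMap.congr_fun h r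
  refine linearMap_ext_monomial fun m => ?_
  have hi : Function.Injective (Prod.map e id : ι × Fin 2 → ζ × Fin 2) :=
    e.injective.prodMap Function.injective_id
  simp only [LinearMap.comp_apply, AlgHom.toLinearMap_apply, slotMap, rename_monomial,
    umbral_monomial]
  rw [← e.prod_comp]
  refine Finset.prod_congr rfl fun i _ => ?_
  have h (c : Fin 2) : Finsupp.mapDomain (Prod.map e id) m (e i, c) = m (i, c) :=
    Finsupp.mapDomain_apply hi m (i, c)
  rw [h, h, Function.comp_apply]

lemma umbral_mul (F : ι ⊕ κ → MvPolynomial (Fin 2) A) (r : MvPolynomial (ι × Fin 2) ℂ)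
    (s : MvPolynomial (κ × Fin 2) ℂ) :
    umbral F (slotMap Sum.inl r * slotMap Sum.inr s) =
      umbral (F ∘ Sum.inl) r * umbral (F ∘ Sum.inr) s := by
  have key : ∀ m m', umbral F (slotMap Sum.inl (monomial m 1) * slotMap Sum.inr (monomial m' 1)) =
      umbral (F ∘ Sum.inl) (monomial m 1) * umbral (F ∘ Sum.inr) (monomial m' 1) := by
    intro m m'
    have hl : Function.Injective (Prod.map Sum.inl id : ι × Fin 2 → (ι ⊕ κ) × Fin 2) :=
      Sum.inl_injective.prodMap Function.injective_id
    have hr : Function.Injective (Prod.map Sum.inr id : κ × Fin 2 → (ι ⊕ κ) × Fin 2) :=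
      Sum.inr_injective.prodMap Function.injective_id
    have h1 (i : ι) (c : Fin 2) : Finsupp.mapDomain (Prod.map Sum.inl id) m
        ((Sum.inl i, c) : (ι ⊕ κ) × Fin 2) = m (i, c) := Finsupp.mapDomain_apply hl m (i, c)
    have h2 (i : κ) (c : Fin 2) : Finsupp.mapDomain (Prod.map Sum.inr id) m'
        ((Sum.inr i, c) : (ι ⊕ κ) × Fin 2) = m' (i, c) := Finsupp.mapDomain_apply hr m' (i, c)
    have h3 (i : κ) (c : Fin 2) : Finsupp.mapDomain (Prod.map Sum.inl id) m
        ((Sum.inr i, c) : (ι ⊕ κ) × Fin 2) = 0 :=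
      Finsupp.mapDomain_of_notMem_range _ _ (by rintro ⟨⟨j, d⟩, h⟩; simp at h)
    have h4 (i : ι) (c : Fin 2) : Finsupp.mapDomain (Prod.map Sum.inr id) m'
        ((Sum.inl i, c) : (ι ⊕ κ) × Fin 2) = 0 :=
      Finsupp.mapDomain_of_notMem_range _ _ (by rintro ⟨⟨j, d⟩, h⟩; simp at h)
    simp only [slotMap, rename_monomial, monomial_mul, one_mul, umbral_monomial,
      Fintype.prod_sum_type, Finsupp.add_apply, h1, h2, h3, h4, add_zero, zero_add,
      Function.comp_apply]
  induction r using MvPolynomial.induction_on' with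
  | add p q hp hq => simp only [map_add, add_mul, hp, hq]
  | monomial m a =>
    induction s using MvPolynomial.induction_on' with
    | add p q hp hq => simp only [map_add, mul_add, hp, hq]
    | monomial m' b =>
      have e1 : monomial m a = a • monomial m (1 : ℂ) := by rw [smul_monomial, smul_eq_mul, mul_one]
      have e2 : monomial m' b = b • monomial m' (1 : ℂ) := by
        rw [smul_monomial, smul_eq_mul, mul_one]
      rw [e1, e2]
      simp only [map_smul, smul_mul_assoc, mul_smul_comm, key]

/-- The umbral letters of a slot. -/
def slotVec (i : ι) (c : Fin 2) : MvPolynomial (ι × Fin 2) ℂ := X (i, c)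

/-- The coefficientwise umbral evaluation. -/
def umbralForm (F : ι → MvPolynomial (Fin 2) A) :
    MvPolynomial (Fin 2) (MvPolynomial (ι × Fin 2) ℂ) →ₗ[ℂ] MvPolynomial (Fin 2) A :=
  mapCoeff (umbral F)

/-- The span of the molecular covariants with atoms `F i`. -/
def molSpan (F : ι → MvPolynomial (Fin 2) A) : Submodule ℂ (MvPolynomial (Fin 2) A) :=
  (Subalgebra.toSubmodule (brAlg (slotVec (ι := ι)))).map (umbralForm F)

lemma mem_molSpan {F : ι → MvPolynomial (Fin 2) A}
    {q : MvPolynomial (Fin 2) (MvPolynomial (ι × Fin 2) ℂ)} (hq : q ∈ brAlg slotVec) :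
    umbralForm F q ∈ molSpan F := ⟨q, hq, rfl⟩

lemma brAlg_slotMap (f : ι → ζ) :
    (brAlg (slotVec (ι := ι))).map (mapAlgHom (slotMap f)) = brAlg (slotVec ∘ f) := by
  rw [brAlg_map]
  congr 1
  funext i c
  simp [slotVec, slotMap]

lemma umbralForm_slotMap (e : ι ≃ ζ) (F : ζ → MvPolynomial (Fin 2) A)
    (q : MvPolynomial (Fin 2) (MvPolynomial (ι × Fin 2) ℂ)) :
    umbralForm F (mapAlgHom (slotMap e) q) = umbralForm (F ∘ e) q := by
  ext m
  simp only [umbralForm, coeff_mapCoeff]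
  rw [← umbral_slotMap]
  congr 1

/-- Atoms may be relabelled freely. Combined with `exists_mem_tauLT_of_mem_molSpan`, this allows a
molecular covariant to be split along any partition of its atoms into two groups. -/
lemma molSpan_comp (e : ι ≃ ζ) (F : ζ → MvPolynomial (Fin 2) A) :
    molSpan (F ∘ e) = molSpan F := by
  have h1 : brAlg (slotVec ∘ e) = brAlg (slotVec (ι := ζ)) := by
    refine le_antisymm (brAlg_comp_le _ _) ?_
    have h := brAlg_comp_le (slotVec ∘ e) e.symm
    rwa [Function.comp_assoc, e.self_comp_symm, Function.comp_id] at h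
  ext x
  constructor
  · rintro ⟨q, hq, rfl⟩
    refine ⟨mapAlgHom (slotMap e) q, ?_, umbralForm_slotMap e F q⟩
    change _ ∈ brAlg slotVec
    rw [← h1, ← brAlg_slotMap]
    exact ⟨q, hq, rfl⟩
  · rintro ⟨q, hq, rfl⟩
    change q ∈ brAlg slotVec at hq
    rw [← h1, ← brAlg_slotMap] at hq
    obtain ⟨q', hq', rfl⟩ := hq
    exact ⟨q', hq', (umbralForm_slotMap e F q').symm⟩

lemma umbralForm_tau (F : ι ⊕ κ → MvPolynomial (Fin 2) A) (t : ℕ)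
    (p : MvPolynomial (Fin 2) (MvPolynomial (ι × Fin 2) ℂ))
    (q : MvPolynomial (Fin 2) (MvPolynomial (κ × Fin 2) ℂ)) :
    umbralForm F (tau t (mapAlgHom (slotMap Sum.inl) p) (mapAlgHom (slotMap Sum.inr) q)) =
      tau t (umbralForm (F ∘ Sum.inl) p) (umbralForm (F ∘ Sum.inr) q) :=
  mapCoeff_tau _ _ _ _ _ (umbral_mul F) t p q

lemma slotVec_sum : (slotVec (ι := ι ⊕ κ)) = Sum.elim (slotVec ∘ Sum.inl) (slotVec ∘ Sum.inr) := by
  funext i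
  rcases i with i | i <;> rfl

lemma tau_mem_molSpan {F : ι → MvPolynomial (Fin 2) A} {G : κ → MvPolynomial (Fin 2) A} (t : ℕ)
    {x y : MvPolynomial (Fin 2) A} (hx : x ∈ molSpan F) (hy : y ∈ molSpan G) :
    tau t x y ∈ molSpan (Sum.elim F G) := by
  obtain ⟨p, hp, rfl⟩ := hx
  obtain ⟨q, hq, rfl⟩ := hy
  refine ⟨_, ?_, umbralForm_tau (Sum.elim F G) t p q⟩
  change _ ∈ brAlg slotVec
  rw [slotVec_sum]
  refine tau_mem_brAlg t ?_ ?_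
  · rw [← brAlg_slotMap]; exact ⟨p, hp, rfl⟩
  · rw [← brAlg_slotMap]; exact ⟨q, hq, rfl⟩

lemma exists_mem_tauLT_of_mem_brAlg {q : MvPolynomial (Fin 2) (MvPolynomial ((ι ⊕ κ) × Fin 2) ℂ)}
    (hq : q ∈ brAlg slotVec) :
    ∃ t, q ∈ tauLT t (Subalgebra.toSubmodule ((brAlg slotVec).map (mapAlgHom (slotMap Sum.inl))))
      (Subalgebra.toSubmodule ((brAlg slotVec).map (mapAlgHom (slotMap Sum.inr)))) := by
  rw [slotVec_sum] at hq
  rw [brAlg_slotMap, brAlg_slotMap]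
  exact brAlg_sumElim_le_tau hq

lemma umbralForm_mem_tauLT (F : ι ⊕ κ → MvPolynomial (Fin 2) A) {t : ℕ}
    {q : MvPolynomial (Fin 2) (MvPolynomial ((ι ⊕ κ) × Fin 2) ℂ)}
    (hq : q ∈ tauLT t
      (Subalgebra.toSubmodule ((brAlg slotVec).map (mapAlgHom (slotMap Sum.inl))))
      (Subalgebra.toSubmodule ((brAlg slotVec).map (mapAlgHom (slotMap Sum.inr))))) :
    umbralForm F q ∈ tauLT t (molSpan (F ∘ Sum.inl)) (molSpan (F ∘ Sum.inr)) := by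
  suffices h : tauLT t _ _ ≤ (tauLT t (molSpan (F ∘ Sum.inl)) (molSpan (F ∘ Sum.inr))).comap
    (umbralForm F) from h hq
  refine tauLT_le ?_
  rintro u hu _ ⟨p, hp, rfl⟩ _ ⟨q, hq, rfl⟩
  rw [Submodule.mem_comap]
  have h := umbralForm_tau F u p q
  refine (congrArg (· ∈ _) h).mpr ?_
  exact tau_mem_tauLT hu (mem_molSpan hp) (mem_molSpan hq)

/-- The converse of `tau_mem_molSpan`: the decomposition of bracket polynomials along two groups of
letters passes through the umbral evaluation, which commutes with `tau`. -/
lemma exists_mem_tauLT_of_mem_molSpan {F : ι ⊕ κ → MvPolynomial (Fin 2) A}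
    {x : MvPolynomial (Fin 2) A} (hx : x ∈ molSpan F) :
    ∃ t, x ∈ tauLT t (molSpan (F ∘ Sum.inl)) (molSpan (F ∘ Sum.inr)) := by
  obtain ⟨q, hq, rfl⟩ := hx
  obtain ⟨t, ht⟩ := exists_mem_tauLT_of_mem_brAlg hq
  exact ⟨t, umbralForm_mem_tauLT F ht⟩

lemma monomial_single_add_single {R : Type*} [CommRing R] (j k : ℕ) (a : R) :
    monomial (Finsupp.single 0 j + Finsupp.single 1 k) a =
      (C a * X 0 ^ j * X 1 ^ k : MvPolynomial (Fin 2) R) := by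
  rw [C_mul_X_pow_eq_monomial, X_pow_eq_monomial, monomial_mul, mul_one]

lemma sg_pow {R : Type*} [CommRing R] (v : Fin 2 → R) (m : ℕ) :
    sg v ^ m = ∑ j ∈ Finset.range (m + 1),
      monomial (Finsupp.single 0 j + Finsupp.single 1 (m - j))
        (m.choose j * (v 0 ^ j * v 1 ^ (m - j))) := by
  rw [sg, add_pow]
  refine Finset.sum_congr rfl fun j _ => ?_
  rw [monomial_single_add_single, mul_pow, mul_pow]
  simp only [C_mul, C_pow, map_natCast]
  ring

lemma homogeneousComponent_fin_two {R : Type*} [CommRing R] (m : ℕ) (F : MvPolynomial (Fin 2) R) :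
    homogeneousComponent m F = ∑ j ∈ Finset.range (m + 1),
      monomial (Finsupp.single 0 j + Finsupp.single 1 (m - j))
        (coeff (Finsupp.single 0 j + Finsupp.single 1 (m - j)) F) := by
  classical
  ext d
  have hd : d.degree = d 0 + d 1 := by simp [Finsupp.degree_eq_sum]
  have he (j k : ℕ) : Finsupp.single 0 j + Finsupp.single 1 k = d ↔ j = d 0 ∧ k = d 1 := by
    constructor
    · rintro rfl; simp
    · rintro ⟨rfl, rfl⟩
      ext c
      fin_cases c <;> simp
  rw [coeff_homogeneousComponent, coeff_sum, hd]
  simp only [coeff_monomial, he]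
  split_ifs with h
  · rw [Finset.sum_eq_single (d 0)]
    · rw [if_pos ⟨rfl, by omega⟩, (he (d 0) (m - d 0)).2 ⟨rfl, by omega⟩]
    · intro j _ hj
      rw [if_neg (fun h => hj h.1)]
    · intro hj
      exact absurd (Finset.mem_range.2 (by omega)) hj
  · refine (Finset.sum_eq_zero fun j hj => if_neg ?_).symm
    rintro ⟨h1, h2⟩
    have := Finset.mem_range.1 hj
    omega

lemma umbral_unit (F : MvPolynomial (Fin 2) A) (j k : ℕ) :
    umbral (fun _ : Unit => F) (X ((), 0) ^ j * X ((), 1) ^ k) =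
      ((j ! * k ! : ℕ) : ℂ) • coeff (Finsupp.single 0 j + Finsupp.single 1 k) F := by
  rw [X_pow_eq_monomial, X_pow_eq_monomial, monomial_mul, mul_one, umbral_monomial]
  simp

/-- The symbolic notation for a form: in the power of `ξ x + η y`, the binomial coefficients turn
the factorials of the umbral evaluation into the single factor `m !`. -/
lemma umbralForm_sg_pow (F : MvPolynomial (Fin 2) A) (m : ℕ) :
    umbralForm (fun _ : Unit => F) (sg (slotVec ()) ^ m) = (m ! : ℂ) • homogeneousComponent m F := by
  rw [sg_pow, homogeneousComponent_fin_two, map_sum, Finset.smul_sum]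
  refine Finset.sum_congr rfl fun j hj => ?_
  have hj' : j ≤ m := Nat.lt_succ_iff.1 (Finset.mem_range.1 hj)
  rw [umbralForm, mapCoeff_monomial, smul_monomial, ← nsmul_eq_mul, map_nsmul, slotVec, slotVec,
    umbral_unit, ← Nat.cast_smul_eq_nsmul ℂ, smul_smul, ← Nat.cast_mul, ← mul_assoc,
    Nat.choose_mul_factorial_mul_factorial hj']

lemma mem_molSpan_unit (F : MvPolynomial (Fin 2) A) : F ∈ molSpan (fun _ : Unit => F) := by
  rw [← sum_homogeneousComponent F]
  refine Submodule.sum_mem _ fun m _ => ?_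
  have h := Submodule.smul_mem _ ((m ! : ℂ)⁻¹)
    (mem_molSpan (F := fun _ : Unit => F) (Subalgebra.pow_mem _ (sg_mem_brAlg slotVec ()) m))
  rw [umbralForm_sg_pow, smul_smul, inv_mul_cancel₀ (Nat.cast_ne_zero.2 m.factorial_ne_zero),
    one_smul] at h
  rwa [sum_homogeneousComponent F]

lemma brAlg_unit_le {R : Type*} [CommRing R] [Algebra ℂ R] (v : Unit → Fin 2 → R) :
    Subalgebra.toSubmodule (brAlg v) ≤ Submodule.span ℂ (Set.range fun m : ℕ => sg (v ()) ^ m) := by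
  have h : brAlg v ≤ Algebra.adjoin ℂ {sg (v ())} := by
    refine Algebra.adjoin_le ?_
    rintro _ (⟨⟨i, j⟩, rfl⟩ | ⟨i, rfl⟩)
    · simp [dt_self]
    · exact Algebra.subset_adjoin rfl
  refine (Subalgebra.toSubmodule.monotone h).trans ?_
  rw [Algebra.adjoin_eq_span]
  refine Submodule.span_mono ?_
  intro x hx
  obtain ⟨m, rfl⟩ := Submonoid.mem_closure_singleton.1 hx
  exact ⟨m, rfl⟩

/-- The bracket of a letter with itself vanishes, so with one atom only the powers of its linear
form remain. -/
lemma molSpan_unit_le (F : Unit → MvPolynomial (Fin 2) A) :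
    molSpan F ≤ Submodule.span ℂ (Set.range fun m : ℕ => homogeneousComponent m (F ())) := by
  rw [molSpan, Submodule.map_le_iff_le_comap]
  refine (brAlg_unit_le _).trans (Submodule.span_le.2 ?_)
  rintro _ ⟨m, rfl⟩
  have h := umbralForm_sg_pow (F ()) m
  have h' : umbralForm F (sg (slotVec ()) ^ m) = _ := h
  rw [SetLike.mem_coe, Submodule.mem_comap, h']
  exact Submodule.smul_mem _ _ (Submodule.subset_span ⟨m, rfl⟩)

lemma exists_tau_sg_pow {R : Type*} [CommRing R] [Algebra ℂ R] (v w : Fin 2 → R) (t m l : ℕ) :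
    ∃ N : ℂ, N ≠ 0 ∧ dt v w ^ t * (sg v ^ m * sg w ^ l) =
      N • tau t (sg v ^ (m + t)) (sg w ^ (l + t)) := by
  induction t with
  | zero => exact ⟨1, one_ne_zero, by simp⟩
  | succ t ih =>
    obtain ⟨N, hN, h⟩ := ih
    have hne : (((m + t + 1) * (l + t + 1) : ℕ) : ℂ) ≠ 0 := Nat.cast_ne_zero.2 (by positivity)
    refine ⟨N * (((m + t + 1) * (l + t + 1) : ℕ) : ℂ)⁻¹, mul_ne_zero hN (inv_ne_zero hne), ?_⟩
    have h1 : tau (t + 1) (sg v ^ (m + (t + 1))) (sg w ^ (l + (t + 1))) =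
        (((m + t + 1) * (l + t + 1) : ℕ) : ℂ) •
          (dt v w * tau t (sg v ^ (m + t)) (sg w ^ (l + t))) := by
      have h2 (c : Fin 2) (v : Fin 2 → R) (k : ℕ) :
          pderiv c (sg v ^ (k + 1)) = ((k + 1 : ℕ) : ℂ) • (C (v c) * sg v ^ k) := by
        rw [pderiv_pow, pderiv_sg, Nat.cast_smul_eq_nsmul, nsmul_eq_mul, Nat.add_sub_cancel]
        ring
      rw [← add_assoc, ← add_assoc, tau_succ]
      simp only [h2, map_smul, LinearMap.smul_apply, tau_C_mul_left, tau_C_mul_right, smul_smul,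
        ← smul_sub, dt_eq, Nat.cast_mul]
      congr 1 <;> ring
    rw [h1, mul_smul, inv_smul_smul₀ hne, pow_succ', mul_assoc, h, mul_smul_comm]

lemma exists_umbralForm_two (F : Unit ⊕ Unit → MvPolynomial (Fin 2) A) (t m l : ℕ) :
    ∃ N : ℂ, N ≠ 0 ∧ umbralForm F (dt (slotVec (Sum.inl ())) (slotVec (Sum.inr ())) ^ t *
      (sg (slotVec (Sum.inl ())) ^ m * sg (slotVec (Sum.inr ())) ^ l)) =
        N • tau t (homogeneousComponent (m + t) (F (Sum.inl ())))
          (homogeneousComponent (l + t) (F (Sum.inr ()))) := by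
  obtain ⟨N, hN, h⟩ := exists_tau_sg_pow (slotVec (ι := Unit ⊕ Unit) (Sum.inl ()))
    (slotVec (Sum.inr ())) t m l
  refine ⟨N * (((m + t)! : ℂ) * ((l + t)! : ℂ)), mul_ne_zero hN (mul_ne_zero
    (Nat.cast_ne_zero.2 (Nat.factorial_ne_zero _)) (Nat.cast_ne_zero.2 (Nat.factorial_ne_zero _))),
    ?_⟩
  have h1 (f : Unit → Unit ⊕ Unit) (k : ℕ) : sg (slotVec (f ())) ^ k =
      mapAlgHom (slotMap f) (sg (slotVec ()) ^ k) := by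
    rw [map_pow]
    congr 1
    refine Eq.trans ?_ (map_sg _ _).symm
    congr 1
    funext c
    simp [slotMap, slotVec]
  have h2 := umbralForm_tau F t (sg (slotVec ()) ^ (m + t)) (sg (slotVec ()) ^ (l + t))
  rw [h, map_smul, h1 Sum.inl, h1 Sum.inr, h2]
  have h3 := umbralForm_sg_pow (F (Sum.inl ())) (m + t)
  have h4 := umbralForm_sg_pow (F (Sum.inr ())) (l + t)
  have h5 : umbralForm (F ∘ Sum.inl) (sg (slotVec ()) ^ (m + t)) = _ := h3
  have h6 : umbralForm (F ∘ Sum.inr) (sg (slotVec ()) ^ (l + t)) = _ := h4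
  rw [h5, h6, map_smul, map_smul, LinearMap.smul_apply, smul_smul, smul_smul, mul_assoc,
    mul_comm ((m + t)! : ℂ)]

end Umbral

/-! ### Umbral evaluation of products over the slots -/

section UmbralProd

variable {A : Type*} [CommRing A] [Algebra ℂ A] {ι : Type*} [Fintype ι]

/-- Both sides are multilinear in `q`, so it is enough to compare them on monomials, where the
exponents of the different slots do not interact. -/
lemma umbral_prod (F : ι → MvPolynomial (Fin 2) A) (q : ι → MvPolynomial (Unit × Fin 2) ℂ) :
    umbral F (∏ i, slotMap (fun _ => i) (q i)) = ∏ i, umbral (fun _ : Unit => F i) (q i) := by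
  classical
  let f : MultilinearMap ℂ (fun _ : ι => MvPolynomial (Unit × Fin 2) ℂ) A :=
    (umbral F).compMultilinearMap
      ((MultilinearMap.mkPiAlgebra ℂ ι (MvPolynomial (ι × Fin 2) ℂ)).compLinearMap
        fun i => (slotMap fun _ : Unit => i).toLinearMap)
  let g : MultilinearMap ℂ (fun _ : ι => MvPolynomial (Unit × Fin 2) ℂ) A :=
    (MultilinearMap.mkPiAlgebra ℂ ι A).compLinearMap fun i => umbral fun _ : Unit => F i
  suffices h : f = g from congrArg (fun k => k q) h
  refine Module.Basis.ext_multilinear (fun _ => basisMonomials (Unit × Fin 2) ℂ) fun m => ?_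
  simp only [f, g, coe_basisMonomials, LinearMap.compMultilinearMap_apply,
    MultilinearMap.compLinearMap_apply, MultilinearMap.mkPiAlgebra_apply, AlgHom.toLinearMap_apply]
  have h1 : ∏ i, slotMap (fun _ : Unit => i) (monomial (m i) (1 : ℂ)) =
      monomial (∑ i, Finsupp.mapDomain (Prod.map (fun _ : Unit => i) id) (m i)) 1 := by
    rw [monomial_sum_one]
    simp [slotMap, rename_monomial]
  rw [h1, umbral_monomial]
  refine Finset.prod_congr rfl fun i _ => ?_
  have h2 (c : Fin 2) : (∑ j, Finsupp.mapDomain (Prod.map (fun _ : Unit => j) id) (m j)) (i, c) =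
      m i ((), c) := by
    rw [Finsupp.finsetSum_apply, Finset.sum_eq_single i]
    · exact Finsupp.mapDomain_apply (f := Prod.map (fun _ : Unit => i) (id : Fin 2 → Fin 2))
        (by rintro ⟨⟨⟩, a⟩ ⟨⟨⟩, b⟩ h; simpa using h) (m i) ((), c)
    · intro j _ hj
      exact Finsupp.mapDomain_of_notMem_range _ _ (by rintro ⟨⟨⟨⟩, a⟩, h⟩; simp at h; exact hj h.1)
    · simp
  rw [h2, h2, umbral_monomial]
  simp

end UmbralProd

/-! ### Linear substitutions and the action of `SL₂` on the coordinate ring -/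

section Substitution

variable {R S : Type*} [CommRing R] [Algebra ℂ R] [CommRing S] [Algebra ℂ S]

/-- The substitution of linear forms with complex coefficients for the variables. -/
def linSubst (M : Matrix (Fin 2) (Fin 2) ℂ) : MvPolynomial (Fin 2) R →ₐ[R] MvPolynomial (Fin 2) R :=
  aeval fun i => map (algebraMap ℂ R) (∑ j, C (M i j) * X j)

lemma linSubst_X (M : Matrix (Fin 2) (Fin 2) ℂ) (i : Fin 2) :
    linSubst M (X i : MvPolynomial (Fin 2) R) =
      C (algebraMap ℂ R (M i 0)) * X 0 + C (algebraMap ℂ R (M i 1)) * X 1 := by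
  simp [linSubst, Fin.sum_univ_two]

lemma linSubst_C (M : Matrix (Fin 2) (Fin 2) ℂ) (r : R) : linSubst M (C r) = C r := by
  simp [linSubst]

lemma mapCoeff_linSubst (E : R →ₗ[ℂ] S) (M : Matrix (Fin 2) (Fin 2) ℂ)
    (P : MvPolynomial (Fin 2) R) : mapCoeff E (linSubst M P) = linSubst M (mapCoeff E P) :=
  mapCoeff_aeval E _ P

lemma map_linSubst (g : R →ₐ[ℂ] S) (M : Matrix (Fin 2) (Fin 2) ℂ) (P : MvPolynomial (Fin 2) R) :
    map g.toRingHom (linSubst M P) = linSubst M (map g.toRingHom P) :=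
  mapCoeff_linSubst g.toLinearMap M P

lemma eval_linSubst (M : Matrix (Fin 2) (Fin 2) ℂ) (v : Fin 2 → ℂ) (P : MvPolynomial (Fin 2) ℂ) :
    eval v (linSubst M P) = eval (M.mulVec v) P := by
  have h : (aeval v : MvPolynomial (Fin 2) ℂ →ₐ[ℂ] ℂ).comp (linSubst M) = aeval (M.mulVec v) := by
    ext i
    fin_cases i <;> simp [linSubst_X]
  exact AlgHom.congr_fun h P

lemma homogeneousComponent_aeval {σ τ : Type*} (s : σ → MvPolynomial τ R)
    (hs : ∀ i, (s i).IsHomogeneous 1) (d : ℕ) {B : Type*} [CommRing B] [Algebra B R]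
    (P : MvPolynomial σ B) :
    homogeneousComponent d (aeval s P) = aeval s (homogeneousComponent d P) := by
  classical
  have h (k : ℕ) : homogeneousComponent d (aeval s (homogeneousComponent k P)) =
      if d = k then aeval s (homogeneousComponent k P) else 0 := by
    refine homogeneousComponent_of_mem ?_
    rw [mem_homogeneousSubmodule]
    simpa using (homogeneousComponent_isHomogeneous k P).aeval s hs
  conv_lhs => rw [← sum_homogeneousComponent P, map_sum, map_sum]
  simp only [h]
  rw [Finset.sum_ite_eq]
  split_ifs with hd
  · rfl
  · rw [homogeneousComponent_eq_zero d P (by simpa [Nat.lt_succ_iff] using hd), map_zero]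

end Substitution

/-! ### The grading by the degree in the coefficients -/

section Degree

variable {n : ℕ}

/-- The component of degree `d` in the coefficients. -/
def degComp (d : ℕ) : CoordRing n →ₗ[ℂ] CoordRing n :=
  mapCoeff ((homogeneousComponent d).restrictScalars ℂ)

lemma isDegree_degComp (d : ℕ) (P : CoordRing n) : IsDegree d (degComp d P) := fun m => by
  rw [degComp, coeff_mapCoeff]
  exact homogeneousComponent_isHomogeneous d _

lemma degComp_of_isDegree {d k : ℕ} {P : CoordRing n} (h : IsDegree k P) :
    degComp d P = if d = k then P else 0 := by
  ext1 m
  rw [degComp, coeff_mapCoeff]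
  refine (homogeneousComponent_of_mem (h m)).trans ?_
  split_ifs <;> rfl

lemma degComp_self {d : ℕ} {P : CoordRing n} (h : IsDegree d P) : degComp d P = P := by
  rw [degComp_of_isDegree h, if_pos rfl]

lemma isDegree_add {d : ℕ} {P Q : CoordRing n} (hP : IsDegree d P) (hQ : IsDegree d Q) :
    IsDegree d (P + Q) := fun m => by
  rw [coeff_add]; exact (hP m).add (hQ m)

lemma isDegree_smul {d : ℕ} {P : CoordRing n} (c : ℂ) (hP : IsDegree d P) :
    IsDegree d (c • P) := fun m => by
  rw [coeff_smul, smul_eq_C_mul]; exact (hP m).C_mul c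

lemma isDegree_mul {d e : ℕ} {P Q : CoordRing n} (hP : IsDegree d P) (hQ : IsDegree e Q) :
    IsDegree (d + e) (P * Q) := fun m => by
  classical
  rw [coeff_mul]
  exact IsHomogeneous.sum _ _ _ fun x _ => (hP _).mul (hQ _)

lemma isDegree_one : IsDegree 0 (1 : CoordRing n) := fun m => by
  classical
  rw [coeff_one]
  split_ifs
  · exact isHomogeneous_one _ _
  · exact isHomogeneous_zero _ _ _

lemma isDegree_pow {d : ℕ} {P : CoordRing n} (hP : IsDegree d P) (k : ℕ) :
    IsDegree (k * d) (P ^ k) := by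
  induction k with
  | zero => simpa using isDegree_one
  | succ k ih => rw [pow_succ, add_mul, one_mul]; exact isDegree_mul ih hP

lemma isDegree_prod {α : Type*} (s : Finset α) (d : α → ℕ) (P : α → CoordRing n)
    (h : ∀ i ∈ s, IsDegree (d i) (P i)) : IsDegree (∑ i ∈ s, d i) (∏ i ∈ s, P i) := by
  classical
  induction s using Finset.induction_on with
  | empty => simpa using isDegree_one
  | insert i s hi ih =>
    rw [Finset.sum_insert hi, Finset.prod_insert hi]
    exact isDegree_mul (h i (Finset.mem_insert_self i s))
      (ih fun j hj => h j (Finset.mem_insert_of_mem hj))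

lemma exists_sum_degComp (P : CoordRing n) :
    ∃ N, P = ∑ d ∈ Finset.range N, degComp d P := by
  refine ⟨P.support.sup (fun m => (coeff m P).totalDegree) + 1, ?_⟩
  ext1 m
  rw [coeff_sum]
  by_cases hm : m ∈ P.support
  · have h1 : (coeff m P).totalDegree ≤ P.support.sup (fun m => (coeff m P).totalDegree) :=
      Finset.le_sup (f := fun m => (coeff m P).totalDegree) hm
    conv_lhs => rw [← sum_homogeneousComponent (coeff m P)]
    refine Finset.sum_subset (Finset.range_mono (Nat.succ_le_succ h1)) fun d _ hd => ?_
    exact homogeneousComponent_eq_zero _ _ (by simpa [Nat.lt_succ_iff] using hd)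
  · rw [notMem_support_iff] at hm
    simp [degComp, hm]

end Degree

/-! ### Invariance as an identity of polynomials -/

section Action

variable {n : ℕ}

lemma coeff_binaryForm {R : Type*} [CommRing R] (a : Fin (n + 1) → R) (i : Fin (n + 1)) :
    coeff (Finsupp.single 0 (n - (i : ℕ)) + Finsupp.single 1 (i : ℕ)) (binaryForm n a) =
      (n.choose i : R) * a i := by
  classical
  rw [binaryForm, coeff_sum, Finset.sum_eq_single i]
  · rw [← monomial_single_add_single, coeff_monomial, if_pos rfl]
  · intro j _ hj
    rw [← monomial_single_add_single, coeff_monomial, if_neg]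
    intro h
    have := DFunLike.congr_fun h 1
    simp at this
    exact hj (Fin.ext this)
  · simp

lemma isHomogeneous_binaryForm {R : Type*} [CommRing R] (a : Fin (n + 1) → R) :
    (binaryForm n a).IsHomogeneous n := by
  refine IsHomogeneous.sum _ _ _ fun i _ => ?_
  rw [← monomial_single_add_single]
  refine isHomogeneous_monomial _ ?_
  have := i.2
  simp [Finsupp.degree_eq_sum]
  omega

lemma choose_ne_zero (i : Fin (n + 1)) : (n.choose (i : ℕ) : ℂ) ≠ 0 :=
  Nat.cast_ne_zero.2 (Nat.choose_pos (Nat.lt_succ_iff.1 i.2)).ne'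

lemma isDegree_genericForm : IsDegree 1 (genericForm n) := fun m => by
  classical
  rw [genericForm, binaryForm, coeff_sum]
  refine IsHomogeneous.sum _ _ _ fun i _ => ?_
  rw [← monomial_single_add_single, coeff_monomial]
  split_ifs
  · rw [← map_natCast C, ]
    exact (isHomogeneous_X ℂ i).C_mul _
  · exact isHomogeneous_zero _ _ _

/-- The action of `g` on the coefficients of the general form. -/
def genAct (g : Matrix.SpecialLinearGroup (Fin 2) ℂ) :
    MvPolynomial (Fin (n + 1)) ℂ →ₐ[ℂ] MvPolynomial (Fin (n + 1)) ℂ :=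
  aeval (formCoeff n (linSubst
    ((g⁻¹ : Matrix.SpecialLinearGroup (Fin 2) ℂ) : Matrix (Fin 2) (Fin 2) ℂ) (genericForm n)))

lemma slAct_eq (g : Matrix.SpecialLinearGroup (Fin 2) ℂ) (a : Fin (n + 1) → ℂ) :
    slAct g a = formCoeff n (linSubst
      ((g⁻¹ : Matrix.SpecialLinearGroup (Fin 2) ℂ) : Matrix (Fin 2) (Fin 2) ℂ)
      (binaryForm n a)) := by
  rw [slAct, linSubst, Algebra.algebraMap_self]
  simp only [map_id]

lemma map_formCoeff {R S : Type*} [CommRing R] [Algebra ℂ R] [CommRing S] [Algebra ℂ S]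
    (g : R →ₐ[ℂ] S) (F : MvPolynomial (Fin 2) R) (i : Fin (n + 1)) :
    g (formCoeff n F i) = formCoeff n (map g.toRingHom F) i := by
  rw [formCoeff, formCoeff, map_smul, coeff_map]
  rfl

lemma map_binaryForm {R S : Type*} [CommRing R] [CommRing S] (g : R →+* S)
    (a : Fin (n + 1) → R) : map g (binaryForm n a) = binaryForm n fun i => g (a i) := by
  simp [binaryForm]

lemma eval_genAct (g : Matrix.SpecialLinearGroup (Fin 2) ℂ) (a : Fin (n + 1) → ℂ)
    (P : MvPolynomial (Fin (n + 1)) ℂ) : eval a (genAct g P) = eval (slAct g a) P := by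
  have h : (aeval a : MvPolynomial (Fin (n + 1)) ℂ →ₐ[ℂ] ℂ).comp (genAct g) =
      aeval (slAct g a) := by
    refine algHom_ext fun i => ?_
    rw [AlgHom.comp_apply, genAct, aeval_X, aeval_X, map_formCoeff, map_linSubst, genericForm,
      map_binaryForm, slAct_eq]
    simp
  exact AlgHom.congr_fun h P

/-- The action of `g` on the coordinate ring of `S_n ⊕ ℂ²`. -/
def coordAct (g : Matrix.SpecialLinearGroup (Fin 2) ℂ) (P : CoordRing n) : CoordRing n :=
  linSubst (g : Matrix (Fin 2) (Fin 2) ℂ) (map (genAct g).toRingHom P)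

lemma evalAt_coordAct (g : Matrix.SpecialLinearGroup (Fin 2) ℂ) (a : Fin (n + 1) → ℂ)
    (v : Fin 2 → ℂ) (P : CoordRing n) : evalAt a v (coordAct g P) =
      evalAt (slAct g a) ((g : Matrix (Fin 2) (Fin 2) ℂ).mulVec v) P := by
  have h1 := map_linSubst (aeval a : MvPolynomial (Fin (n + 1)) ℂ →ₐ[ℂ] ℂ)
    (g : Matrix (Fin 2) (Fin 2) ℂ) (map (genAct g).toRingHom P)
  have h2 : evalAt a v (coordAct g P) = eval v (map
    (aeval a : MvPolynomial (Fin (n + 1)) ℂ →ₐ[ℂ] ℂ).toRingHom (coordAct g P)) := rfl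
  rw [h2, coordAct, h1, eval_linSubst, map_map]
  have h3 : (aeval a : MvPolynomial (Fin (n + 1)) ℂ →ₐ[ℂ] ℂ).toRingHom.comp (genAct g).toRingHom =
      eval (slAct g a) := RingHom.ext fun Q => eval_genAct g a Q
  rw [h3]
  rfl

lemma evalAt_ext {P Q : CoordRing n} (h : ∀ a v, evalAt a v P = evalAt a v Q) : P = Q := by
  ext1 m
  refine MvPolynomial.funext fun a => ?_
  rw [← coeff_map, ← coeff_map]
  congr 1
  exact MvPolynomial.funext fun v => h a v

/-- A polynomial over `ℂ` is determined by its values, so pointwise invariance becomes invariance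
under an operator on the coordinate ring. -/
lemma mem_Cov_iff {P : CoordRing n} : P ∈ Cov n ↔ ∀ g, coordAct g P = P := by
  constructor
  · intro h g
    refine evalAt_ext fun a v => ?_
    rw [evalAt_coordAct, h g a v]
  · intro h g a v
    rw [← evalAt_coordAct, h g]

lemma coordAct_homogeneousComponent (g : Matrix.SpecialLinearGroup (Fin 2) ℂ) (m : ℕ)
    (P : CoordRing n) :
    coordAct g (homogeneousComponent m P) = homogeneousComponent m (coordAct g P) := by
  rw [coordAct, coordAct, linSubst, homogeneousComponent_aeval]
  · congr 1
    exact mapCoeff_homogeneousComponent (genAct g).toLinearMap m P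
  · intro i
    refine IsHomogeneous.map (IsHomogeneous.sum _ _ _ fun j _ => ?_) _
    exact isHomogeneous_C_mul_X _ _

lemma homogeneousComponent_mem_Cov {P : CoordRing n} (h : P ∈ Cov n) (m : ℕ) :
    homogeneousComponent m P ∈ Cov n := by
  rw [mem_Cov_iff] at h ⊢
  intro g
  rw [coordAct_homogeneousComponent, h]

lemma degComp_linSubst (M : Matrix (Fin 2) (Fin 2) ℂ) (d : ℕ) (P : CoordRing n) :
    degComp d (linSubst M P) = linSubst M (degComp d P) := mapCoeff_linSubst _ M P

/-- The action replaces each coefficient of the form by a linear combination of the coefficients and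
hence respects the degree. -/
lemma degComp_mem_Cov {P : CoordRing n} (h : P ∈ Cov n) (d : ℕ) : degComp d P ∈ Cov n := by
  rw [mem_Cov_iff] at h ⊢
  intro g
  conv_rhs => rw [← h g]
  rw [coordAct, coordAct, degComp_linSubst]
  congr 1
  ext1 m
  rw [degComp, coeff_map, coeff_mapCoeff, coeff_mapCoeff, coeff_map]
  refine (homogeneousComponent_aeval _ (fun i => ?_) d _).symm
  rw [formCoeff, smul_eq_C_mul]
  refine IsHomogeneous.C_mul ?_ _
  have h1 := isDegree_degComp 1 (linSubst
    ((g⁻¹ : Matrix.SpecialLinearGroup (Fin 2) ℂ) : Matrix (Fin 2) (Fin 2) ℂ) (genericForm n))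
  rw [degComp_linSubst, degComp_self isDegree_genericForm] at h1
  exact h1 _

end Action

/-! ### Equivariance of the umbral evaluation -/

section Equivariance

variable {n : ℕ} {ι : Type*}

lemma coeff_sg_pow {R : Type*} [CommRing R] (v : Fin 2 → R) (j k : ℕ) :
    coeff (Finsupp.single 0 j + Finsupp.single 1 k) (sg v ^ (j + k)) =
      ((j + k).choose j : R) * (v 0 ^ j * v 1 ^ k) := by
  classical
  rw [sg_pow, coeff_sum, Finset.sum_eq_single j]
  · rw [Nat.add_sub_cancel_left, coeff_monomial, if_pos rfl]
  · intro i _ hi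
    rw [coeff_monomial, if_neg]
    intro h
    have := DFunLike.congr_fun h 0
    simp at this
    exact hi this
  · intro h
    exact absurd (Finset.mem_range.2 (by omega)) h

/-- The substitution of a matrix into the umbral letters of every slot. -/
def actLetters (h : Matrix (Fin 2) (Fin 2) ℂ) :
    MvPolynomial (ι × Fin 2) ℂ →ₐ[ℂ] MvPolynomial (ι × Fin 2) ℂ :=
  aeval fun p => C (h p.2 0) * X (p.1, 0) + C (h p.2 1) * X (p.1, 1)

lemma actLetters_X (h : Matrix (Fin 2) (Fin 2) ℂ) (i : ι) (c : Fin 2) :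
    actLetters h (X (i, c)) = C (h c 0) * X (i, 0) + C (h c 1) * X (i, 1) := by
  simp [actLetters]

lemma slotMap_actLetters {ζ : Type*} (h : Matrix (Fin 2) (Fin 2) ℂ) (f : ι → ζ)
    (r : MvPolynomial (ι × Fin 2) ℂ) :
    slotMap f (actLetters h r) = actLetters h (slotMap f r) := by
  suffices e : (slotMap f).comp (actLetters h) = (actLetters h).comp (slotMap f) from
    AlgHom.congr_fun e r
  refine algHom_ext fun p => ?_
  simp [actLetters, slotMap]

lemma linSubst_sg_slotVec (M : Matrix (Fin 2) (Fin 2) ℂ) (i : ι) :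
    linSubst M (sg (slotVec i)) = sg fun c => actLetters M.transpose (slotVec i c) := by
  simp only [sg, map_add, map_mul, linSubst_C, linSubst_X, slotVec, actLetters_X,
    Matrix.transpose_apply, MvPolynomial.algebraMap_eq]
  ring

lemma linSubst_smul {R : Type*} [CommRing R] [Algebra ℂ R] (M : Matrix (Fin 2) (Fin 2) ℂ) (c : ℂ)
    (P : MvPolynomial (Fin 2) R) : linSubst M (c • P) = c • linSubst M P :=
  map_smul ((linSubst M).restrictScalars ℂ) c P

/-- Substituting `M` for the variables of `ξ x + η y` has the same effect as substituting the
transpose of `M` for the letters. Applied to the power of exponent `j + k`, and read on the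
coefficient of `x ^ j * y ^ k`, this compares the two actions. -/
lemma genAct_umbral_unit (g : Matrix.SpecialLinearGroup (Fin 2) ℂ)
    (r : MvPolynomial (Unit × Fin 2) ℂ) :
    genAct g (umbral (fun _ : Unit => genericForm n) r) = umbral (fun _ : Unit => genericForm n)
      (actLetters
        ((g⁻¹ : Matrix.SpecialLinearGroup (Fin 2) ℂ) : Matrix (Fin 2) (Fin 2) ℂ).transpose r) := by
  set M := ((g⁻¹ : Matrix.SpecialLinearGroup (Fin 2) ℂ) : Matrix (Fin 2) (Fin 2) ℂ) with hM
  set U := umbral (fun _ : Unit => genericForm n)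
  suffices e : (genAct g).toLinearMap ∘ₗ U = U ∘ₗ (actLetters M.transpose).toLinearMap from
    LinearMap.congr_fun e r
  refine linearMap_ext_monomial fun d => ?_
  obtain ⟨j, hj⟩ : ∃ j, d ((), 0) = j := ⟨_, rfl⟩
  obtain ⟨k, hk⟩ : ∃ k, d ((), 1) = k := ⟨_, rfl⟩
  have hd : monomial d (1 : ℂ) = X ((), 0) ^ j * X ((), 1) ^ k := by
    rw [X_pow_eq_monomial, X_pow_eq_monomial, monomial_mul, mul_one]
    refine congrArg (fun e => monomial e (1 : ℂ)) (Finsupp.ext ?_)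
    rintro ⟨⟨⟩, c⟩
    fin_cases c <;> simp [hj, hk]
  rw [hd]
  simp only [LinearMap.comp_apply, AlgHom.toLinearMap_apply, map_mul, map_pow]
  have h1 : ((j + k).choose j : ℂ) • U (actLetters M.transpose (X ((), 0)) ^ j *
        actLetters M.transpose (X ((), 1)) ^ k) = ((j + k)! : ℂ) •
      coeff (Finsupp.single 0 j + Finsupp.single 1 k)
        (linSubst M (homogeneousComponent (j + k) (genericForm n))) := by
    have h2 := congrArg (coeff (Finsupp.single 0 j + Finsupp.single 1 k))
      (mapCoeff_linSubst U M (sg (slotVec ()) ^ (j + k)))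
    have h3 : mapCoeff U (sg (slotVec ()) ^ (j + k)) = _ :=
      umbralForm_sg_pow (genericForm n) (j + k)
    rw [h3, map_pow, linSubst_sg_slotVec, coeff_mapCoeff, coeff_sg_pow, ← nsmul_eq_mul,
      map_nsmul, ← Nat.cast_smul_eq_nsmul ℂ, linSubst_smul, coeff_smul] at h2
    exact h2
  have hc : ((j + k).choose j : ℂ) ≠ 0 :=
    Nat.cast_ne_zero.2 (Nat.choose_pos (Nat.le_add_right j k)).ne'
  have h4 := umbral_unit (genericForm n) j k
  change U _ = _ at h4
  rw [h4, map_smul]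
  apply smul_right_injective _ hc
  dsimp only
  rw [h1, smul_smul, ← Nat.cast_mul, ← mul_assoc]
  have h5 := Nat.choose_mul_factorial_mul_factorial (Nat.le_add_right j k)
  rw [Nat.add_sub_cancel_left] at h5
  rw [h5]
  congr 1
  -- Only monomials of degree `n` have a nonzero value, the general form being homogeneous of order
  -- `n`.
  by_cases hjk : j + k = n
  · obtain rfl : j = n - k := by omega
    have hkn : k ≤ n := by omega
    have hhom : (genericForm n).IsHomogeneous n := isHomogeneous_binaryForm X
    rw [hjk, homogeneousComponent_eq_self hhom]
    have h6 := coeff_binaryForm (n := n) (X : Fin (n + 1) → MvPolynomial (Fin (n + 1)) ℂ)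
      ⟨k, Nat.lt_succ_iff.2 hkn⟩
    rw [genericForm]
    rw [h6, map_mul, map_natCast, genAct, aeval_X, formCoeff]
    rw [← nsmul_eq_mul, ← Nat.cast_smul_eq_nsmul ℂ, smul_smul,
      mul_inv_cancel₀ (choose_ne_zero ⟨k, Nat.lt_succ_iff.2 hkn⟩), one_smul]
    rfl
  · have h6 : (genericForm n).IsHomogeneous n := isHomogeneous_binaryForm X
    rw [h6.coeff_eq_zero, map_zero, homogeneousComponent_of_mem (n := n) h6, if_neg hjk,
      map_zero, coeff_zero]
    simpa [Finsupp.degree_eq_sum] using hjk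

variable [Fintype ι]

lemma span_slotProd : Submodule.span ℂ (Set.range fun q : ι → MvPolynomial (Unit × Fin 2) ℂ =>
    ∏ i, slotMap (fun _ : Unit => i) (q i)) = ⊤ := by
  classical
  rw [eq_top_iff]
  rintro r -
  induction r using MvPolynomial.induction_on' with
  | add p q hp hq => exact add_mem hp hq
  | monomial m a =>
    have h1 : monomial m a = a • monomial m (1 : ℂ) := by rw [smul_monomial, smul_eq_mul, mul_one]
    rw [h1]
    refine Submodule.smul_mem _ _ (Submodule.subset_span ⟨fun i => ∏ c, X ((), c) ^ m (i, c), ?_⟩)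
    have h2 : monomial m (1 : ℂ) = ∏ p : ι × Fin 2, X p ^ m p := by
      rw [monomial_eq, C_1, one_mul, Finsupp.prod_fintype _ _ (fun _ => pow_zero _)]
    rw [h2, Fintype.prod_prod_type]
    simp [slotMap]

lemma genAct_umbral (g : Matrix.SpecialLinearGroup (Fin 2) ℂ) (r : MvPolynomial (ι × Fin 2) ℂ) :
    genAct g (umbral (fun _ : ι => genericForm n) r) = umbral (fun _ : ι => genericForm n)
      (actLetters
        ((g⁻¹ : Matrix.SpecialLinearGroup (Fin 2) ℂ) : Matrix (Fin 2) (Fin 2) ℂ).transpose r) := by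
  set M := ((g⁻¹ : Matrix.SpecialLinearGroup (Fin 2) ℂ) : Matrix (Fin 2) (Fin 2) ℂ) with hM
  have hr : r ∈ Submodule.span ℂ (Set.range fun q : ι → MvPolynomial (Unit × Fin 2) ℂ =>
    ∏ i, slotMap (fun _ : Unit => i) (q i)) := by rw [span_slotProd]; trivial
  induction hr using Submodule.span_induction with
  | zero => simp
  | add x y _ _ hx hy => simp only [map_add, hx, hy]
  | smul c x _ hx => simp only [map_smul, hx]
  | mem x hx =>
    obtain ⟨q, rfl⟩ := hx
    simp only [map_prod, ← slotMap_actLetters, umbral_prod, genAct_umbral_unit, ← hM]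

/-- The simultaneous action on the umbral letters and on the variables. -/
def actForm (g : Matrix.SpecialLinearGroup (Fin 2) ℂ) :
    MvPolynomial (Fin 2) (MvPolynomial (ι × Fin 2) ℂ) →ₐ[ℂ]
      MvPolynomial (Fin 2) (MvPolynomial (ι × Fin 2) ℂ) :=
  ((linSubst (g : Matrix (Fin 2) (Fin 2) ℂ)).restrictScalars ℂ).comp (mapAlgHom (actLetters
    ((g⁻¹ : Matrix.SpecialLinearGroup (Fin 2) ℂ) : Matrix (Fin 2) (Fin 2) ℂ).transpose))

omit [Fintype ι] in
lemma actForm_apply (g : Matrix.SpecialLinearGroup (Fin 2) ℂ)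
    (q : MvPolynomial (Fin 2) (MvPolynomial (ι × Fin 2) ℂ)) :
    actForm g q = linSubst (g : Matrix (Fin 2) (Fin 2) ℂ) (map (actLetters
      ((g⁻¹ : Matrix.SpecialLinearGroup (Fin 2) ℂ) :
        Matrix (Fin 2) (Fin 2) ℂ).transpose).toRingHom q) := rfl

lemma coordAct_umbralForm (g : Matrix.SpecialLinearGroup (Fin 2) ℂ)
    (q : MvPolynomial (Fin 2) (MvPolynomial (ι × Fin 2) ℂ)) :
    coordAct g (umbralForm (fun _ : ι => genericForm n) q) =
      umbralForm (fun _ : ι => genericForm n) (actForm g q) := by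
  rw [actForm_apply, umbralForm, mapCoeff_linSubst, coordAct]
  refine congrArg _ ?_
  ext1 m
  rw [coeff_map, coeff_mapCoeff, coeff_mapCoeff, coeff_map]
  exact genAct_umbral g _

omit [Fintype ι] in
lemma actForm_of_mem_brAlg (g : Matrix.SpecialLinearGroup (Fin 2) ℂ)
    {q : MvPolynomial (Fin 2) (MvPolynomial (ι × Fin 2) ℂ)} (hq : q ∈ brAlg slotVec) :
    actForm g q = q := by
  have hdet : (g : Matrix (Fin 2) (Fin 2) ℂ) 0 0 * (g : Matrix (Fin 2) (Fin 2) ℂ) 1 1 -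
      (g : Matrix (Fin 2) (Fin 2) ℂ) 0 1 * (g : Matrix (Fin 2) (Fin 2) ℂ) 1 0 = 1 := by
    rw [← Matrix.det_fin_two]; exact g.2
  have hdet' : (C (C ((g : Matrix (Fin 2) (Fin 2) ℂ) 0 0)) *
      C (C ((g : Matrix (Fin 2) (Fin 2) ℂ) 1 1)) - C (C ((g : Matrix (Fin 2) (Fin 2) ℂ) 0 1)) *
      C (C ((g : Matrix (Fin 2) (Fin 2) ℂ) 1 0)) :
        MvPolynomial (Fin 2) (MvPolynomial (ι × Fin 2) ℂ)) = 1 := by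
    rw [← C_mul, ← C_mul, ← C_mul, ← C_mul, ← C_sub, ← C_sub, hdet, C_1, C_1]
  suffices h : brAlg slotVec ≤ AlgHom.equalizer (actForm (ι := ι) g) (AlgHom.id ℂ _) from h hq
  refine Algebra.adjoin_le ?_
  rintro _ (⟨⟨i, j⟩, rfl⟩ | ⟨i, rfl⟩)
  · rw [SetLike.mem_coe, AlgHom.mem_equalizer, AlgHom.id_apply, actForm_apply, map_dt, dt_eq]
    simp only [map_sub, map_mul, linSubst_C, dt_eq, slotVec, AlgHom.toRingHom_eq_coe,
      RingHom.coe_coe, actLetters_X, Matrix.SpecialLinearGroup.coe_inv, Matrix.adjugate_fin_two,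
      Matrix.transpose_apply, Matrix.of_apply, Matrix.cons_val_zero, Matrix.cons_val_one,
      map_add, map_neg]
    linear_combination (C (X (i, 0)) * C (X (j, 1)) - C (X (i, 1)) * C (X (j, 0))) * hdet'
  · rw [SetLike.mem_coe, AlgHom.mem_equalizer, AlgHom.id_apply, actForm_apply, map_sg, sg]
    simp only [map_add, map_mul, linSubst_C, linSubst_X, slotVec, AlgHom.toRingHom_eq_coe,
      RingHom.coe_coe, actLetters_X, Matrix.SpecialLinearGroup.coe_inv, Matrix.adjugate_fin_two,
      Matrix.transpose_apply, Matrix.of_apply, Matrix.cons_val_zero, Matrix.cons_val_one,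
      map_neg, MvPolynomial.algebraMap_eq, sg]
    linear_combination (C (X (i, 0)) * X 0 + C (X (i, 1)) * X 1) * hdet'

/-- Brackets have determinant weight and the linear forms pair letters with variables
contragrediently; both are therefore fixed by the simultaneous action, with which the evaluation is
compatible. -/
lemma molSpan_le_Cov :
    molSpan (fun _ : ι => genericForm n) ≤ Subalgebra.toSubmodule (Cov n) := by
  rintro _ ⟨q, hq, rfl⟩
  rw [Subalgebra.mem_toSubmodule, mem_Cov_iff]
  intro g
  rw [coordAct_umbralForm, actForm_of_mem_brAlg g hq]

lemma umbralForm_isDegree (q : MvPolynomial (Fin 2) (MvPolynomial (ι × Fin 2) ℂ)) :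
    IsDegree (Fintype.card ι) (umbralForm (fun _ : ι => genericForm n) q) := by
  intro m
  rw [umbralForm, coeff_mapCoeff]
  generalize coeff m q = r
  induction r using MvPolynomial.induction_on' with
  | add p q hp hq => rw [map_add]; exact hp.add hq
  | monomial m a =>
    have h1 : monomial m a = a • monomial m (1 : ℂ) := by rw [smul_monomial, smul_eq_mul, mul_one]
    rw [h1, map_smul, umbral_monomial, smul_eq_C_mul]
    refine IsHomogeneous.C_mul ?_ _
    have h2 : Fintype.card ι = ∑ _i : ι, 1 := by simp
    rw [h2]
    refine IsHomogeneous.prod _ _ _ fun i _ => ?_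
    rw [smul_eq_C_mul]
    exact (isDegree_genericForm _).C_mul _

end Equivariance

/-! ### The first fundamental theorem -/

section FirstFundamental

variable {n : ℕ} {ι : Type*}

/-- The umbral letters of the slots, and the variables as a further letter, as vectors. -/
def formVec : Option ι → Fin 2 → MvPolynomial (Fin 2) (MvPolynomial (ι × Fin 2) ℂ)
  | some i => fun c => C (X (i, c))
  | none => ![-X 1, X 0]

/-- This is the reason for the vector `(-y, x)`: it transforms by the same matrix as the umbral
letters, so the variables count as one more letter, and the brackets involving it are the linear
forms up to sign. -/
lemma actForm_formVec (g : Matrix.SpecialLinearGroup (Fin 2) ℂ) (u : Option ι) (c : Fin 2) :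
    actForm g (formVec u c) =
      algebraMap ℂ _ (((g⁻¹ : Matrix.SpecialLinearGroup (Fin 2) ℂ) :
          Matrix (Fin 2) (Fin 2) ℂ) 0 c) * formVec u 0 +
      algebraMap ℂ _ (((g⁻¹ : Matrix.SpecialLinearGroup (Fin 2) ℂ) :
          Matrix (Fin 2) (Fin 2) ℂ) 1 c) * formVec u 1 := by
  rcases u with _ | i
  · rw [actForm_apply]
    fin_cases c <;>
    simp [formVec, linSubst_X, Matrix.SpecialLinearGroup.coe_inv, Matrix.adjugate_fin_two,
      MvPolynomial.algebraMap_apply, MvPolynomial.algebraMap_eq] <;> ring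
  · rw [actForm_apply]
    simp [formVec, actLetters_X, MvPolynomial.algebraMap_apply,
      MvPolynomial.algebraMap_eq]

lemma dt_formVec_mem (u u' : Option ι) :
    formVec u 0 * formVec u' 1 - formVec u 1 * formVec u' 0 ∈ brAlg (slotVec (ι := ι)) := by
  rcases u with _ | i <;> rcases u' with _ | j
  · convert zero_mem (brAlg (slotVec (ι := ι))) using 1
    simp [formVec]; ring
  · convert neg_mem (sg_mem_brAlg (slotVec (ι := ι)) j) using 1
    simp [formVec, sg, slotVec]; ring
  · convert sg_mem_brAlg (slotVec (ι := ι)) i using 1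
    simp [formVec, sg, slotVec]; ring
  · convert dt_mem_brAlg (slotVec (ι := ι)) i j using 1
    simp [formVec, dt_eq, slotVec]

/-- Each `Ω` consumes one letter on either side, and there are `2 * w` letters in all. So after `w`
steps nothing but brackets is left; if the two sides are of different size, the result is zero. -/
lemma tau_formVec_mem [DecidableEq ι] (w : ℕ) (s s' : Multiset (Option ι))
    (h : Multiset.card s + Multiset.card s' = 2 * w) :
    ∃ b ∈ brAlg (slotVec (ι := ι)), tau w (sgProd formVec s) (sgProd formVec s') = C b := by
  suffices hs : tau w (sgProd formVec s) (sgProd formVec s') ∈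
      (brAlg (slotVec (ι := ι))).map (Algebra.ofId _ (MvPolynomial (Fin 2)
        (MvPolynomial (Fin 2) (MvPolynomial (ι × Fin 2) ℂ))) |>.restrictScalars ℂ) by
    obtain ⟨b, hb, h⟩ := hs
    exact ⟨b, hb, h.symm⟩
  induction w generalizing s s' with
  | zero =>
    have h1 : s = 0 := Multiset.card_eq_zero.1 (by omega)
    have h2 : s' = 0 := Multiset.card_eq_zero.1 (by omega)
    subst h1 h2
    simp
  | succ w ih =>
    rw [tau_succ_sgProd]
    refine multiset_sum_mem _ fun x hx => ?_
    obtain ⟨a, ha, rfl⟩ := Multiset.mem_map.1 hx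
    refine multiset_sum_mem _ fun x hx => ?_
    obtain ⟨b, hb, rfl⟩ := Multiset.mem_map.1 hx
    refine mul_mem ⟨_, dt_formVec_mem a b, rfl⟩ (ih _ _ ?_)
    have h1 := Multiset.card_erase_add_one ha
    have h2 := Multiset.card_erase_add_one hb
    omega

/-- The determinant of the generic matrix. -/
def genDet (R : Type*) [CommRing R] : MvPolynomial (Fin 2 × Fin 2) R :=
  X (0, 0) * X (1, 1) - X (0, 1) * X (1, 0)

/-- Cayley's identity for the generic `2 × 2` determinant. Its factor is positive, so that `Ω ^ w`
sends the `w`-th power of the determinant to a nonzero constant. -/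
lemma cayley_genDet_pow {R : Type*} [CommRing R] (s : ℕ) :
    cayley (0 : Fin 2) 1 (genDet R ^ (s + 1)) =
      (((s + 1) * (s + 2) : ℕ) : MvPolynomial (Fin 2 × Fin 2) R) * genDet R ^ s := by
  have h00 : pderiv (0, 0) (genDet R) = X (1, 1) := by simp [genDet, pderiv_X]
  have h01 : pderiv (0, 1) (genDet R) = -X (1, 0) := by simp [genDet, pderiv_X]
  have h10 : pderiv (1, 0) (genDet R) = -X (0, 1) := by simp [genDet, pderiv_X]
  have h11 : pderiv (1, 1) (genDet R) = X (0, 0) := by simp [genDet, pderiv_X]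
  have hn (i : Fin 2 × Fin 2) (k : ℕ) : pderiv i (k : MvPolynomial (Fin 2 × Fin 2) R) = 0 := by
    rw [← map_natCast C, pderiv_C]
  rw [cayley_apply]
  rcases s with _ | s
  · simp only [zero_add, pow_one, pow_zero, h11, h10, map_neg, pderiv_X_self]
    norm_num
  · simp only [pderiv_pow, pderiv_mul, h00, h01, h10, h11, hn, Nat.add_sub_cancel, map_neg,
      pderiv_X_self]
    push_cast
    rw [show genDet R ^ (s + 1) = genDet R ^ s * (X (0, 0) * X (1, 1) - X (0, 1) * X (1, 0)) from
      pow_succ _ _]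
    simp
    ring

lemma exists_cayley_pow_genDet {R : Type*} [CommRing R] (w : ℕ) :
    ∃ N : ℕ, N ≠ 0 ∧ (cayley (0 : Fin 2) 1 ^ w) (genDet R ^ w) =
      (N : MvPolynomial (Fin 2 × Fin 2) R) := by
  induction w with
  | zero => exact ⟨1, one_ne_zero, by simp⟩
  | succ w ih =>
    obtain ⟨N, hN, h⟩ := ih
    refine ⟨(w + 1) * (w + 2) * N, by positivity, ?_⟩
    rw [pow_succ, Module.End.mul_apply, cayley_genDet_pow, ← map_natCast C, cayley_pow_C_mul, h,
      map_natCast, ← Nat.cast_mul]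

lemma mapCoeff_aeval_const {R A σ : Type*} [CommRing R] [Algebra ℂ R] [CommRing A] [Algebra ℂ A]
    (E : R →ₗ[ℂ] A) (h : σ → ℂ) (Z : MvPolynomial σ R) :
    E (aeval (fun i => algebraMap ℂ R (h i)) Z) =
      aeval (fun i => algebraMap ℂ A (h i)) (mapCoeff E Z) := by
  induction Z using MvPolynomial.induction_on' with
  | monomial m r =>
    simp only [mapCoeff_monomial, aeval_monomial, Finsupp.prod, ← map_pow, ← map_prod,
      Algebra.algebraMap_self, RingHom.id_apply]
    rw [mul_comm r, ← Algebra.smul_def, map_smul, Algebra.smul_def, mul_comm]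
  | add p q hp hq => simp only [map_add, hp, hq]

lemma eq_zero_of_aeval_const {σ : Type*} (Z : MvPolynomial σ (CoordRing n))
    (h : ∀ x : σ → ℂ, aeval (fun i => algebraMap ℂ (CoordRing n) (x i)) Z = 0) : Z = 0 := by
  ext1 m
  rw [coeff_zero]
  refine evalAt_ext fun a v => ?_
  rw [← coeff_map, map_zero]
  suffices h1 : map (evalAt a v) Z = 0 by rw [h1, coeff_zero]
  refine MvPolynomial.funext fun x => ?_
  have h2 := congrArg (evalAt a v) (h x)
  rw [map_zero, map_aeval] at h2
  rw [map_zero, eval_map, ← h2]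
  have h3 : (fun i => evalAt a v (algebraMap ℂ (CoordRing n) (x i))) = x := by
    funext i
    simp [evalAt, MvPolynomial.algebraMap_apply]
  rw [h3]
  rfl

lemma aeval_smul_of_isHomogeneous {σ R : Type*} [CommRing R] [Algebra ℂ R] {N : ℕ}
    {Q : MvPolynomial σ ℂ} (hQ : Q.IsHomogeneous N) (c : ℂ) (f : σ → R) :
    aeval (fun i => c • f i) Q = c ^ N • aeval f Q := by
  rw [aeval_def, eval₂_eq, aeval_def, eval₂_eq, Finset.smul_sum]
  refine Finset.sum_congr rfl fun m hm => ?_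
  have h1 : ∑ i ∈ m.support, m i = N := by
    have := hQ (mem_support_iff.1 hm)
    rwa [Finsupp.weight_apply, Finsupp.sum, Finset.sum_congr rfl (g := m)] at this
    intro i _
    simp
  simp only [Algebra.smul_def, mul_pow, Finset.prod_mul_distrib, Finset.prod_pow_eq_pow_sum, h1,
    map_pow]
  ring

/-- The polynomial `Q` evaluated at the images of the letters under the generic matrix. -/
def genSubst (Q : MvPolynomial (Option ι × Fin 2) ℂ) :
    MvPolynomial (Fin 2 × Fin 2) (MvPolynomial (Fin 2) (MvPolynomial (ι × Fin 2) ℂ)) :=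
  aeval (fun p => C (formVec p.1 0) * X (p.2, 0) + C (formVec p.1 1) * X (p.2, 1)) Q

lemma aeval_genSubst (Q : MvPolynomial (Option ι × Fin 2) ℂ) (h : Fin 2 × Fin 2 → ℂ) :
    aeval (fun i => algebraMap ℂ (MvPolynomial (Fin 2) (MvPolynomial (ι × Fin 2) ℂ)) (h i))
      (genSubst Q) =
    aeval (fun p : Option ι × Fin 2 => h (p.2, 0) • formVec p.1 0 + h (p.2, 1) • formVec p.1 1)
      Q := by
  have e : ((aeval (fun i => algebraMap ℂ (MvPolynomial (Fin 2) (MvPolynomial (ι × Fin 2) ℂ))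
      (h i))).restrictScalars ℂ).comp (aeval fun p : Option ι × Fin 2 =>
        C (formVec p.1 0) * X (p.2, 0) + C (formVec p.1 1) * X (p.2, 1)) =
      aeval (fun p : Option ι × Fin 2 => h (p.2, 0) • formVec p.1 0 +
        h (p.2, 1) • formVec p.1 1) := by
    refine algHom_ext fun p => ?_
    simp [Algebra.smul_def, mul_comm]
  exact AlgHom.congr_fun e Q

/-- After the substitution, the letters of a monomial of `Q` with component `c` become linear forms
in row `c` of the generic matrix. The monomial is thus a product of linear forms in two separate
sets of variables, and `Ω ^ w` acts on it as `tau w`. -/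
lemma diag_cayley_genSubst_mem {w : ℕ} {Q : MvPolynomial (Option ι × Fin 2) ℂ}
    (hQ : Q.IsHomogeneous (2 * w)) : ∃ b ∈ brAlg (slotVec (ι := ι)),
      diag ((cayley (0 : Fin 2) 1 ^ w) (genSubst Q)) = C b := by
  classical
  let S := (brAlg (slotVec (ι := ι))).map (Algebra.ofId _ (MvPolynomial (Fin 2)
        (MvPolynomial (Fin 2) (MvPolynomial (ι × Fin 2) ℂ))) |>.restrictScalars ℂ)
  suffices hs : diag ((cayley (0 : Fin 2) 1 ^ w) (genSubst Q)) ∈ S by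
    obtain ⟨b, hb, h⟩ := hs
    exact ⟨b, hb, h.symm⟩
  rw [genSubst, aeval_def, eval₂_eq, map_sum, diag, map_sum]
  refine sum_mem fun m hm => ?_
  have hm2 : ∑ i ∈ m.support, m i = 2 * w := by
    have := hQ (mem_support_iff.1 hm)
    rwa [Finsupp.weight_apply, Finsupp.sum, Finset.sum_congr rfl (g := m)] at this
    intro i _
    simp
  let T : Fin 2 → Multiset (Option ι) := fun c =>
    ∑ p ∈ m.support.filter (fun p => p.2 = c), Multiset.replicate (m p) p.1
  have hT (c : Fin 2) : ∏ p ∈ m.support.filter (fun p => p.2 = c),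
      (C (formVec p.1 0) * X (p.2, 0) + C (formVec p.1 1) * X (p.2, 1)) ^ m p =
      inSlot c (sgProd formVec (T c)) := by
    have h1 (F : Finset (Option ι × Fin 2)) : sgProd formVec
        (∑ p ∈ F, Multiset.replicate (m p) p.1) = ∏ p ∈ F, sg (formVec p.1) ^ m p := by
      induction F using Finset.induction_on with
      | empty => simp
      | insert p F hp ih => rw [Finset.sum_insert hp, Finset.prod_insert hp, sgProd_add, ih,
          sgProd_replicate]
    rw [h1, inSlot, map_prod]
    refine Finset.prod_congr rfl fun p hp => ?_
    rw [(Finset.mem_filter.1 hp).2, map_pow, sg]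
    simp
  have hcard : Multiset.card (T 0) + Multiset.card (T 1) = 2 * w := by
    rw [← hm2, ← Finset.sum_filter_add_sum_filter_not m.support (fun p => p.2 = 0)]
    have h2 : m.support.filter (fun p => ¬ p.2 = 0) = m.support.filter (fun p => p.2 = 1) := by
      refine Finset.filter_congr fun p _ => ?_
      have := p.2
      omega
    rw [h2]
    simp [T]
  have hprod : ∏ p ∈ m.support,
      (C (formVec p.1 0) * X (p.2, 0) + C (formVec p.1 1) * X (p.2, 1)) ^ m p =
      inSlot 0 (sgProd formVec (T 0)) * inSlot 1 (sgProd formVec (T 1)) := by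
    rw [← Finset.prod_filter_mul_prod_filter_not m.support (fun p => p.2 = 0), ← hT, ← hT]
    congr 2
    refine Finset.filter_congr fun p _ => ?_
    have := p.2
    omega
  rw [hprod, ← Algebra.smul_def, ← algebraMap_smul
    (MvPolynomial (Fin 2) (MvPolynomial (ι × Fin 2) ℂ)), map_smul, map_smul, algebraMap_smul]
  refine Subalgebra.smul_mem _ ?_ _
  obtain ⟨b, hb, h⟩ := tau_formVec_mem w (T 0) (T 1) hcard
  rw [tau_apply, diag] at h
  rw [h]
  exact ⟨b, hb, rfl⟩

variable [Fintype ι]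

/-- A covariant which is the umbral value of a homogeneous polynomial in the letters is the umbral
value of a polynomial in the brackets. -/
lemma mem_molSpan_of_mem_Cov {N : ℕ} {Q : MvPolynomial (Option ι × Fin 2) ℂ}
    (hQ : Q.IsHomogeneous N) {P : CoordRing n} (hP : P ∈ Cov n)
    (h : P = umbralForm (fun _ : ι => genericForm n) (aeval (fun p => formVec p.1 p.2) Q)) :
    P ∈ molSpan (fun _ : ι => genericForm n) := by
  set E := umbralForm (fun _ : ι => genericForm n)
  rw [mem_Cov_iff] at hP
  have hinv (M : Matrix (Fin 2) (Fin 2) ℂ) (hM : M.det = 1) : E (aeval (fun p => 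
      M p.2 0 • formVec p.1 0 + M p.2 1 • formVec p.1 1) Q) = P := by
    -- The letters are acted on by the transpose of the inverse; the element `g⁻¹`, with `g` the
    -- transpose of `M`, therefore acts on them by `M` itself.
    let g : Matrix.SpecialLinearGroup (Fin 2) ℂ := ⟨M.transpose, by rw [Matrix.det_transpose, hM]⟩
    have h1 := hP g⁻¹
    rw [h, coordAct_umbralForm] at h1
    rw [h, ← h1]
    congr 1
    have e : (actForm g⁻¹).comp (aeval fun p : Option ι × Fin 2 => formVec p.1 p.2) =
        aeval fun p : Option ι × Fin 2 => M p.2 0 • formVec p.1 0 + M p.2 1 • formVec p.1 1 := by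
      refine algHom_ext fun p => ?_
      rw [AlgHom.comp_apply, aeval_X, aeval_X, actForm_formVec, inv_inv, Algebra.smul_def,
        Algebra.smul_def]
      rfl
    exact (AlgHom.congr_fun e Q).symm
  rcases Nat.even_or_odd' N with ⟨w, rfl | rfl⟩
  -- Division by a square root of the determinant brings an invertible matrix into `SL₂`. The degree
  -- `2 * w` of `Q` then produces the `w`-th power of the determinant.
  · have hscale (x : Fin 2 × Fin 2 → ℂ)
        (hx : x (0, 0) * x (1, 1) - x (0, 1) * x (1, 0) ≠ 0) : E (aeval (fun p =>
          x (p.2, 0) • formVec p.1 0 + x (p.2, 1) • formVec p.1 1) Q) =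
        (x (0, 0) * x (1, 1) - x (0, 1) * x (1, 0)) ^ w • P := by
      obtain ⟨s, hs⟩ := IsAlgClosed.exists_pow_nat_eq
        (x (0, 0) * x (1, 1) - x (0, 1) * x (1, 0)) (n := 2) (by norm_num)
      have hs0 : s ≠ 0 := by
        rintro rfl
        exact hx (by rw [← hs]; norm_num)
      have h1 := hinv (Matrix.of fun c j => s⁻¹ * x (c, j)) (by
        rw [Matrix.det_fin_two]
        simp only [Matrix.of_apply]
        field_simp
        rw [hs])
      simp only [Matrix.of_apply, mul_smul, ← smul_add] at h1
      rw [aeval_smul_of_isHomogeneous hQ, map_smul] at h1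
      rw [← h1, ← hs, smul_smul, inv_pow, ← pow_mul, mul_inv_cancel₀ (pow_ne_zero _ hs0), one_smul]
    have key : mapCoeff E (genSubst Q) = genDet (CoordRing n) ^ w * C P := by
      have hne : genDet (CoordRing n) ≠ 0 := by
        intro h0
        have := congrArg (eval fun p : Fin 2 × Fin 2 => if p.1 = p.2 then (1 : CoordRing n) else 0)
          h0
        simp [genDet] at this
      -- The identity is known only where the determinant does not vanish; multiplying by the
      -- determinant makes it valid at every complex matrix, hence as an identity of polynomials in
      -- a domain.
      refine sub_eq_zero.1 ((mul_eq_zero.1 (eq_zero_of_aeval_const (genDet (CoordRing n) *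
        (mapCoeff E (genSubst Q) - genDet (CoordRing n) ^ w * C P)) fun x => ?_)).resolve_left hne)
      have hdet : aeval (fun i => algebraMap ℂ (CoordRing n) (x i)) (genDet (CoordRing n)) =
          algebraMap ℂ (CoordRing n) (x (0, 0) * x (1, 1) - x (0, 1) * x (1, 0)) := by
        simp [genDet]
      rw [map_mul, hdet, map_sub (aeval _), ← mapCoeff_aeval_const, aeval_genSubst, map_mul,
        map_pow, hdet]
      by_cases hx : x (0, 0) * x (1, 1) - x (0, 1) * x (1, 0) = 0
      · rw [hx, map_zero, zero_mul]
      · rw [hscale x hx, ← map_pow, Algebra.smul_def]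
        simp
    obtain ⟨b, hb, hb'⟩ := diag_cayley_genSubst_mem hQ
    obtain ⟨M, hM, hM'⟩ := exists_cayley_pow_genDet (R := CoordRing n) w
    -- Applying `Ω ^ w` to `key` leaves the value of a bracket polynomial on the left and a nonzero
    -- integer multiple of `P` on the right.
    have h1 := congrArg (fun Z => diag ((cayley (0 : Fin 2) 1 ^ w) Z)) key
    rw [← mapCoeff_cayley_pow, diag, ← mapCoeff_rename, mul_comm, cayley_pow_C_mul, hM'] at h1
    rw [diag] at hb'
    rw [hb', mapCoeff_C, diag, map_mul, rename_C, map_natCast, ← map_natCast C, ← C_mul] at h1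
    have h2 : E b = (M : ℂ) • P := by
      rw [C_injective _ _ h1, mul_comm, ← nsmul_eq_mul, Nat.cast_smul_eq_nsmul]
    refine ⟨(M : ℂ)⁻¹ • b, Submodule.smul_mem _ _ hb, ?_⟩
    change E ((M : ℂ)⁻¹ • b) = P
    rw [map_smul, h2, smul_smul, inv_mul_cancel₀ (Nat.cast_ne_zero.2 hM), one_smul]
  -- In odd degree the matrix `-1` changes the sign of the symbol, so `P = -P`.
  · have h1 := hinv (-1) (by simp [Matrix.det_fin_two])
    have h2 : (fun p : Option ι × Fin 2 => (-1 : Matrix (Fin 2) (Fin 2) ℂ) p.2 0 • formVec p.1 0 +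
        (-1 : Matrix (Fin 2) (Fin 2) ℂ) p.2 1 • formVec p.1 1) =
        fun p => (-1 : ℂ) • formVec p.1 p.2 := by
      funext ⟨u, c⟩
      fin_cases c <;> simp
    rw [h2, aeval_smul_of_isHomogeneous hQ, map_smul, ← h, Odd.neg_one_pow ⟨w, rfl⟩, neg_one_smul,
      neg_eq_self] at h1
    rw [h1]
    exact zero_mem _

lemma exists_prod_X_of_degree {σ : Type*} (d : ℕ) (m : σ →₀ ℕ) (hm : m.degree = d) :
    ∃ i : Fin d → σ, monomial m (1 : ℂ) = ∏ k, X (i k) := by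
  classical
  induction d generalizing m with
  | zero =>
    refine ⟨Fin.elim0, ?_⟩
    rw [(Finsupp.degree_eq_zero_iff m).1 hm]
    simp
  | succ d ih =>
    obtain ⟨j, hj⟩ : ∃ j, m j ≠ 0 := by
      by_contra! h
      have : m = 0 := Finsupp.ext h
      rw [this] at hm
      simp at hm
    have hle : Finsupp.single j 1 ≤ m := by
      rw [Finsupp.single_le_iff]
      exact Nat.one_le_iff_ne_zero.2 hj
    have hmj : m = Finsupp.single j 1 + (m - Finsupp.single j 1) := (add_tsub_cancel_of_le hle).symm
    obtain ⟨i, hi⟩ := ih (m - Finsupp.single j 1) (by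
      have h1 := congrArg Finsupp.degree hmj
      rw [map_add, hm, Finsupp.degree_single] at h1
      omega)
    refine ⟨Fin.cons j i, ?_⟩
    rw [Fin.prod_univ_succ, Fin.cons_zero]
    simp only [Fin.cons_succ]
    rw [← hi, X, monomial_mul, one_mul, ← hmj]

lemma umbral_unit_genericForm (i : Fin (n + 1)) :
    umbral (fun _ : Unit => genericForm n) (X ((), 0) ^ (n - (i : ℕ)) * X ((), 1) ^ (i : ℕ)) =
      (n ! : ℂ) • X i := by
  rw [umbral_unit, genericForm, coeff_binaryForm, ← nsmul_eq_mul, ← Nat.cast_smul_eq_nsmul ℂ,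
    smul_smul, ← Nat.cast_mul]
  congr 2
  rw [mul_comm, mul_comm (n - (i : ℕ))!, ← mul_assoc]
  exact Nat.choose_mul_factorial_mul_factorial (Nat.lt_succ_iff.1 i.2)

/-- Every element of given degree and order is the umbral value of a homogeneous polynomial. -/
lemma exists_umbral_preimage {d m : ℕ} {P : CoordRing n} (hd : IsDegree d P)
    (hm : P.IsHomogeneous m) : ∃ Q : MvPolynomial (Option (Fin d) × Fin 2) ℂ,
      Q.IsHomogeneous (d * n + m) ∧
      P = umbralForm (fun _ : Fin d => genericForm n) (aeval (fun p => formVec p.1 p.2) Q) := by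
  let W : Submodule ℂ (CoordRing n) := (homogeneousSubmodule _ ℂ (d * n + m)).map
    (umbralForm (fun _ : Fin d => genericForm n) ∘ₗ
      (aeval fun p : Option (Fin d) × Fin 2 => formVec p.1 p.2).toLinearMap)
  suffices h : P ∈ W by
    obtain ⟨Q, hQ, rfl⟩ := h
    exact ⟨Q, hQ, rfl⟩
  rw [P.as_sum]
  refine sum_mem fun e he => ?_
  have he' : e 0 + e 1 = m := by
    have := hm (mem_support_iff.1 he)
    simpa [Finsupp.weight_apply, Finsupp.sum_fintype] using this
  have hc := hd e
  revert hc
  generalize coeff e P = r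
  intro hc
  rw [r.as_sum, map_sum]
  refine sum_mem fun μ hμ => ?_
  have hμ' : μ.degree = d := by
    have := hc (mem_support_iff.1 hμ)
    rwa [Finsupp.degree_eq_weight_one]
  obtain ⟨i, hi⟩ := exists_prod_X_of_degree d μ hμ'
  have h1 : monomial μ (coeff μ r) = coeff μ r • ∏ k, (X (i k) : MvPolynomial (Fin (n + 1)) ℂ) := by
    rw [← hi, smul_monomial, smul_eq_mul, mul_one]
  rw [h1, ← smul_monomial]
  refine Submodule.smul_mem _ _ ?_
  have hfac : ((n ! : ℂ) ^ d) ≠ 0 := pow_ne_zero _ (Nat.cast_ne_zero.2 n.factorial_ne_zero)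
  refine (Submodule.smul_mem_iff _ hfac).1 ?_
  -- The coefficient `a_i` is represented by `ξ ^ (n - i) * η ^ i`, whose value is `n ! • a_i`; this
  -- accounts for the factor `n ! ^ d`. In the extra letter `(-y, x)`, component `1` is `x` and the
  -- negative of component `0` is `y`.
  refine ⟨(∏ k, (X (some k, 0) ^ (n - (i k : ℕ)) * X (some k, 1) ^ (i k : ℕ))) *
    (X (none, 1) ^ e 0 * (-X (none, 0)) ^ e 1), ?_, ?_⟩
  · refine IsHomogeneous.mul ?_ ?_
    · have : d * n = ∑ _k : Fin d, n := by simp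
      rw [this]
      refine IsHomogeneous.prod _ _ _ fun k _ => ?_
      have h2 : n = (n - (i k : ℕ)) + (i k : ℕ) := by have := (i k).2; omega
      conv => arg 2; rw [h2]
      exact (isHomogeneous_X_pow _ _).mul (isHomogeneous_X_pow _ _)
    · rw [← he']
      refine (isHomogeneous_X_pow _ _).mul ?_
      simpa using (isHomogeneous_X ℂ ((none, 0) : Option (Fin d) × Fin 2)).neg.pow (e 1)
  · rw [LinearMap.comp_apply, AlgHom.toLinearMap_apply]
    have h3 : aeval (fun p : Option (Fin d) × Fin 2 => formVec p.1 p.2)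
        ((∏ k, (X (some k, 0) ^ (n - (i k : ℕ)) * X (some k, 1) ^ (i k : ℕ))) *
          (X (none, 1) ^ e 0 * (-X (none, 0)) ^ e 1) :
            MvPolynomial (Option (Fin d) × Fin 2) ℂ) =
        monomial e (∏ k, slotMap (fun _ : Unit => k)
          (X ((), 0) ^ (n - (i k : ℕ)) * X ((), 1) ^ (i k : ℕ))) := by
      have h4 (R : Type) [CommRing R] (a : R) :
          monomial e a = (C a * X 0 ^ e 0 * X 1 ^ e 1 : MvPolynomial (Fin 2) R) := by
        rw [← monomial_single_add_single]
        refine congrArg (fun e => monomial e a) (Finsupp.ext fun c => ?_)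
        fin_cases c <;> simp
      rw [h4]
      simp [formVec, slotMap, mul_assoc]
    rw [h3, umbralForm, mapCoeff_monomial, umbral_prod]
    simp only [umbral_unit_genericForm]
    rw [Finset.prod_smul, smul_monomial]
    simp

/-- The covariants of degree `d` are the combinations of the molecular covariants with `d` atoms. -/
theorem mem_molSpan_of_isDegree {d : ℕ} {P : CoordRing n} (hP : P ∈ Cov n) (hd : IsDegree d P) :
    P ∈ molSpan (fun _ : Fin d => genericForm n) := by
  rw [← sum_homogeneousComponent P]
  refine Submodule.sum_mem _ fun m _ => ?_
  have h1 : IsDegree d (homogeneousComponent m P) := fun e => by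
    rw [coeff_homogeneousComponent]
    split_ifs
    · exact hd e
    · exact isHomogeneous_zero (Fin (n + 1)) ℂ d
  obtain ⟨Q, hQ, h⟩ := exists_umbral_preimage h1 (homogeneousComponent_isHomogeneous m P)
  exact mem_molSpan_of_mem_Cov hQ (homogeneousComponent_mem_Cov hP m) h

end FirstFundamental

/-! ### Molecular covariants and Gordan's ideals -/

section SlotPowers

variable {R : Type*} [CommRing R] {ι : Type*} [Fintype ι]

/-- The product of powers of the linear forms of the slots, each in its own variables. -/
def slotPow (v : ι → Fin 2 → R) (e : ι → ℕ) : MvPolynomial (ι × Fin 2) R :=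
  ∏ i, inSlot i (sg (v i)) ^ e i

lemma diag_slotPow (v : ι → Fin 2 → R) (e : ι → ℕ) :
    diag (slotPow v e) = ∏ i, sg (v i) ^ e i := by
  rw [diag, slotPow, map_prod]
  refine Finset.prod_congr rfl fun i _ => ?_
  rw [map_pow, inSlot, rename_rename]
  congr 1
  exact rename_id_apply _

variable [DecidableEq ι]

lemma pderiv_inSlot_sg (v : ι → Fin 2 → R) (a i : ι) (c : Fin 2) :
    pderiv (a, c) (inSlot i (sg (v i))) = if i = a then C (v a c) else 0 := by
  by_cases h : i = a
  · subst h
    rw [if_pos rfl]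
    fin_cases c <;> simp [inSlot, sg, pderiv_X]
  · rw [if_neg h]
    simp [inSlot, sg, pderiv_X, h, Prod.ext_iff]

lemma pderiv_slotPow (v : ι → Fin 2 → R) (e : ι → ℕ) (a : ι) (c : Fin 2) :
    pderiv (a, c) (slotPow v (e + Pi.single a 1)) =
      ((e a + 1 : ℕ) : MvPolynomial (ι × Fin 2) R) * C (v a c) * slotPow v e := by
  have h0 (s : Finset ι) (ha : a ∉ s) (f : ι → ℕ) :
      pderiv (a, c) (∏ i ∈ s, inSlot i (sg (v i)) ^ f i) = 0 := by
    induction s using Finset.induction_on with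
    | empty => simp
    | insert i s hi ih =>
      rw [Finset.mem_insert, not_or] at ha
      rw [Finset.prod_insert hi, pderiv_mul, ih ha.2, pderiv_pow, pderiv_inSlot_sg,
        if_neg (Ne.symm ha.1)]
      simp
  have h1 : ∏ i ∈ Finset.univ.erase a, inSlot i (sg (v i)) ^ (e + Pi.single a 1 : ι → ℕ) i =
      ∏ i ∈ Finset.univ.erase a, inSlot i (sg (v i)) ^ e i := by
    refine Finset.prod_congr rfl fun i hi => ?_
    rw [Pi.add_apply, Pi.single_eq_of_ne (Finset.ne_of_mem_erase hi), add_zero]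
  rw [slotPow, slotPow, ← Finset.mul_prod_erase _ _ (Finset.mem_univ a), h1, pderiv_mul,
    h0 _ (Finset.notMem_erase a _), pderiv_pow, pderiv_inSlot_sg, if_pos rfl,
    ← Finset.mul_prod_erase Finset.univ (fun i => inSlot i (sg (v i)) ^ e i) (Finset.mem_univ a)]
  simp only [Pi.add_apply, Pi.single_eq_same, Nat.add_sub_cancel]
  ring

lemma cayley_slotPow (v : ι → Fin 2 → R) (e : ι → ℕ) {a b : ι} (hab : a ≠ b) :
    cayley a b (slotPow v (e + (Pi.single a 1 + Pi.single b 1))) =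
      C (((e a + 1) * (e b + 1) : ℕ) * (v a 0 * v b 1 - v a 1 * v b 0)) * slotPow v e := by
  have hn (i : ι × Fin 2) (k : ℕ) (r : R) (P : MvPolynomial (ι × Fin 2) R) :
      pderiv i ((k : MvPolynomial (ι × Fin 2) R) * C r * P) =
        (k : MvPolynomial (ι × Fin 2) R) * C r * pderiv i P := by
    rw [← map_natCast C, ← C_mul, pderiv_C_mul]
  rw [cayley_apply, ← add_assoc]
  simp only [pderiv_slotPow, hn]
  simp only [Pi.add_apply, Pi.single_eq_of_ne hab.symm, add_zero]
  simp only [C_mul, map_sub, map_natCast, Nat.cast_mul]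
  ring

lemma exists_cayley_pow_slotPow (v : ι → Fin 2 → R) (e : ι → ℕ) {a b : ι} (w : ℕ)
    (hab : w ≠ 0 → a ≠ b) :
    ∃ N : ℕ, N ≠ 0 ∧ (cayley a b ^ w) (slotPow v (e + w • (Pi.single a 1 + Pi.single b 1))) =
      C (N * (v a 0 * v b 1 - v a 1 * v b 0) ^ w) * slotPow v e := by
  induction w with
  | zero => exact ⟨1, one_ne_zero, by simp⟩
  | succ w ih =>
    have hab' := hab (Nat.succ_ne_zero w)
    obtain ⟨N, hN, h⟩ := ih fun _ => hab'
    set e' := e + w • (Pi.single a 1 + Pi.single b 1 : ι → ℕ)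
    refine ⟨(e' a + 1) * (e' b + 1) * N, by positivity, ?_⟩
    rw [succ_nsmul, ← add_assoc, pow_succ, Module.End.mul_apply, cayley_slotPow v e' hab',
      cayley_pow_C_mul, h, ← mul_assoc, ← C_mul]
    congr 2
    push_cast
    ring

/-- On powers of linear forms, a Cayley operator lowers two exponents and contributes one bracket
with a positive integer factor. The initial exponents exceed `e` by exactly what the operators
consume. -/
lemma exists_list_cayley_slotPow (v : ι → Fin 2 → R) (w : ι × ι → ℕ)
    (hw : ∀ p, w p ≠ 0 → p.1 ≠ p.2) (L : List (ι × ι)) (e : ι → ℕ) :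
    ∃ N : ℕ, N ≠ 0 ∧ (L.map fun p => cayley (R := R) p.1 p.2 ^ w p).prod
        (slotPow v (e + (L.map fun p => w p • (Pi.single p.1 1 + Pi.single p.2 1)).sum)) =
      C (N * (L.map fun p => (v p.1 0 * v p.2 1 - v p.1 1 * v p.2 0) ^ w p).prod) *
        slotPow v e := by
  induction L generalizing e with
  | nil => exact ⟨1, one_ne_zero, by simp⟩
  | cons p L ih =>
    obtain ⟨M, hM, h'⟩ := exists_cayley_pow_slotPow v e (a := p.1) (b := p.2) (w p) (hw p)
    obtain ⟨N, hN, h⟩ := ih (e + w p • (Pi.single p.1 1 + Pi.single p.2 1))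
    refine ⟨N * M, mul_ne_zero hN hM, ?_⟩
    rw [List.map_cons, List.map_cons, List.map_cons, List.prod_cons, List.prod_cons, List.sum_cons,
      Module.End.mul_apply, ← add_assoc, h, cayley_pow_C_mul, h', ← mul_assoc, ← C_mul]
    congr 2
    push_cast
    ring

end SlotPowers

/-! ### Bracket monomials -/

section BracketMonomials

variable {R : Type*} [CommRing R] [Algebra ℂ R] {ι : Type*} [Fintype ι] [DecidableEq ι]

/-- A monomial in the brackets and linear forms of a family of letters. -/
def brMonomial (v : ι → Fin 2 → R) (w : ι → ι → ℕ) (s : ι → ℕ) : MvPolynomial (Fin 2) R :=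
  (∏ p : ι × ι, dt (v p.1) (v p.2) ^ w p.1 p.2) * ∏ i, sg (v i) ^ s i

lemma brMonomial_mul (v : ι → Fin 2 → R) (w w' : ι → ι → ℕ) (s s' : ι → ℕ) :
    brMonomial v w s * brMonomial v w' s' = brMonomial v (w + w') (s + s') := by
  simp only [brMonomial, Pi.add_apply, pow_add, Finset.prod_mul_distrib]
  ring

lemma brMonomial_single (v : ι → Fin 2 → R) (i j : ι) (r : ℕ) :
    brMonomial v (fun a b => if (a, b) = (i, j) then r else 0) 0 = dt (v i) (v j) ^ r := by
  rw [brMonomial, Finset.prod_eq_single (i, j)]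
  · simp
  · intro p _ hp
    rw [if_neg hp, pow_zero]
  · simp

/-- The bracket of a letter with itself is zero, so monomials without loops suffice, and their
exponents are the edge weights of a molecule. -/
lemma brAlg_le_span_brMonomial (v : ι → Fin 2 → R) :
    Subalgebra.toSubmodule (brAlg v) ≤ Submodule.span ℂ
      {x | ∃ w s, (∀ i, w i i = 0) ∧ x = brMonomial v w s} := by
  rw [brAlg, Algebra.adjoin_eq_span, Submodule.span_le]
  intro x hx
  suffices h : x = 0 ∨ ∃ w s, (∀ i, w i i = 0) ∧ x = brMonomial v w s by
    rcases h with rfl | h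
    · exact zero_mem _
    · exact Submodule.subset_span h
  induction hx using Submonoid.closure_induction with
  | mem x h =>
    rcases h with ⟨⟨i, j⟩, rfl⟩ | ⟨i, rfl⟩
    · by_cases hij : i = j
      · subst hij
        exact Or.inl (dt_self _)
      · refine Or.inr ⟨fun a b => if (a, b) = (i, j) then 1 else 0, 0, fun a => ?_, ?_⟩
        · refine if_neg fun h => ?_
          rw [Prod.mk.injEq] at h
          exact hij (h.1.symm.trans h.2)
        · rw [brMonomial_single, pow_one]
    · refine Or.inr ⟨0, Pi.single i 1, fun a => rfl, ?_⟩
      rw [brMonomial, Finset.prod_eq_single (a := i)]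
      · simp
      · intro j _ hj
        rw [Pi.single_eq_of_ne hj, pow_zero]
      · simp
  | one => exact Or.inr ⟨0, 0, fun _ => rfl, by simp [brMonomial]⟩
  | mul x y _ _ hx hy =>
    rcases hx with rfl | ⟨w, s, hw, rfl⟩
    · simp
    rcases hy with rfl | ⟨w', s', hw', rfl⟩
    · simp
    exact Or.inr ⟨w + w', s + s', fun i => by simp [hw i, hw' i], brMonomial_mul _ _ _ _ _⟩

end BracketMonomials

/-! ### Molecular covariants as umbral values of bracket monomials -/

section Molecules

variable {n : ℕ}

lemma prod_monomial {S τ ι : Type*} [CommRing S] (s : Finset ι) (m : ι → τ →₀ ℕ) (r : ι → S) :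
    ∏ i ∈ s, monomial (m i) (r i) = monomial (∑ i ∈ s, m i) (∏ i ∈ s, r i) := by
  classical
  induction s using Finset.induction_on with
  | empty => simp
  | insert i s hi ih =>
    rw [Finset.prod_insert hi, Finset.prod_insert hi, Finset.sum_insert hi, ih, monomial_mul]

lemma mapCoeff_prod_slotMap {A : Type*} [CommRing A] [Algebra ℂ A] {ι τ : Type*} [Fintype ι]
    (F : ι → MvPolynomial (Fin 2) A) (P : ι → MvPolynomial τ (MvPolynomial (Unit × Fin 2) ℂ)) :
    mapCoeff (umbral F) (∏ i, map (slotMap (fun _ : Unit => i)).toRingHom (P i)) =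
      ∏ i, mapCoeff (umbral fun _ : Unit => F i) (P i) := by
  classical
  have h1 (i : ι) : map (slotMap (fun _ : Unit => i)).toRingHom (P i) =
      ∑ m ∈ (P i).support, monomial m (slotMap (fun _ : Unit => i) (coeff m (P i))) := by
    conv_lhs => rw [(P i).as_sum]
    rw [map_sum]
    exact Finset.sum_congr rfl fun m _ => map_monomial _ _ _
  have h2 (i : ι) : mapCoeff (umbral fun _ : Unit => F i) (P i) =
      ∑ m ∈ (P i).support, monomial m (umbral (fun _ : Unit => F i) (coeff m (P i))) := by
    conv_lhs => rw [(P i).as_sum]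
    rw [map_sum]
    exact Finset.sum_congr rfl fun m _ => mapCoeff_monomial _ _ _
  simp only [h1, h2, Finset.prod_univ_sum, map_sum]
  refine Finset.sum_congr rfl fun m _ => ?_
  rw [prod_monomial, prod_monomial, mapCoeff_monomial, umbral_prod]

lemma map_slotMap_sg {ι : Type*} (i : ι) :
    map (slotMap fun _ : Unit => i).toRingHom (sg (slotVec ())) = sg (slotVec i) := by
  rw [map_sg]
  congr 1
  funext c
  simp [slotVec, slotMap]

lemma mapCoeff_slotPow {ι : Type*} [Fintype ι] (e : ι → ℕ) :
    mapCoeff (umbral fun _ : ι => genericForm n) (slotPow slotVec e) =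
      (∏ i, ((e i)! : ℂ)) • ∏ i, inSlot i (homogeneousComponent (e i) (genericForm n)) := by
  have h1 (i : ι) : inSlot i (sg (slotVec i)) ^ e i =
      map (slotMap fun _ : Unit => i).toRingHom (inSlot i (sg (slotVec ()) ^ e i)) := by
    rw [inSlot, inSlot, map_rename, map_pow (map _), map_slotMap_sg, map_pow]
  have h2 (i : ι) : mapCoeff (umbral fun _ : Unit => genericForm n)
      (inSlot i (sg (slotVec ()) ^ e i)) =
        ((e i)! : ℂ) • inSlot i (homogeneousComponent (e i) (genericForm n)) := by
    have h3 := umbralForm_sg_pow (genericForm n) (e i)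
    rw [umbralForm] at h3
    rw [inSlot, mapCoeff_rename, h3, inSlot]
    exact LinearMap.map_smul_of_tower (rename _).toLinearMap _ _
  rw [slotPow, Finset.prod_congr rfl fun i _ => h1 i, mapCoeff_prod_slotMap,
    Finset.prod_congr rfl fun i _ => h2 i, Finset.prod_smul]

lemma mapCoeff_list_cayley {R A : Type*} [CommRing R] [Algebra ℂ R] [CommRing A] [Algebra ℂ A]
    (E : R →ₗ[ℂ] A) {ι : Type*} (w : ι × ι → ℕ) (L : List (ι × ι))
    (P : MvPolynomial (ι × Fin 2) R) :
    mapCoeff E ((L.map fun p => cayley (R := R) p.1 p.2 ^ w p).prod P) =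
      (L.map fun p => cayley (R := A) p.1 p.2 ^ w p).prod (mapCoeff E P) := by
  induction L with
  | nil => rfl
  | cons p L ih =>
    rw [List.map_cons, List.map_cons, List.prod_cons, List.prod_cons, Module.End.mul_apply,
      Module.End.mul_apply, mapCoeff_cayley_pow, ih]

lemma list_product_map_prod {d : ℕ} {M : Type*} [CommMonoid M] (f : Fin d × Fin d → M) :
    (((List.finRange d).product (List.finRange d)).map f).prod = ∏ p, f p := by
  classical
  have h1 : ((List.finRange d).product (List.finRange d)).toFinset = Finset.univ := by
    refine Finset.eq_univ_iff_forall.2 fun p => List.mem_toFinset.2 ?_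
    exact List.pair_mem_product.2 ⟨List.mem_finRange _, List.mem_finRange _⟩
  rw [← h1]
  exact (List.prod_toFinset f ((List.nodup_finRange d).product (List.nodup_finRange d))).symm

lemma list_product_map_sum {d : ℕ} {M : Type*} [AddCommMonoid M] (f : Fin d × Fin d → M) :
    (((List.finRange d).product (List.finRange d)).map f).sum = ∑ p, f p := by
  classical
  have h1 : ((List.finRange d).product (List.finRange d)).toFinset = Finset.univ := by
    refine Finset.eq_univ_iff_forall.2 fun p => List.mem_toFinset.2 ?_
    exact List.pair_mem_product.2 ⟨List.mem_finRange _, List.mem_finRange _⟩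
  rw [← h1]
  exact (List.sum_toFinset f ((List.nodup_finRange d).product (List.nodup_finRange d))).symm

/-- The umbral value of a bracket monomial, in terms of the edge operator of a molecule. -/
lemma exists_umbralForm_brMonomial (D : Molecule) (s : Fin D.atoms → ℕ) :
    ∃ c : ℂ, c ≠ 0 ∧ umbralForm (fun _ : Fin D.atoms => genericForm n) (brMonomial slotVec D.w s) =
      c • diag (D.edgeOp (MvPolynomial (Fin (n + 1)) ℂ)
        (∏ α, inSlot α (homogeneousComponent (D.used α + s α) (genericForm n)))) := by
  set L := (List.finRange D.atoms).product (List.finRange D.atoms) with hL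
  obtain ⟨N, hN, h⟩ := exists_list_cayley_slotPow (slotVec (ι := Fin D.atoms))
    (fun p => D.w p.1 p.2) (fun p hp h => hp (by rw [h]; exact D.loopless _)) L s
  have hs : s + (L.map fun p => D.w p.1 p.2 • (Pi.single p.1 1 + Pi.single p.2 1)).sum =
      fun α => D.used α + s α := by
    rw [hL, list_product_map_sum]
    funext α
    rw [Pi.add_apply, add_comm, Finset.sum_apply, Molecule.used]
    congr 1
    simp only [Pi.smul_apply, Pi.add_apply, smul_eq_mul, mul_add, Pi.single_apply,
      Finset.sum_add_distrib, Fintype.sum_prod_type, mul_ite, mul_one, mul_zero]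
    congr 1
    · rw [Finset.sum_comm]
      simp
    · simp
  have hne : (∏ α, ((D.used α + s α)! : ℂ)) ≠ 0 :=
    Finset.prod_ne_zero_iff.2 fun α _ => Nat.cast_ne_zero.2 (Nat.factorial_ne_zero _)
  have h2 : diag (C ((N : MvPolynomial (Fin D.atoms × Fin 2) ℂ) * ∏ p : Fin D.atoms × Fin D.atoms,
      (slotVec p.1 0 * slotVec p.2 1 - slotVec p.1 1 * slotVec p.2 0) ^ D.w p.1 p.2) *
      slotPow slotVec s) = (N : ℂ) • brMonomial slotVec D.w s := by
    have h3 := diag_slotPow (slotVec (ι := Fin D.atoms)) s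
    rw [diag] at h3
    rw [diag, map_mul, h3, rename_C, C_mul, brMonomial, map_natCast,
      Nat.cast_smul_eq_nsmul, nsmul_eq_mul, mul_assoc, map_prod]
    simp only [map_pow]
    rfl
  have h4 : (N : ℂ) • umbralForm (fun _ : Fin D.atoms => genericForm n)
      (brMonomial slotVec D.w s) = (∏ α, ((D.used α + s α)! : ℂ)) •
        diag (D.edgeOp (MvPolynomial (Fin (n + 1)) ℂ)
          (∏ α, inSlot α (homogeneousComponent (D.used α + s α) (genericForm n)))) := by
    rw [hs, hL, list_product_map_prod] at h
    rw [← LinearMap.map_smul, ← h2, ← h, umbralForm, diag, mapCoeff_rename, mapCoeff_list_cayley,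
      mapCoeff_slotPow, LinearMap.map_smul_of_tower]
    exact LinearMap.map_smul_of_tower (rename _).toLinearMap _ _
  refine ⟨(N : ℂ)⁻¹ * ∏ α, ((D.used α + s α)! : ℂ),
    mul_ne_zero (inv_ne_zero (Nat.cast_ne_zero.2 hN)) hne, ?_⟩
  rw [mul_smul, ← h4, inv_smul_smul₀ (Nat.cast_ne_zero.2 hN)]

lemma brMonomial_mem_brAlg {R : Type*} [CommRing R] [Algebra ℂ R] {ι : Type*} [Fintype ι]
    (v : ι → Fin 2 → R) (w : ι → ι → ℕ) (s : ι → ℕ) : brMonomial v w s ∈ brAlg v :=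
  mul_mem (prod_mem fun p _ => pow_mem (dt_mem_brAlg v p.1 p.2) _)
    (prod_mem fun i _ => pow_mem (sg_mem_brAlg v i) _)

lemma exists_covariant_eq (D : Molecule) : ∃ c : ℂ, D.covariant n =
    c • umbralForm (fun _ : Fin D.atoms => genericForm n)
      (brMonomial slotVec D.w fun α => n - D.used α) := by
  by_cases hD : ∀ α, D.used α ≤ n
  · obtain ⟨c, hc, h⟩ := exists_umbralForm_brMonomial (n := n) D fun α => n - D.used α
    refine ⟨((∏ α, (n - D.used α)! : ℕ) : ℂ) * c⁻¹, ?_⟩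
    have h1 : (genericForm n).IsHomogeneous n := isHomogeneous_binaryForm X
    simp only [fun α => Nat.add_sub_cancel' (hD α), homogeneousComponent_eq_self h1] at h
    rw [h, mul_smul, inv_smul_smul₀ hc, Molecule.covariant, if_pos hD, Nat.cast_smul_eq_nsmul]
  · exact ⟨0, by rw [Molecule.covariant, if_neg hD, zero_smul]⟩

/-- If some letter does not occur exactly `n` times, the value is zero because the general form has
order `n`; otherwise the exponents of the linear forms are the free valences. -/
lemma exists_umbralForm_eq_covariant (D : Molecule) (s : Fin D.atoms → ℕ) :
    ∃ c : ℂ, umbralForm (fun _ : Fin D.atoms => genericForm n) (brMonomial slotVec D.w s) =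
      c • D.covariant n := by
  obtain ⟨c, hc, h⟩ := exists_umbralForm_brMonomial (n := n) D s
  have h1 : (genericForm n).IsHomogeneous n := isHomogeneous_binaryForm X
  by_cases hD : ∀ α, D.used α + s α = n
  · refine ⟨c * ((∏ α, (n - D.used α)! : ℕ) : ℂ)⁻¹, ?_⟩
    have hne : ((∏ α, (n - D.used α)! : ℕ) : ℂ) ≠ 0 :=
      Nat.cast_ne_zero.2 (Finset.prod_ne_zero_iff.2 fun _ _ => Nat.factorial_ne_zero _)
    simp only [hD, homogeneousComponent_eq_self h1] at h
    have hD' : ∀ α, D.used α ≤ n := fun α => by have := hD α; omega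
    rw [h, Molecule.covariant, if_pos hD', ← Nat.cast_smul_eq_nsmul ℂ, mul_smul,
      inv_smul_smul₀ hne]
  · refine ⟨0, ?_⟩
    obtain ⟨α, hα⟩ := not_forall.1 hD
    rw [h, Finset.prod_eq_zero (Finset.mem_univ α)]
    · rw [map_zero, diag, map_zero, smul_zero, zero_smul]
    · rw [homogeneousComponent_of_mem (n := n) h1, if_neg hα, inSlot, map_zero]

end Molecules

/-! ### Gordan's ideals as spans of molecular covariants -/

section GordanSpan

variable {n : ℕ} {ι ζ : Type*} [Fintype ι] [Fintype ζ]

lemma map_slotMap_dt (f : ι → ζ) (i j : ι) :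
    mapAlgHom (slotMap f) (dt (slotVec i) (slotVec j)) = dt (slotVec (f i)) (slotVec (f j)) := by
  refine (map_dt _ _ _).trans ?_
  congr 1 <;> funext c <;> simp [slotVec, slotMap]

lemma mapAlgHom_slotMap_mem_brAlg (f : ι → ζ)
    {q : MvPolynomial (Fin 2) (MvPolynomial (ι × Fin 2) ℂ)} (hq : q ∈ brAlg slotVec) :
    mapAlgHom (slotMap f) q ∈ brAlg (slotVec (ι := ζ)) := by
  refine brAlg_comp_le slotVec f ?_
  rw [← brAlg_slotMap]
  exact ⟨q, hq, rfl⟩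

lemma tau_dt_pow_mul_left {R : Type*} [CommRing R] [Algebra ℂ R] (t r : ℕ) (v w : Fin 2 → R)
    (F G : MvPolynomial (Fin 2) R) : tau t (dt v w ^ r * F) G = dt v w ^ r * tau t F G := by
  rw [dt, ← C_pow, tau_C_mul_left]

variable (n) in
/-- The span of the molecular covariants with `d` atoms of the general form, two of which are
joined by a bracket of multiplicity at least `r`. -/
def gordanSpanDeg (r d : ℕ) : Submodule ℂ (CoordRing n) :=
  Submodule.span ℂ {x | ∃ i j : Fin d, i ≠ j ∧ ∃ q ∈ brAlg slotVec,
    x = umbralForm (fun _ : Fin d => genericForm n) (dt (slotVec i) (slotVec j) ^ r * q)}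

variable (n) in
/-- The span of the molecular covariants of the general form in which some bracket occurs with
multiplicity at least `r`. -/
def gordanSpan (r : ℕ) : Submodule ℂ (CoordRing n) := ⨆ d, gordanSpanDeg n r d

lemma umbralForm_mem_gordanSpan {r : ℕ} {i j : ι} (hij : i ≠ j)
    {q : MvPolynomial (Fin 2) (MvPolynomial (ι × Fin 2) ℂ)} (hq : q ∈ brAlg slotVec) :
    umbralForm (fun _ : ι => genericForm n) (dt (slotVec i) (slotVec j) ^ r * q) ∈
      gordanSpan n r := by
  refine (le_iSup (gordanSpanDeg n r) (Fintype.card ι)) (Submodule.subset_span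
    ⟨Fintype.equivFin ι i, Fintype.equivFin ι j, by simpa using hij,
      mapAlgHom (slotMap (Fintype.equivFin ι)) q, mapAlgHom_slotMap_mem_brAlg _ hq, ?_⟩)
  have h := umbralForm_slotMap (Fintype.equivFin ι) (fun _ => genericForm n)
    (dt (slotVec i) (slotVec j) ^ r * q)
  rw [map_mul, map_pow, map_slotMap_dt] at h
  exact h.symm

lemma gordanSpan_induction {r : ℕ} {W : Submodule ℂ (CoordRing n)}
    (h : ∀ (d : ℕ) (i j : Fin d), i ≠ j → ∀ q ∈ brAlg slotVec,
      umbralForm (fun _ : Fin d => genericForm n) (dt (slotVec i) (slotVec j) ^ r * q) ∈ W) :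
    gordanSpan n r ≤ W := by
  refine iSup_le fun d => Submodule.span_le.2 ?_
  rintro _ ⟨i, j, hij, q, hq, rfl⟩
  exact h d i j hij q hq

lemma dt_pow_mul_mem_brAlg (i j : ι) (r : ℕ)
    {q : MvPolynomial (Fin 2) (MvPolynomial (ι × Fin 2) ℂ)} (hq : q ∈ brAlg slotVec) :
    dt (slotVec i) (slotVec j) ^ r * q ∈ brAlg slotVec :=
  mul_mem (pow_mem (dt_mem_brAlg slotVec i j) r) hq

lemma gordanSpan_le_Cov (r : ℕ) : gordanSpan n r ≤ Subalgebra.toSubmodule (Cov n) :=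
  gordanSpan_induction fun _ i j _ _ hq =>
    molSpan_le_Cov (mem_molSpan (dt_pow_mul_mem_brAlg i j r hq))

lemma degComp_mem_gordanSpanDeg {r : ℕ} {P : CoordRing n} (hP : P ∈ gordanSpan n r) (d : ℕ) :
    degComp d P ∈ gordanSpanDeg n r d := by
  refine gordanSpan_induction (W := (gordanSpanDeg n r d).comap (degComp d)) ?_ hP
  intro d' i j hij q hq
  have h := umbralForm_isDegree (n := n) (ι := Fin d') (dt (slotVec i) (slotVec j) ^ r * q)
  rw [Fintype.card_fin] at h
  rw [Submodule.mem_comap, degComp_of_isDegree h]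
  split_ifs with hd
  · subst hd
    exact Submodule.subset_span ⟨i, j, hij, q, hq, rfl⟩
  · exact zero_mem _

lemma degComp_mem_gordanSpan {r : ℕ} {P : CoordRing n} (hP : P ∈ gordanSpan n r) (d : ℕ) :
    degComp d P ∈ gordanSpan n r :=
  le_iSup (gordanSpanDeg n r) d (degComp_mem_gordanSpanDeg hP d)

lemma Cov_le_iSup_molSpan : Subalgebra.toSubmodule (Cov n) ≤
    ⨆ d, molSpan fun _ : Fin d => genericForm n := by
  intro P hP
  obtain ⟨N, h⟩ := exists_sum_degComp P
  rw [h]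
  exact Submodule.sum_mem _ fun d _ => le_iSup (fun d => molSpan fun _ : Fin d => genericForm n) d
    (mem_molSpan_of_isDegree (degComp_mem_Cov hP d) (isDegree_degComp d P))

lemma umbralForm_const_tau (t : ℕ) (p : MvPolynomial (Fin 2) (MvPolynomial (ι × Fin 2) ℂ))
    (q : MvPolynomial (Fin 2) (MvPolynomial (ζ × Fin 2) ℂ)) :
    umbralForm (fun _ : ι ⊕ ζ => genericForm n)
        (tau t (mapAlgHom (slotMap Sum.inl) p) (mapAlgHom (slotMap Sum.inr) q)) =
      tau t (umbralForm (fun _ : ι => genericForm n) p)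
        (umbralForm (fun _ : ζ => genericForm n) q) :=
  umbralForm_tau (fun _ : ι ⊕ ζ => genericForm n) t p q

lemma tau_slotMap_mem_brAlg (t : ℕ) {p : MvPolynomial (Fin 2) (MvPolynomial (ι × Fin 2) ℂ)}
    {q : MvPolynomial (Fin 2) (MvPolynomial (ζ × Fin 2) ℂ)} (hp : p ∈ brAlg slotVec)
    (hq : q ∈ brAlg slotVec) :
    tau t (mapAlgHom (slotMap Sum.inl) p) (mapAlgHom (slotMap Sum.inr) q) ∈
      brAlg (slotVec (ι := ι ⊕ ζ)) := by
  rw [slotVec_sum]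
  refine tau_mem_brAlg t ?_ ?_
  · rw [← brAlg_slotMap]; exact ⟨p, hp, rfl⟩
  · rw [← brAlg_slotMap]; exact ⟨q, hq, rfl⟩

lemma tau_umbralForm_mem_gordanSpan {r : ℕ} (t : ℕ) {i j : ι} (hij : i ≠ j)
    {p : MvPolynomial (Fin 2) (MvPolynomial (ι × Fin 2) ℂ)}
    {q : MvPolynomial (Fin 2) (MvPolynomial (ζ × Fin 2) ℂ)} (hp : p ∈ brAlg slotVec)
    (hq : q ∈ brAlg slotVec) :
    tau t (umbralForm (fun _ : ι => genericForm n) (dt (slotVec i) (slotVec j) ^ r * p))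
      (umbralForm (fun _ : ζ => genericForm n) q) ∈ gordanSpan n r := by
  rw [← umbralForm_const_tau, map_mul, map_pow, map_slotMap_dt, tau_dt_pow_mul_left]
  exact umbralForm_mem_gordanSpan (Sum.inl_injective.ne hij) (tau_slotMap_mem_brAlg t hp hq)

lemma tau_umbralForm_mem_gordanSpan_of_mem {r : ℕ} (t : ℕ) {P : CoordRing n}
    (hP : P ∈ gordanSpan n r) {q : MvPolynomial (Fin 2) (MvPolynomial (ζ × Fin 2) ℂ)}
    (hq : q ∈ brAlg slotVec) :
    tau t P (umbralForm (fun _ : ζ => genericForm n) q) ∈ gordanSpan n r := by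
  have h : gordanSpan n r ≤ (gordanSpan n r).comap
      ((tau t).flip (umbralForm (fun _ : ζ => genericForm n) q)) := by
    refine gordanSpan_induction fun d i j hij p hp => ?_
    rw [Submodule.mem_comap, LinearMap.flip_apply]
    exact tau_umbralForm_mem_gordanSpan t hij hp hq
  have h1 := h hP
  rwa [Submodule.mem_comap, LinearMap.flip_apply] at h1

/-- A bracket inside the first argument is a constant for `Ω`, so its power survives in all the
terms of the transvectant. This stability, stronger than that of an ideal, is the reason for working
with `gordanSpan`. -/
lemma tau_mem_gordanSpan {r : ℕ} (t : ℕ) {P Q : CoordRing n} (hP : P ∈ gordanSpan n r)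
    (hQ : Q ∈ Cov n) : tau t P Q ∈ gordanSpan n r := by
  have h : Subalgebra.toSubmodule (Cov n) ≤ (gordanSpan n r).comap (tau t P) := by
    refine Cov_le_iSup_molSpan.trans (iSup_le fun d => ?_)
    rw [molSpan, Submodule.map_le_iff_le_comap]
    intro q hq
    rw [Subalgebra.mem_toSubmodule] at hq
    rw [Submodule.mem_comap, Submodule.mem_comap]
    exact tau_umbralForm_mem_gordanSpan_of_mem t hP hq
  exact Submodule.mem_comap.1 (h ((Subalgebra.mem_toSubmodule _).2 hQ))

/-- The product of the edges of a molecule of positive grade `≥ r` contains an `r`-th power. -/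
lemma covariant_mem_gordanSpan {r : ℕ} (hr : 1 ≤ r) (D : Molecule) (hD : r ≤ D.grade) :
    D.covariant n ∈ gordanSpan n r := by
  obtain ⟨⟨i, j⟩, -, hij⟩ := (Finset.le_sup_iff (Nat.lt_of_lt_of_le Nat.zero_lt_one hr)).1 hD
  have hne : i ≠ j := by
    rintro rfl
    have := D.loopless i
    dsimp only at hij
    omega
  obtain ⟨c, h⟩ := exists_covariant_eq (n := n) D
  rw [h]
  refine Submodule.smul_mem _ _ ?_
  have h1 : D.w = (fun a b => if (a, b) = (i, j) then r else 0) +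
      fun a b => if (a, b) = (i, j) then D.w i j - r else D.w a b := by
    funext a b
    by_cases hab : (a, b) = (i, j)
    · obtain ⟨rfl, rfl⟩ := Prod.mk.inj hab
      simp only [Pi.add_apply, if_true]
      dsimp only at hij
      omega
    · simp only [Pi.add_apply, if_neg hab, zero_add]
  have h2 (s : Fin D.atoms → ℕ) : brMonomial slotVec D.w s = dt (slotVec i) (slotVec j) ^ r *
      brMonomial slotVec (fun a b => if (a, b) = (i, j) then D.w i j - r else D.w a b) s := by
    rw [← brMonomial_single, brMonomial_mul, ← h1, zero_add]
  rw [h2]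
  exact umbralForm_mem_gordanSpan hne (brMonomial_mem_brAlg _ _ _)

/-- The condition `1 ≤ r` ensures that a molecule of grade at least `r` has an edge; for `r = 0` it
might have no atoms at all. -/
lemma coe_mem_gordanSpan {r : ℕ} (hr : 1 ≤ r) {P : Cov n} (hP : P ∈ gordanIdeal n r) :
    (P : CoordRing n) ∈ gordanSpan n r := by
  induction hP using Submodule.span_induction with
  | mem x h =>
    obtain ⟨D, hD, h⟩ := h
    rw [h]
    exact covariant_mem_gordanSpan hr D hD
  | zero => exact zero_mem _
  | add x y _ _ hx hy => exact add_mem hx hy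
  | smul a x _ hx =>
    rw [smul_eq_mul, mul_comm]
    have := tau_mem_gordanSpan 0 hx a.2
    rwa [tau_zero_apply] at this

lemma covariant_mem_Cov (D : Molecule) : D.covariant n ∈ Cov n := by
  obtain ⟨c, h⟩ := exists_covariant_eq (n := n) D
  rw [h]
  exact Subalgebra.smul_mem _ (molSpan_le_Cov (mem_molSpan (brMonomial_mem_brAlg _ _ _))) c

/-- The factor `[i j] ^ r` times a monomial without loops is the monomial of a molecule whose edge
from `i` to `j` has weight at least `r`. -/
lemma gordanSpan_le_ideal (r : ℕ) : gordanSpan n r ≤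
    ((gordanIdeal n r).restrictScalars ℂ).map (Cov n).val.toLinearMap := by
  refine gordanSpan_induction fun d i j hij q hq => ?_
  have hq' := brAlg_le_span_brMonomial _ hq
  clear hq
  induction hq' using Submodule.span_induction with
  | zero => simp
  | add x y _ _ hx hy => rw [mul_add, map_add]; exact add_mem hx hy
  | smul c x _ hx => rw [mul_smul_comm, map_smul]; exact Submodule.smul_mem _ _ hx
  | mem x h =>
    obtain ⟨w, s, hw, rfl⟩ := h
    rw [← brMonomial_single, brMonomial_mul]
    let D : Molecule := ⟨d, (fun a b => if (a, b) = (i, j) then r else 0) + w, fun a => by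
      simp only [Pi.add_apply, hw, add_zero]
      refine if_neg fun h => hij ?_
      rw [Prod.mk.injEq] at h
      exact h.1.symm.trans h.2⟩
    obtain ⟨c, h⟩ := exists_umbralForm_eq_covariant (n := n) D (0 + s)
    refine ⟨c • (⟨D.covariant n, covariant_mem_Cov D⟩ : Cov n), ?_, h.symm⟩
    refine Submodule.smul_mem ((gordanIdeal n r).restrictScalars ℂ) c (Ideal.subset_span ⟨D, ?_, rfl⟩)
    refine le_trans ?_ (Finset.le_sup (f := fun e : Fin d × Fin d => D.w e.1 e.2)
      (Finset.mem_univ (i, j)))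
    simp [D]

lemma exists_gordanIdeal_of_mem {r : ℕ} {P : CoordRing n} (hP : P ∈ gordanSpan n r) :
    ∃ Q ∈ gordanIdeal n r, (Q : CoordRing n) = P := by
  obtain ⟨Q, hQ, h⟩ := gordanSpan_le_ideal r hP
  exact ⟨Q, hQ, h⟩

end GordanSpan

/-! ### Closure properties of the algebra of covariants -/

section TauHomogeneous

variable {R : Type*} [CommRing R] [Algebra ℂ R]

lemma tau_swap (t : ℕ) (F G : MvPolynomial (Fin 2) R) :
    tau t F G = ((-1) ^ t : ℂ) • tau t G F := by
  induction t generalizing F G with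
  | zero => simp [mul_comm]
  | succ t ih =>
    rw [tau_succ, tau_succ, ih (pderiv 0 F), ih (pderiv 1 F), pow_succ, ← smul_sub, mul_neg_one,
      neg_smul, ← smul_neg, neg_sub]

lemma tau_self_of_odd {t : ℕ} (ht : Odd t) (F : MvPolynomial (Fin 2) R) : tau t F F = 0 := by
  have h := tau_swap t F F
  rw [ht.neg_one_pow, neg_smul, one_smul] at h
  have h2 : (2 : ℂ) • tau t F F = 0 := by
    rw [two_smul]
    nth_rw 1 [h]
    exact neg_add_cancel _
  have h3 := congrArg (fun x => (2 : ℂ)⁻¹ • x) h2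
  simpa only [inv_smul_smul₀ (two_ne_zero (α := ℂ)), smul_zero] using h3

lemma pderiv_eq_zero_of_isHomogeneous_zero {F : MvPolynomial (Fin 2) R} (hF : F.IsHomogeneous 0)
    (c : Fin 2) : pderiv c F = 0 := by
  rw [← totalDegree_zero_iff_isHomogeneous, totalDegree_eq_zero_iff_eq_C] at hF
  rw [hF, pderiv_C]

/-- Indices above an order give zero for `tau` by differentiation and for `transvectant` by
convention; the two operations remain proportional in that range. -/
lemma tau_eq_zero_left {t m : ℕ} {F : MvPolynomial (Fin 2) R} (hF : F.IsHomogeneous m)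
    (h : m < t) (G : MvPolynomial (Fin 2) R) : tau t F G = 0 := by
  induction t generalizing m F G with
  | zero => omega
  | succ t ih =>
    rw [tau_succ]
    rcases m with _ | m
    · simp [pderiv_eq_zero_of_isHomogeneous_zero hF]
    · rw [ih hF.pderiv (by omega), ih hF.pderiv (by omega), sub_zero]

lemma tau_eq_zero_right {t m : ℕ} {G : MvPolynomial (Fin 2) R} (hG : G.IsHomogeneous m)
    (h : m < t) (F : MvPolynomial (Fin 2) R) : tau t F G = 0 := by
  rw [tau_swap, tau_eq_zero_left hG h, smul_zero]

lemma tau_isHomogeneous (t : ℕ) {m l : ℕ} {F G : MvPolynomial (Fin 2) R} (hF : F.IsHomogeneous m)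
    (hG : G.IsHomogeneous l) : (tau t F G).IsHomogeneous (m + l - 2 * t) := by
  by_cases h : t ≤ m ∧ t ≤ l
  · induction t generalizing m l F G with
    | zero => simpa using hF.mul hG
    | succ t ih =>
      rw [tau_succ, show m + l - 2 * (t + 1) = (m - 1) + (l - 1) - 2 * t by omega]
      exact (ih hF.pderiv hG.pderiv (by omega)).sub (ih hF.pderiv hG.pderiv (by omega))
  · rw [not_and_or, not_le, not_le] at h
    rcases h with h | h
    · rw [tau_eq_zero_left hF h]; exact isHomogeneous_zero _ _ _
    · rw [tau_eq_zero_right hG h]; exact isHomogeneous_zero _ _ _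

lemma isHomogeneous_smul {F : MvPolynomial (Fin 2) R} {m : ℕ}
    (hF : F.IsHomogeneous m) (c : ℂ) : (c • F).IsHomogeneous m := by
  rw [← algebraMap_smul R c, smul_eq_C_mul]
  exact hF.C_mul _

lemma transvectant_isHomogeneous (t : ℕ) {m l : ℕ} {F G : MvPolynomial (Fin 2) R}
    (hF : F.IsHomogeneous m) (hG : G.IsHomogeneous l) :
    (transvectant m l t F G).IsHomogeneous (m + l - 2 * t) := by
  obtain ⟨c, h⟩ := transvectant_eq_smul_tau m l t F G
  rw [h]
  exact isHomogeneous_smul (tau_isHomogeneous t hF hG) c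

/-- The unnormalized transvectant of homogeneous forms is a multiple of the transvectant. -/
lemma exists_tau_eq_smul_transvectant (t : ℕ) {m l : ℕ} {F G : MvPolynomial (Fin 2) R}
    (hF : F.IsHomogeneous m) (hG : G.IsHomogeneous l) :
    ∃ c : ℂ, tau t F G = c • transvectant m l t F G := by
  by_cases h : t ≤ m ∧ t ≤ l
  · refine ⟨(((m - t)! * (l - t)! : ℕ) : ℂ)⁻¹, ?_⟩
    rw [tau_eq_transvectant h.1 h.2, inv_smul_smul₀]
    exact Nat.cast_ne_zero.2 (mul_ne_zero (Nat.factorial_ne_zero _) (Nat.factorial_ne_zero _))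
  · refine ⟨0, ?_⟩
    rw [zero_smul]
    rw [not_and_or, not_le, not_le] at h
    rcases h with h | h
    · exact tau_eq_zero_left hF h G
    · exact tau_eq_zero_right hG h F

end TauHomogeneous

/-! ### Generation of the covariants by transvectants -/

section CovAlg

variable {n : ℕ}

lemma TransClosed.isHomogeneous {S : Set (CoordRing n)} {m : ℕ} {F : CoordRing n}
    (h : TransClosed S m F) : F.IsHomogeneous m := by
  induction h with
  | base _ hm => exact hm
  | step r _ _ hF hG => exact transvectant_isHomogeneous r hF hG

/-- By the first fundamental theorem both arguments are umbral values of bracket polynomials, and a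
transvectant of bracket polynomials in disjoint letters is again one. -/
lemma tau_mem_Cov (t : ℕ) {P Q : CoordRing n} (hP : P ∈ Cov n) (hQ : Q ∈ Cov n) :
    tau t P Q ∈ Cov n := by
  have h1 (d : ℕ) {q : MvPolynomial (Fin 2) (MvPolynomial (Fin d × Fin 2) ℂ)}
      (hq : q ∈ brAlg slotVec) (P : CoordRing n) (hP : P ∈ Cov n) :
      tau t P (umbralForm (fun _ : Fin d => genericForm n) q) ∈ Cov n := by
    have h : Subalgebra.toSubmodule (Cov n) ≤ (Subalgebra.toSubmodule (Cov n)).comap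
        ((tau t).flip (umbralForm (fun _ : Fin d => genericForm n) q)) := by
      refine Cov_le_iSup_molSpan.trans (iSup_le fun d' => ?_)
      rw [molSpan, Submodule.map_le_iff_le_comap]
      intro p hp
      rw [Subalgebra.mem_toSubmodule] at hp
      rw [Submodule.mem_comap, Submodule.mem_comap, LinearMap.flip_apply, ← umbralForm_const_tau]
      exact molSpan_le_Cov (mem_molSpan (tau_slotMap_mem_brAlg t hp hq))
    have h2 := h ((Subalgebra.mem_toSubmodule _).2 hP)
    rwa [Submodule.mem_comap, LinearMap.flip_apply] at h2
  have h : Subalgebra.toSubmodule (Cov n) ≤ (Subalgebra.toSubmodule (Cov n)).comap (tau t P) := by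
    refine Cov_le_iSup_molSpan.trans (iSup_le fun d => ?_)
    rw [molSpan, Submodule.map_le_iff_le_comap]
    intro q hq
    rw [Subalgebra.mem_toSubmodule] at hq
    rw [Submodule.mem_comap, Submodule.mem_comap]
    exact h1 d hq P hP
  exact Submodule.mem_comap.1 (h ((Subalgebra.mem_toSubmodule _).2 hQ))

lemma covAlg_le {S : Set (CoordRing n)} {A : Subalgebra ℂ (CoordRing n)} (hS : S ⊆ A)
    (hA : ∀ t, ∀ F ∈ A, ∀ G ∈ A, tau t F G ∈ A) : covAlg S ≤ A := by
  refine Algebra.adjoin_le ?_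
  rintro F ⟨m, h⟩
  induction h with
  | base hF _ => exact hS hF
  | @step m p F G r _ _ hF hG =>
    obtain ⟨c, h⟩ := transvectant_eq_smul_tau m p r F G
    rw [SetLike.mem_coe, h]
    exact Subalgebra.smul_mem _ (hA r F hF G hG) c

lemma covAlg_le_Cov {S : Set (CoordRing n)} (hS : S ⊆ Cov n) : covAlg S ≤ Cov n :=
  covAlg_le hS fun t _ hF _ hG => tau_mem_Cov t hF hG

lemma genericForm_mem_Cov : genericForm n ∈ Cov n :=
  molSpan_le_Cov (mem_molSpan_unit _)

lemma isHomogeneous_genericForm : (genericForm n).IsHomogeneous n := isHomogeneous_binaryForm X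

lemma molSpan_unit_genericForm_le {c : ℂ} (hc : c ≠ 0) (F : Unit → CoordRing n)
    (hF : F () = genericForm n) : molSpan F ≤ Submodule.span ℂ {c • genericForm n} := by
  refine (molSpan_unit_le F).trans (Submodule.span_le.2 ?_)
  rintro _ ⟨m, rfl⟩
  dsimp only
  rw [hF, homogeneousComponent_of_mem (n := n) isHomogeneous_genericForm]
  split_ifs
  · exact Submodule.mem_span_singleton.2 ⟨c⁻¹, inv_smul_smul₀ hc _⟩
  · exact zero_mem _

/-- Induction on the number of atoms: one atom is split off, and the covariant becomes a combination
of transvectants with `f` of covariants having one atom fewer. The factor `c` is there because the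
reduced family is only known to contain a multiple of `f`. -/
lemma molSpan_succ_le_span_transClosed {S : Set (CoordRing n)} {c : ℂ} (hc : c ≠ 0)
    (hS : c • genericForm n ∈ S) (d : ℕ) :
    molSpan (fun _ : Fin (d + 1) => genericForm n) ≤
      Submodule.span ℂ {F | ∃ m, TransClosed S m F} := by
  have hT : TransClosed S n (c • genericForm n) :=
    .base hS (isHomogeneous_smul isHomogeneous_genericForm c)
  have hf : c • genericForm n ∈ {F | ∃ m, TransClosed S m F} := ⟨n, hT⟩
  induction d with
  | zero =>
    have h := molSpan_comp (Equiv.equivPUnit (Fin 1) : Fin 1 ≃ Unit) fun _ => genericForm n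
    refine (le_of_eq h).trans ((molSpan_unit_genericForm_le hc _ rfl).trans ?_)
    exact Submodule.span_mono (Set.singleton_subset_iff.2 hf)
  | succ d ih =>
    have e : Fin (d + 1) ⊕ Unit ≃ Fin (d + 1 + 1) :=
      (Equiv.sumCongr (Equiv.refl _) (Equiv.equivPUnit (Fin 1)).symm).trans finSumFinEquiv
    intro x hx
    rw [← molSpan_comp e] at hx
    obtain ⟨t, ht⟩ := exists_mem_tauLT_of_mem_molSpan hx
    refine tauLT_le ?_ ht
    intro u _ F hF G hG
    refine tau_mem_of_span ?_ (ih hF) (molSpan_unit_genericForm_le hc _ rfl hG)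
    rintro F ⟨m, hF⟩ G rfl
    obtain ⟨c, h⟩ := exists_tau_eq_smul_transvectant u hF.isHomogeneous hT.isHomogeneous
    rw [h]
    exact Submodule.smul_mem _ _ (Submodule.subset_span ⟨_, hF.step u hT⟩)

lemma molSpan_zero_le (F : Fin 0 → CoordRing n) :
    molSpan F ≤ Subalgebra.toSubmodule (⊥ : Subalgebra ℂ (CoordRing n)) := by
  rw [molSpan, Submodule.map_le_iff_le_comap]
  have h : brAlg (slotVec (ι := Fin 0)) ≤ ⊥ := by
    refine Algebra.adjoin_le ?_
    rintro _ (⟨⟨i, j⟩, rfl⟩ | ⟨i, rfl⟩)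
    · exact i.elim0
    · exact i.elim0
  intro q hq
  obtain ⟨c, rfl⟩ := Algebra.mem_bot.1 (h hq)
  rw [Submodule.mem_comap, Subalgebra.mem_toSubmodule, Algebra.algebraMap_eq_smul_one, map_smul]
  refine Subalgebra.smul_mem _ ?_ c
  have h1 : (1 : MvPolynomial (Fin 0 × Fin 2) ℂ) = monomial 0 1 := rfl
  rw [← C_1, umbralForm, mapCoeff_C, h1, umbral_monomial]
  simp [one_mem]

lemma Cov_le_covAlg_of_smul_mem {S : Set (CoordRing n)} {c : ℂ} (hc : c ≠ 0)
    (hS : c • genericForm n ∈ S) : Cov n ≤ covAlg S := by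
  have h : Subalgebra.toSubmodule (Cov n) ≤ Subalgebra.toSubmodule (covAlg S) := by
    refine Cov_le_iSup_molSpan.trans (iSup_le fun d => ?_)
    rcases d with _ | d
    · exact (molSpan_zero_le _).trans (Subalgebra.toSubmodule.monotone bot_le)
    · refine (molSpan_succ_le_span_transClosed hc hS d).trans (Submodule.span_le.2 fun x hx => ?_)
      exact Algebra.subset_adjoin hx
  exact h

lemma Cov_le_covAlg {S : Set (CoordRing n)} (hS : genericForm n ∈ S) : Cov n ≤ covAlg S :=
  Cov_le_covAlg_of_smul_mem one_ne_zero (by rwa [one_smul])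

end CovAlg

/-! ### Covariants of a substituted form -/

section Substitution

variable {n p : ℕ}

lemma substForm_eq_mapAlgHom (H : CoordRing n) (G : CoordRing p) :
    substForm H G = mapAlgHom (aeval (formCoeff p H)) G := rfl

/-- The algebra of the covariants of `S_p` with a form `H` substituted for the general form. -/
def covOf (p : ℕ) (H : CoordRing n) : Subalgebra ℂ (CoordRing n) :=
  (Cov p).map (mapAlgHom (aeval (formCoeff p H)))

lemma tau_mem_covOf {H P Q : CoordRing n} (t : ℕ) (hP : P ∈ covOf p H) (hQ : Q ∈ covOf p H) :
    tau t P Q ∈ covOf p H := by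
  obtain ⟨P, hP, rfl⟩ := hP
  obtain ⟨Q, hQ, rfl⟩ := hQ
  exact ⟨tau t P Q, tau_mem_Cov t hP hQ, map_tau _ _ _ _⟩

lemma homogeneousComponent_mem_covOf {H P : CoordRing n} (m : ℕ) (hP : P ∈ covOf p H) :
    homogeneousComponent m P ∈ covOf p H := by
  obtain ⟨P, hP, rfl⟩ := hP
  refine ⟨homogeneousComponent m P, homogeneousComponent_mem_Cov hP m, ?_⟩
  exact mapCoeff_homogeneousComponent (aeval (formCoeff p H)).toLinearMap m P

lemma binaryForm_formCoeff {R : Type*} [CommRing R] [Algebra ℂ R] {H : MvPolynomial (Fin 2) R}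
    (hH : H.IsHomogeneous p) : binaryForm p (formCoeff p H) = H := by
  have h := homogeneousComponent_fin_two p H
  rw [homogeneousComponent_eq_self hH] at h
  refine Eq.trans ?_ h.symm
  rw [binaryForm, ← Finset.sum_range_reflect, Finset.sum_range]
  refine Finset.sum_congr rfl fun i _ => ?_
  have hi : (i : ℕ) ≤ p := Nat.lt_succ_iff.1 i.2
  rw [← monomial_single_add_single, formCoeff, ← nsmul_eq_mul, ← Nat.cast_smul_eq_nsmul ℂ,
    smul_inv_smul₀ (choose_ne_zero i)]
  have h1 : p + 1 - 1 - (i : ℕ) = p - i := by omega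
  have h2 : p - (p - (i : ℕ)) = i := by omega
  rw [h1, h2]

lemma substForm_genericForm {H : CoordRing n} (hH : H.IsHomogeneous p) :
    substForm H (genericForm p) = H := by
  rw [substForm, genericForm, map_binaryForm]
  conv_rhs => rw [← binaryForm_formCoeff hH]
  congr 1
  funext i
  exact aeval_X _ _

lemma self_mem_covOf {H : CoordRing n} (hH : H.IsHomogeneous p) : H ∈ covOf p H :=
  ⟨genericForm p, genericForm_mem_Cov, substForm_genericForm hH⟩

/-- Substitution commutes with transvectants, and `Cov p` is generated from its general form by
transvectants, so it is enough that `H` itself is a covariant. -/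
lemma covOf_le_Cov {H : CoordRing n} (hH : H.IsHomogeneous p) (hC : H ∈ Cov n) :
    covOf p H ≤ Cov n := by
  refine Subalgebra.map_le.2 ((Cov_le_covAlg (Set.mem_singleton _)).trans ?_)
  refine covAlg_le ?_ ?_
  · rintro _ rfl
    have h := substForm_genericForm hH
    rw [substForm_eq_mapAlgHom] at h
    rw [SetLike.mem_coe, Subalgebra.mem_comap, h]
    exact hC
  · intro t F hF G hG
    rw [Subalgebra.mem_comap] at hF hG ⊢
    have h := map_tau (aeval (formCoeff p H) : MvPolynomial (Fin (p + 1)) ℂ →ₐ[ℂ] _).toRingHom t F G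
    have h' : mapAlgHom (aeval (formCoeff p H)) (tau t F G) = _ := h
    rw [h']
    exact tau_mem_Cov t hF hG

end Substitution

/-! ### Decomposition of the leading Gordan ideal -/

section GordanDecomposition

variable {n : ℕ} {ι ζ : Type*} [Fintype ι] [Fintype ζ]

lemma brAlg_pair_le {R : Type*} [CommRing R] [Algebra ℂ R] (v : Unit ⊕ Unit → Fin 2 → R) :
    Subalgebra.toSubmodule (brAlg v) ≤ Submodule.span ℂ {x | ∃ c m l : ℕ,
      x = dt (v (.inl ())) (v (.inr ())) ^ c * (sg (v (.inl ())) ^ m * sg (v (.inr ())) ^ l)} := by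
  rw [brAlg, Algebra.adjoin_eq_span, Submodule.span_le]
  intro x hx
  suffices h : ∃ (a : ℂ) (c m l : ℕ), x = a • (dt (v (.inl ())) (v (.inr ())) ^ c *
      (sg (v (.inl ())) ^ m * sg (v (.inr ())) ^ l)) by
    obtain ⟨a, c, m, l, rfl⟩ := h
    exact Submodule.smul_mem _ _ (Submodule.subset_span ⟨c, m, l, rfl⟩)
  induction hx using Submonoid.closure_induction with
  | mem x h =>
    rcases h with ⟨⟨i | i, j | j⟩, rfl⟩ | ⟨i | i, rfl⟩
    · exact ⟨0, 0, 0, 0, by simp [dt_self]⟩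
    · exact ⟨1, 1, 0, 0, by simp⟩
    · exact ⟨-1, 1, 0, 0, by simpa using dt_swap (v (Sum.inr i)) (v (Sum.inl j))⟩
    · exact ⟨0, 0, 0, 0, by simp [dt_self]⟩
    · exact ⟨1, 0, 1, 0, by simp⟩
    · exact ⟨1, 0, 0, 1, by simp⟩
  | one => exact ⟨1, 0, 0, 0, by simp⟩
  | mul x y _ _ hx hy =>
    obtain ⟨a, c, m, l, rfl⟩ := hx
    obtain ⟨a', c', m', l', rfl⟩ := hy
    refine ⟨a * a', c + c', m + m', l + l', ?_⟩
    rw [smul_mul_smul_comm]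
    congr 1
    ring

lemma exists_homogeneousComponent_eq_smul {R : Type*} [CommRing R] [Algebra ℂ R]
    {F : MvPolynomial (Fin 2) R} {m : ℕ} (hF : F.IsHomogeneous m) (i : ℕ) :
    ∃ c : ℂ, homogeneousComponent i F = c • F := by
  rw [homogeneousComponent_of_mem hF]
  split_ifs
  · exact ⟨1, (one_smul _ _).symm⟩
  · exact ⟨0, (zero_smul _ _).symm⟩

/-- With two atoms, the further exponent `c` of the only bracket decides: `c = 0` gives a multiple
of `(f, f)_{2k}`, `c = 1` gives zero by antisymmetry, and `c ≥ 2` has grade at least `2k + 2`. The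
vanishing for `c = 1` is what makes the grade rise by two. -/
lemma umbralForm_pair_mem (k : ℕ)
    {q : MvPolynomial (Fin 2) (MvPolynomial ((Unit ⊕ Unit) × Fin 2) ℂ)} (hq : q ∈ brAlg slotVec) :
    umbralForm (fun _ => genericForm n)
        (dt (slotVec (.inl ())) (slotVec (.inr ())) ^ (2 * k) * q) ∈
      Submodule.span ℂ {tau (2 * k) (genericForm n) (genericForm n)} ⊔
        gordanSpan n (2 * k + 2) := by
  have hq' := brAlg_pair_le _ hq
  clear hq
  induction hq' using Submodule.span_induction with
  | zero => simp
  | add x y _ _ hx hy => rw [mul_add, map_add]; exact add_mem hx hy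
  | smul c x _ hx => rw [mul_smul_comm, map_smul]; exact Submodule.smul_mem _ _ hx
  | mem x h =>
    obtain ⟨c, m, l, rfl⟩ := h
    have h1 (t : ℕ) : ∃ N : ℂ, umbralForm (fun _ : Unit ⊕ Unit => genericForm n)
        (dt (slotVec (.inl ())) (slotVec (.inr ())) ^ t * (sg (slotVec (.inl ())) ^ m *
          sg (slotVec (.inr ())) ^ l)) = N • tau t (genericForm n) (genericForm n) := by
      obtain ⟨N, -, h⟩ := exists_umbralForm_two (fun _ => genericForm n) t m l
      obtain ⟨c₁, h₁⟩ := exists_homogeneousComponent_eq_smul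
        (isHomogeneous_genericForm (n := n)) (m + t)
      obtain ⟨c₂, h₂⟩ := exists_homogeneousComponent_eq_smul
        (isHomogeneous_genericForm (n := n)) (l + t)
      refine ⟨N * (c₂ * c₁), ?_⟩
      rw [h, h₁, h₂, map_smul, map_smul, LinearMap.smul_apply, smul_smul, smul_smul, mul_assoc]
    rcases c with _ | _ | c
    · obtain ⟨N, h⟩ := h1 (2 * k)
      rw [pow_zero, one_mul, h]
      exact Submodule.mem_sup_left (Submodule.smul_mem _ _ (Submodule.subset_span rfl))
    · obtain ⟨N, h⟩ := h1 (2 * k + 1)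
      rw [← mul_assoc, ← pow_add, zero_add, h, tau_self_of_odd (odd_two_mul_add_one k), smul_zero]
      exact zero_mem _
    · refine Submodule.mem_sup_right ?_
      rw [← mul_assoc, ← pow_add, show 2 * k + (c + 1 + 1) = (2 * k + 2) + c by ring, pow_add,
        mul_assoc]
      exact umbralForm_mem_gordanSpan (by simp) (dt_pow_mul_mem_brAlg _ _ _
        (mul_mem (pow_mem (sg_mem_brAlg _ _) _) (pow_mem (sg_mem_brAlg _ _) _)))

lemma exists_slotMap_eq (e : ι ≃ ζ) {q : MvPolynomial (Fin 2) (MvPolynomial (ζ × Fin 2) ℂ)}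
    (hq : q ∈ brAlg slotVec) : ∃ q' ∈ brAlg slotVec, mapAlgHom (slotMap e) q' = q := by
  have h := brAlg_comp_le (slotVec ∘ e) e.symm
  rw [Function.comp_assoc, e.self_comp_symm, Function.comp_id, ← brAlg_slotMap] at h
  exact h hq

/-- Modulo brackets of multiplicity `2k + 2`, a molecular covariant with a bracket of multiplicity
`2k` is a combination of transvectants of `(f, f)_{2k}` with covariants of smaller degree. -/
lemma gordanSpanDeg_le (k d : ℕ) : gordanSpanDeg n (2 * k) d ≤
    Submodule.span ℂ {x | ∃ t, ∃ M ∈ Cov n, ∃ d', IsDegree d' M ∧ d' < d ∧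
      x = tau t (tau (2 * k) (genericForm n) (genericForm n)) M} ⊔ gordanSpan n (2 * k + 2) := by
  refine Submodule.span_le.2 ?_
  rintro _ ⟨i, j, hij, q, hq, rfl⟩
  let κ := {x : Fin d // x ≠ i ∧ x ≠ j}
  -- The atoms `i` and `j` form the first group and the remaining `d - 2` atoms the second.
  let g : (Unit ⊕ Unit) ⊕ κ → Fin d := Sum.elim (Sum.elim (fun _ => i) fun _ => j) Subtype.val
  have hg : Function.Bijective g := by
    constructor
    · rintro ((a | a) | ⟨a, ha, ha'⟩) ((b | b) | ⟨b, hb, hb'⟩) h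
      · rfl
      · exact absurd h hij
      · exact absurd h.symm hb
      · exact absurd h.symm hij
      · rfl
      · exact absurd h.symm hb'
      · exact absurd h ha
      · exact absurd h ha'
      · exact congrArg Sum.inr (Subtype.ext h)
    · intro x
      by_cases hi : x = i
      · exact ⟨.inl (.inl ()), hi.symm⟩
      by_cases hj : x = j
      · exact ⟨.inl (.inr ()), hj.symm⟩
      exact ⟨.inr ⟨x, hi, hj⟩, rfl⟩
  let e := Equiv.ofBijective g hg
  have hcard : Fintype.card κ < d := by
    have h := Fintype.card_congr e
    rw [Fintype.card_sum, Fintype.card_sum, Fintype.card_fin, Fintype.card_unit] at h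
    omega
  obtain ⟨q, hq', rfl⟩ := exists_slotMap_eq e hq
  have h1 : dt (slotVec i) (slotVec j) ^ (2 * k) * mapAlgHom (slotMap e) q =
      mapAlgHom (slotMap e) (dt (slotVec (.inl (.inl ()))) (slotVec (.inl (.inr ()))) ^ (2 * k) *
        q) := by
    rw [map_mul, map_pow, map_slotMap_dt]
    rfl
  rw [h1, SetLike.mem_coe, umbralForm_slotMap]
  clear h1 hq
  change umbralForm (fun _ : (Unit ⊕ Unit) ⊕ κ => genericForm n) _ ∈ _
  obtain ⟨T, hT⟩ := exists_mem_tauLT_of_mem_brAlg hq'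
  set W := Submodule.span ℂ {x | ∃ t, ∃ M ∈ Cov n, ∃ d', IsDegree d' M ∧ d' < d ∧
    x = tau t (tau (2 * k) (genericForm n) (genericForm n)) M} ⊔ gordanSpan n (2 * k + 2) with hW
  have key : ∀ a ∈ brAlg slotVec, ∀ b ∈ brAlg slotVec, ∀ u,
      umbralForm (fun _ : (Unit ⊕ Unit) ⊕ κ => genericForm n)
        (dt (slotVec (.inl (.inl ()))) (slotVec (.inl (.inr ()))) ^ (2 * k) *
          tau u (mapAlgHom (slotMap Sum.inl) a) (mapAlgHom (slotMap Sum.inr) b)) ∈ W := by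
    intro a ha b hb u
    -- The bracket of `i` and `j` is internal to the first group, so its power moves inside the
    -- first argument, where `umbralForm_pair_mem` applies.
    have h1 := tau_dt_pow_mul_left u (2 * k) (slotVec (.inl (.inl ())))
      (slotVec (.inl (.inr ()))) (mapAlgHom (slotMap (Sum.inl : _ → (Unit ⊕ Unit) ⊕ κ)) a)
      (mapAlgHom (slotMap Sum.inr) b)
    rw [← map_slotMap_dt Sum.inl, ← map_pow, ← map_mul, map_pow, map_slotMap_dt] at h1
    rw [← h1, umbralForm_const_tau]
    have hM := molSpan_le_Cov (mem_molSpan (F := fun _ : κ => genericForm n) hb)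
    have hd := umbralForm_isDegree (n := n) (ι := κ) b
    obtain ⟨x, hx, y, hy, hxy⟩ := Submodule.mem_sup.1 (umbralForm_pair_mem (n := n) k ha)
    obtain ⟨c, rfl⟩ := Submodule.mem_span_singleton.1 hx
    rw [← hxy, map_add, LinearMap.add_apply, map_smul, LinearMap.smul_apply]
    exact add_mem (Submodule.mem_sup_left (Submodule.smul_mem _ _
      (Submodule.subset_span ⟨u, _, hM, _, hd, hcard, rfl⟩)))
      (Submodule.mem_sup_right (tau_mem_gordanSpan u hy hM))
  suffices h : tauLT T (Subalgebra.toSubmodule ((brAlg slotVec).map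
      (mapAlgHom (slotMap Sum.inl)))) (Subalgebra.toSubmodule ((brAlg slotVec).map
      (mapAlgHom (slotMap Sum.inr)))) ≤ W.comap ((umbralForm
      (fun _ : (Unit ⊕ Unit) ⊕ κ => genericForm n)) ∘ₗ LinearMap.mulLeft ℂ
        (dt (slotVec (.inl (.inl ()))) (slotVec (.inl (.inr ()))) ^ (2 * k))) from h hT
  refine tauLT_le ?_
  rintro u - _ ⟨a, ha, rfl⟩ _ ⟨b, hb, rfl⟩
  exact key a ha b hb u

end GordanDecomposition

/-! ### Iterated transvectants and products -/

section Associativity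

variable {R : Type*} [CommRing R] [Algebra ℂ R]

lemma molSpan_pair_le (F : Unit ⊕ Unit → MvPolynomial (Fin 2) R) :
    molSpan F ≤ Submodule.span ℂ {x | ∃ t a b : ℕ,
      x = tau t (homogeneousComponent a (F (.inl ()))) (homogeneousComponent b (F (.inr ())))} := by
  intro x hx
  obtain ⟨T, hT⟩ := exists_mem_tauLT_of_mem_molSpan hx
  refine tauLT_le ?_ hT
  intro u _ A hA B hB
  refine tau_mem_of_span ?_ (molSpan_unit_le _ hA) (molSpan_unit_le _ hB)
  rintro _ ⟨a, rfl⟩ _ ⟨b, rfl⟩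
  exact Submodule.subset_span ⟨u, a, b, rfl⟩

/-- Both sides are molecular covariants on the three atoms `H`, `M`, `V`; only the grouping changes,
from `{H, M}, {V}` to `{M}, {H, V}`. -/
lemma tau_tau_mem_span (r t : ℕ) (H M V : MvPolynomial (Fin 2) R) :
    tau r (tau t H M) V ∈ Submodule.span ℂ {x | ∃ u a c d e : ℕ,
      x = tau u (homogeneousComponent a M)
        (tau c (homogeneousComponent d H) (homogeneousComponent e V))} := by
  have h1 := tau_mem_molSpan r (tau_mem_molSpan t (mem_molSpan_unit H) (mem_molSpan_unit M))
    (mem_molSpan_unit V)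
  let e : Unit ⊕ (Unit ⊕ Unit) ≃ (Unit ⊕ Unit) ⊕ Unit :=
    (Equiv.sumAssoc _ _ _).symm.trans (Equiv.sumCongr (Equiv.sumComm _ _) (Equiv.refl _))
  rw [← molSpan_comp e] at h1
  obtain ⟨T, hT⟩ := exists_mem_tauLT_of_mem_molSpan h1
  refine tauLT_le ?_ hT
  intro u _ A hA B hB
  refine tau_mem_of_span ?_ (molSpan_unit_le _ hA) (molSpan_pair_le _ hB)
  rintro _ ⟨a, rfl⟩ _ ⟨c, d, e, rfl⟩
  exact Submodule.subset_span ⟨u, a, c, d, e, rfl⟩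

lemma molSpan_pair_le_of_isHomogeneous (F : Unit ⊕ Unit → MvPolynomial (Fin 2) R) {m l : ℕ}
    (h₁ : (F (.inl ())).IsHomogeneous m) (h₂ : (F (.inr ())).IsHomogeneous l) :
    molSpan F ≤ Submodule.span ℂ (Set.range fun t => tau t (F (.inl ())) (F (.inr ()))) := by
  refine (molSpan_pair_le F).trans (Submodule.span_le.2 ?_)
  rintro _ ⟨t, a, b, rfl⟩
  obtain ⟨c, hc⟩ := exists_homogeneousComponent_eq_smul h₁ a
  obtain ⟨d, hd⟩ := exists_homogeneousComponent_eq_smul h₂ b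
  rw [hc, hd, map_smul, map_smul, LinearMap.smul_apply]
  exact Submodule.smul_mem _ _ (Submodule.smul_mem _ _ (Submodule.subset_span ⟨t, rfl⟩))

lemma mapAlgHom_slotMap_sg {ι ζ : Type*} (f : ι → ζ) (i : ι) :
    mapAlgHom (slotMap f) (sg (slotVec i)) = sg (slotVec (f i)) := by
  refine (map_sg _ _).trans ?_
  congr 1
  funext c
  simp [slotVec, slotMap]

lemma exists_umbralForm_two_of_isHomogeneous (F : Unit ⊕ Unit → MvPolynomial (Fin 2) R)
    {t m l : ℕ} (hm : t ≤ m) (hl : t ≤ l) (h₁ : (F (.inl ())).IsHomogeneous m)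
    (h₂ : (F (.inr ())).IsHomogeneous l) :
    ∃ N : ℂ, N ≠ 0 ∧ umbralForm F (dt (slotVec (Sum.inl ())) (slotVec (Sum.inr ())) ^ t *
      (sg (slotVec (Sum.inl ())) ^ (m - t) * sg (slotVec (Sum.inr ())) ^ (l - t))) =
        N • tau t (F (Sum.inl ())) (F (Sum.inr ())) := by
  obtain ⟨N, hN, h⟩ := exists_umbralForm_two F t (m - t) (l - t)
  rw [Nat.sub_add_cancel hm, Nat.sub_add_cancel hl, homogeneousComponent_eq_self h₁,
    homogeneousComponent_eq_self h₂] at h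
  exact ⟨N, hN, h⟩

/-- Transvectants of products: up to transvectants of smaller index, the transvectant of index
`r₁ + r₂` of two products is a multiple of a product of transvectants. -/
lemma exists_tau_mul_sub_mem {U₁ U₂ V₁ V₂ : MvPolynomial (Fin 2) R} {m₁ m₂ l₁ l₂ r₁ r₂ : ℕ}
    (hU₁ : U₁.IsHomogeneous m₁) (hU₂ : U₂.IsHomogeneous m₂) (hV₁ : V₁.IsHomogeneous l₁)
    (hV₂ : V₂.IsHomogeneous l₂) (hm₁ : r₁ ≤ m₁) (hm₂ : r₂ ≤ m₂) (hl₁ : r₁ ≤ l₁) (hl₂ : r₂ ≤ l₂) :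
    ∃ c : ℂ, tau (r₁ + r₂) (U₁ * U₂) (V₁ * V₂) - c • (tau r₁ U₁ V₁ * tau r₂ U₂ V₂) ∈
      tauLT (r₁ + r₂) (Submodule.span ℂ (Set.range fun i => tau i U₁ U₂))
        (Submodule.span ℂ (Set.range fun i => tau i V₁ V₂)) := by
  let FU : Unit ⊕ Unit → MvPolynomial (Fin 2) R := Sum.elim (fun _ => U₁) fun _ => U₂
  let FV : Unit ⊕ Unit → MvPolynomial (Fin 2) R := Sum.elim (fun _ => V₁) fun _ => V₂
  let G₁ : Unit ⊕ Unit → MvPolynomial (Fin 2) R := Sum.elim (fun _ => U₁) fun _ => V₁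
  let G₂ : Unit ⊕ Unit → MvPolynomial (Fin 2) R := Sum.elim (fun _ => U₂) fun _ => V₂
  let e := Equiv.sumSumSumComm Unit Unit Unit Unit
  have he : Sum.elim FU FV ∘ e = Sum.elim G₁ G₂ := by
    funext i
    rcases i with (i | i) | (i | i) <;> rfl
  obtain ⟨N₁, hN₁, h₁⟩ := exists_umbralForm_two_of_isHomogeneous FU (Nat.zero_le _) (Nat.zero_le _)
    hU₁ hU₂
  obtain ⟨N₂, hN₂, h₂⟩ := exists_umbralForm_two_of_isHomogeneous FV (Nat.zero_le _) (Nat.zero_le _)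
    hV₁ hV₂
  obtain ⟨N₃, -, h₃⟩ := exists_umbralForm_two_of_isHomogeneous G₁ hm₁ hl₁ hU₁ hV₁
  obtain ⟨N₄, -, h₄⟩ := exists_umbralForm_two_of_isHomogeneous G₂ hm₂ hl₂ hU₂ hV₂
  rw [pow_zero, one_mul, Nat.sub_zero, Nat.sub_zero, tau_zero_apply] at h₁ h₂
  let v : Unit ⊕ Unit → Fin 2 → MvPolynomial (((Unit ⊕ Unit) ⊕ (Unit ⊕ Unit)) × Fin 2) ℂ :=
    slotVec ∘ Sum.inl
  let w : Unit ⊕ Unit → Fin 2 → MvPolynomial (((Unit ⊕ Unit) ⊕ (Unit ⊕ Unit)) × Fin 2) ℂ :=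
    slotVec ∘ Sum.inr
  -- Among the terms of the transvectant, the one selected has `r₁` brackets between `U₁` and `V₁`,
  -- `r₂` between `U₂` and `V₂`, and no other.
  obtain ⟨N, -, h⟩ := exists_tau_sub_mem_crossLT (v := v) (w := w)
    (List.replicate r₁ (Sum.inl (), Sum.inl ()) ++ List.replicate r₂ (Sum.inr (), Sum.inr ()))
    (Multiset.replicate (m₁ - r₁) (Sum.inl ()) + Multiset.replicate (m₂ - r₂) (Sum.inr ()))
    (Multiset.replicate (l₁ - r₁) (Sum.inl ()) + Multiset.replicate (l₂ - r₂) (Sum.inr ()))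
  replace h := crossLT_le_tauLT _ h
  simp only [List.length_append, List.length_replicate, List.map_append, List.map_replicate,
    List.prod_append, List.prod_replicate, ← Multiset.coe_add, Multiset.coe_replicate, sgProd_add,
    sgProd_replicate] at h
  have e₁ (a b c d : ℕ) (hac : c ≤ a) (hbd : d ≤ b)
      (f : Unit ⊕ Unit → (Unit ⊕ Unit) ⊕ (Unit ⊕ Unit)) :
      sg ((slotVec ∘ f) (Sum.inl ())) ^ c * sg ((slotVec ∘ f) (Sum.inr ())) ^ d *
        (sg ((slotVec ∘ f) (Sum.inl ())) ^ (a - c) * sg ((slotVec ∘ f) (Sum.inr ())) ^ (b - d)) =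
      mapAlgHom (slotMap f) (sg (slotVec (Sum.inl ())) ^ a * sg (slotVec (Sum.inr ())) ^ b) := by
    rw [map_mul, map_pow, map_pow, mapAlgHom_slotMap_sg, mapAlgHom_slotMap_sg, mul_mul_mul_comm,
      ← pow_add, ← pow_add, Nat.add_sub_cancel' hac, Nat.add_sub_cancel' hbd]
    rfl
  rw [e₁ m₁ m₂ r₁ r₂ hm₁ hm₂ Sum.inl, e₁ l₁ l₂ r₁ r₂ hl₁ hl₂ Sum.inr] at h
  -- Regrouped by `e`, the selected term has no bracket between the pairs `{U₁, V₁}` and `{U₂, V₂}`: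
  -- it is a product of two transvectants.
  have e₂ : dt (v (Sum.inl ())) (w (Sum.inl ())) ^ r₁ * dt (v (Sum.inr ())) (w (Sum.inr ())) ^ r₂ *
      (sg (v (Sum.inl ())) ^ (m₁ - r₁) * sg (v (Sum.inr ())) ^ (m₂ - r₂) *
        (sg (w (Sum.inl ())) ^ (l₁ - r₁) * sg (w (Sum.inr ())) ^ (l₂ - r₂))) =
      mapAlgHom (slotMap e) (tau 0
        (mapAlgHom (slotMap Sum.inl) (dt (slotVec (Sum.inl ())) (slotVec (Sum.inr ())) ^ r₁ *
          (sg (slotVec (Sum.inl ())) ^ (m₁ - r₁) * sg (slotVec (Sum.inr ())) ^ (l₁ - r₁))))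
        (mapAlgHom (slotMap Sum.inr) (dt (slotVec (Sum.inl ())) (slotVec (Sum.inr ())) ^ r₂ *
          (sg (slotVec (Sum.inl ())) ^ (m₂ - r₂) * sg (slotVec (Sum.inr ())) ^ (l₂ - r₂))))) := by
    simp only [tau_zero_apply, map_mul, map_pow, map_slotMap_dt, mapAlgHom_slotMap_sg]
    have d₁ : slotVec (e (Sum.inl (Sum.inl ()))) = v (Sum.inl ()) := rfl
    have d₂ : slotVec (e (Sum.inl (Sum.inr ()))) = w (Sum.inl ()) := rfl
    have d₃ : slotVec (e (Sum.inr (Sum.inl ()))) = v (Sum.inr ()) := rfl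
    have d₄ : slotVec (e (Sum.inr (Sum.inr ()))) = w (Sum.inr ()) := rfl
    rw [d₁, d₂, d₃, d₄]
    ring
  rw [e₂] at h
  have hv : brAlg v = (brAlg slotVec).map (mapAlgHom (slotMap Sum.inl)) := (brAlg_slotMap _).symm
  have hw : brAlg w = (brAlg slotVec).map (mapAlgHom (slotMap Sum.inr)) := (brAlg_slotMap _).symm
  rw [hv, hw] at h
  have h5 := umbralForm_mem_tauLT (Sum.elim FU FV) h
  have h6 := umbralForm_tau (Sum.elim FU FV) (r₁ + r₂)
    (sg (slotVec (Sum.inl ())) ^ m₁ * sg (slotVec (Sum.inr ())) ^ m₂)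
    (sg (slotVec (Sum.inl ())) ^ l₁ * sg (slotVec (Sum.inr ())) ^ l₂)
  rw [Sum.elim_comp_inl, Sum.elim_comp_inr, h₁, h₂] at h6
  have h7 := umbralForm_tau (Sum.elim G₁ G₂) 0
    (dt (slotVec (Sum.inl ())) (slotVec (Sum.inr ())) ^ r₁ *
      (sg (slotVec (Sum.inl ())) ^ (m₁ - r₁) * sg (slotVec (Sum.inr ())) ^ (l₁ - r₁)))
    (dt (slotVec (Sum.inl ())) (slotVec (Sum.inr ())) ^ r₂ *
      (sg (slotVec (Sum.inl ())) ^ (m₂ - r₂) * sg (slotVec (Sum.inr ())) ^ (l₂ - r₂)))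
  rw [Sum.elim_comp_inl, Sum.elim_comp_inr, h₃, h₄] at h7
  rw [map_sub, LinearMap.map_smul, umbralForm_slotMap, he, h6, h7, Sum.elim_comp_inl,
    Sum.elim_comp_inr, tau_zero_apply] at h5
  simp only [map_smul, LinearMap.smul_apply, smul_smul, smul_mul_smul_comm] at h5
  refine ⟨(N₂ * N₁)⁻¹ * (N * (N₃ * N₄)), ?_⟩
  have h8 := Submodule.smul_mem _ (N₂ * N₁)⁻¹ h5
  rw [smul_sub, inv_smul_smul₀ (mul_ne_zero hN₂ hN₁), smul_smul] at h8
  refine tauLT_le ?_ h8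
  intro u hu A hA B hB
  exact tau_mem_tauLT hu (molSpan_pair_le_of_isHomogeneous FU hU₁ hU₂ hA)
    (molSpan_pair_le_of_isHomogeneous FV hV₁ hV₂ hB)

end Associativity

/-! ### Reduced monomials -/

section ReducedMonomials

variable {R : Type*} [CommRing R] [Algebra ℂ R] {q t : ℕ}

lemma prod_pow_add_single (x : Fin q → R) (γ : Fin q → ℕ) (i : Fin q) (k : ℕ) :
    ∏ j, x j ^ (γ + Pi.single i k : Fin q → ℕ) j = (∏ j, x j ^ γ j) * x i ^ k := by
  simp only [Pi.add_apply, pow_add, Finset.prod_mul_distrib]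
  congr 1
  rw [Finset.prod_eq_single i]
  · rw [Pi.single_eq_same]
  · intro j _ hj
    rw [Pi.single_eq_of_ne hj, pow_zero]
  · simp

lemma prod_pow_mul_aeval_mem_span (x : Fin q → R) (γ : Fin q → ℕ) (i : Fin q)
    (P : MvPolynomial {j : Fin q // i < j} ℂ) :
    (∏ j, x j ^ γ j) * aeval (fun j => x j.1) P ∈
      Submodule.span ℂ {y | ∃ β : Fin q → ℕ, (∀ j ≤ i, β j = γ j) ∧ y = ∏ j, x j ^ β j} := by
  induction P using MvPolynomial.induction_on with
  | C a =>
    rw [aeval_C, mul_comm, ← Algebra.smul_def]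
    exact Submodule.smul_mem _ _ (Submodule.subset_span ⟨γ, fun _ _ => rfl, rfl⟩)
  | add p q hp hq => rw [map_add, mul_add]; exact add_mem hp hq
  | mul_X p j hp =>
    rw [map_mul, aeval_X, ← mul_assoc]
    generalize (∏ j, x j ^ γ j) * aeval (fun j => x j.1) p = z at hp ⊢
    induction hp using Submodule.span_induction with
    | zero => simp
    | add y z _ _ hy hz => rw [add_mul]; exact add_mem hy hz
    | smul c y _ hy => rw [smul_mul_assoc]; exact Submodule.smul_mem _ _ hy
    | mem y h =>
      obtain ⟨β, hβ, rfl⟩ := h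
      refine Submodule.subset_span ⟨β + Pi.single j.1 1, fun l hl => ?_, ?_⟩
      · rw [Pi.add_apply, Pi.single_eq_of_ne (hl.trans_lt j.2).ne, add_zero, hβ l hl]
      · rw [prod_pow_add_single, pow_one]

/-- Rewriting terminates because each relation lowers the exponent of its first variable and changes
no earlier one, whatever happens to the later ones; the lexicographic order on finitely many
exponents is well founded. -/
lemma prod_pow_mem_span_isReduced {x : Fin q → R} {I : Finset (Fin q)} {e : Fin q → ℕ}
    (hI : PowerRelations x I e) {jb jc : Fin t → Fin q} {eb ec : Fin t → ℕ}
    (hJ : PairRelations x jb jc eb ec) (β : Fin q → ℕ) :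
    ∏ j, x j ^ β j ∈ Submodule.span ℂ
      {y | ∃ β : Fin q → ℕ, IsReduced I e jb jc eb ec β ∧ y = ∏ j, x j ^ β j} := by
  have wf : WellFounded (Pi.Lex (· < ·) fun {_} => (· < ·) :
      (Fin q → ℕ) → (Fin q → ℕ) → Prop) := Pi.Lex.wellFounded _ fun _ => wellFounded_lt
  induction β using wf.induction with
  | _ β ih =>
  have step (i : Fin q) (γ : Fin q → ℕ) (l : Fin q) (hil : i ≤ l) (hlt : ∀ j < i, γ j = β j)
      (hi : γ i < β i) (P : MvPolynomial {j : Fin q // l < j} ℂ) :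
      (∏ j, x j ^ γ j) * aeval (fun j => x j.1) P ∈ Submodule.span ℂ
        {y | ∃ β : Fin q → ℕ, IsReduced I e jb jc eb ec β ∧ y = ∏ j, x j ^ β j} := by
    refine Submodule.span_le.2 ?_ (prod_pow_mul_aeval_mem_span x γ l P)
    rintro _ ⟨β', hβ', rfl⟩
    refine ih β' ⟨i, fun j hj => ?_, ?_⟩
    · rw [hβ' j (hj.le.trans hil), hlt j hj]
    · rwa [hβ' i hil]
  by_cases hβ : IsReduced I e jb jc eb ec β
  · exact Submodule.subset_span ⟨β, hβ, rfl⟩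
  rw [IsReduced, not_and_or] at hβ
  push Not at hβ
  rcases hβ with ⟨i, hi, hle⟩ | ⟨j, hle⟩
  · obtain ⟨-, he, P, hP⟩ := hI i hi
    obtain ⟨γ, rfl⟩ := exists_add_of_le hle
    rw [add_comm, prod_pow_add_single, hP, Finset.mul_sum]
    refine Submodule.sum_mem _ fun k hk => ?_
    rw [← mul_assoc, ← prod_pow_add_single]
    refine step i _ i le_rfl (fun j hj => ?_) ?_ (P k)
    · rw [Pi.add_apply, Pi.add_apply, Pi.single_eq_of_ne hj.ne, Pi.single_eq_of_ne hj.ne, add_comm]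
    · rw [Pi.add_apply, Pi.add_apply, Pi.single_eq_same, Pi.single_eq_same]
      have := Finset.mem_range.1 hk
      omega
  · obtain ⟨hlt, heb, -, P, hP⟩ := hJ j
    obtain ⟨γ, rfl⟩ := exists_add_of_le hle
    rw [add_comm, ← add_assoc, prod_pow_add_single, prod_pow_add_single, mul_assoc, hP]
    refine step (jb j) γ (jc j) hlt.le (fun l hl => ?_) ?_ P
    · rw [Pi.add_apply, Pi.add_apply, Pi.single_eq_of_ne hl.ne,
        Pi.single_eq_of_ne (hl.trans hlt).ne, zero_add, zero_add]
    · rw [Pi.add_apply, Pi.add_apply, Pi.single_eq_same]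
      omega

lemma adjoin_le_span_prod_pow {s : ℕ} (x : Fin s → R) :
    Subalgebra.toSubmodule (Algebra.adjoin ℂ (Set.range x)) ≤
      Submodule.span ℂ (Set.range fun β : Fin s → ℕ => ∏ j, x j ^ β j) := by
  rw [Algebra.adjoin_eq_span, Submodule.span_le]
  intro y hy
  refine Submodule.subset_span ?_
  induction hy using Submonoid.closure_induction with
  | mem y h =>
    obtain ⟨i, rfl⟩ := h
    refine ⟨0 + Pi.single i 1, ?_⟩
    dsimp only
    rw [prod_pow_add_single]
    simp
  | one => exact ⟨0, by simp⟩
  | mul y z _ _ hy hz =>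
    obtain ⟨β, rfl⟩ := hy
    obtain ⟨γ, rfl⟩ := hz
    exact ⟨β + γ, by simp only [Pi.add_apply, pow_add, Finset.prod_mul_distrib]⟩

lemma adjoin_le_span_isReduced {x : Fin q → R} {I : Finset (Fin q)} {e : Fin q → ℕ}
    (hI : PowerRelations x I e) {jb jc : Fin t → Fin q} {eb ec : Fin t → ℕ}
    (hJ : PairRelations x jb jc eb ec) :
    Subalgebra.toSubmodule (Algebra.adjoin ℂ (Set.range x)) ≤ Submodule.span ℂ
      {y | ∃ β : Fin q → ℕ, IsReduced I e jb jc eb ec β ∧ y = ∏ j, x j ^ β j} := by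
  refine (adjoin_le_span_prod_pow x).trans (Submodule.span_le.2 ?_)
  rintro _ ⟨β, rfl⟩
  exact prod_pow_mem_span_isReduced hI hJ β

lemma IsReduced.mono {I : Finset (Fin q)} {e : Fin q → ℕ} {jb jc : Fin t → Fin q}
    {eb ec : Fin t → ℕ} {β γ : Fin q → ℕ} (h : IsReduced I e jb jc eb ec β) (hγ : γ ≤ β) :
    IsReduced I e jb jc eb ec γ :=
  ⟨fun i hi hle => h.1 i hi (hle.trans hγ), fun j hle => h.2 j (hle.trans hγ)⟩

end ReducedMonomials

/-! ### Irreducible solutions -/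

section Solutions

variable {s q : ℕ} {a : Fin s → ℕ} {b : Fin q → ℕ}

lemma isSol_iff {κ : Tuple s q} : IsSol a b κ ↔
    ∑ i, a i * κ.1 i = κ.2.2.1 + κ.2.2.2.2 ∧ ∑ j, b j * κ.2.1 j = κ.2.2.2.1 + κ.2.2.2.2 := Iff.rfl

lemma IsSol.of_add {κ δ : Tuple s q} (h : IsSol a b κ) (h' : IsSol a b (κ + δ)) :
    IsSol a b δ := by
  rw [isSol_iff] at h h' ⊢
  simp only [Prod.fst_add, Prod.snd_add, Pi.add_apply, mul_add, Finset.sum_add_distrib] at h'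
  omega

/-- The difference of two comparable solutions is a solution, so irreducible solutions are pairwise
incomparable; by Dickson's lemma an antichain of tuples of natural numbers is finite. -/
lemma finite_isIrredSol (a : Fin s → ℕ) (b : Fin q → ℕ) : {κ | IsIrredSol a b κ}.Finite := by
  refine WellQuasiOrderedLE.finite_of_isAntichain ?_
  intro κ hκ κ' hκ' hne hle
  obtain ⟨δ, rfl⟩ := exists_add_of_le hle
  rcases hκ'.2.2 κ δ hκ.1 (hκ.1.of_add hκ'.1) rfl with h | h
  · exact hκ.2.1 h
  · exact hne (by rw [h, add_zero])

end Solutions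

/-! ### Degrees of transvectants -/

section Degrees

variable {n p : ℕ}

lemma isDegree_pderiv {d : ℕ} {P : CoordRing n} (h : IsDegree d P) (c : Fin 2) :
    IsDegree d (pderiv c P) := fun m => by
  have h1 := isDegree_smul ((m c + 1 : ℕ) : ℂ) h (m + Finsupp.single c 1)
  rw [coeff_smul, Nat.cast_smul_eq_nsmul, nsmul_eq_mul, Nat.cast_add, Nat.cast_one, mul_comm] at h1
  rwa [coeff_pderiv]

lemma isDegree_tau (t : ℕ) {d e : ℕ} {P Q : CoordRing n} (hP : IsDegree d P) (hQ : IsDegree e Q) :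
    IsDegree (d + e) (tau t P Q) := by
  induction t generalizing P Q with
  | zero => rw [tau_zero_apply]; exact isDegree_mul hP hQ
  | succ t ih =>
    rw [tau_succ, sub_eq_add_neg, ← neg_one_smul ℂ]
    exact isDegree_add (ih (isDegree_pderiv hP 0) (isDegree_pderiv hQ 1))
      (isDegree_smul _ (ih (isDegree_pderiv hP 1) (isDegree_pderiv hQ 0)))

lemma isDegree_transvectant (m l t : ℕ) {d e : ℕ} {P Q : CoordRing n} (hP : IsDegree d P)
    (hQ : IsDegree e Q) : IsDegree (d + e) (transvectant m l t P Q) := by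
  obtain ⟨c, h⟩ := transvectant_eq_smul_tau m l t P Q
  rw [h]
  exact isDegree_smul c (isDegree_tau t hP hQ)

lemma isDegree_homogeneousComponent {d : ℕ} {P : CoordRing n} (h : IsDegree d P) (i : ℕ) :
    IsDegree d (homogeneousComponent i P) := fun m => by
  rw [coeff_homogeneousComponent]
  split_ifs
  · exact h m
  · exact isHomogeneous_zero _ _ _

lemma isDegree_substForm {d e : ℕ} {H : CoordRing n} {G : CoordRing p} (hH : IsDegree e H)
    (hG : IsDegree d G) : IsDegree (e * d) (substForm H G) := fun m => by
  rw [substForm, coeff_map]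
  exact (hG m).aeval _ fun i => isDegree_smul ((p.choose i : ℂ)⁻¹) hH _

lemma exists_isDegree_of_mem_closure {S : Set (CoordRing n)} (hS : ∀ F ∈ S, ∃ d, IsDegree d F)
    {P : CoordRing n} (hP : P ∈ Submonoid.closure S) : ∃ d, IsDegree d P := by
  induction hP using Submonoid.closure_induction with
  | mem x h => exact hS x h
  | one => exact ⟨0, isDegree_one⟩
  | mul x y _ _ hx hy =>
    obtain ⟨d, hd⟩ := hx
    obtain ⟨e, he⟩ := hy
    exact ⟨d + e, isDegree_mul hd he⟩

lemma degComp_mem_adjoin {S : Set (CoordRing n)} (hS : ∀ F ∈ S, ∃ d, IsDegree d F)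
    {P : CoordRing n} (hP : P ∈ Algebra.adjoin ℂ S) (d : ℕ) : degComp d P ∈ Algebra.adjoin ℂ S := by
  have h : Subalgebra.toSubmodule (Algebra.adjoin ℂ S) ≤
      (Subalgebra.toSubmodule (Algebra.adjoin ℂ S)).comap (degComp d) := by
    conv_lhs => rw [Algebra.adjoin_eq_span]
    refine Submodule.span_le.2 fun x hx => ?_
    obtain ⟨e, he⟩ := exists_isDegree_of_mem_closure hS hx
    rw [SetLike.mem_coe, Submodule.mem_comap, degComp_of_isDegree he]
    split_ifs
    · exact (Algebra.adjoin_eq_span ℂ S).symm ▸ Submodule.subset_span hx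
    · exact zero_mem _
  exact h hP

end Degrees

/-! ### The hessian -/

section Hessian

variable {n k p : ℕ}

lemma exists_tau_eq_smul_hessian (n k : ℕ) :
    ∃ c : ℂ, tau (2 * k) (genericForm n) (genericForm n) = c • hessian n k :=
  exists_tau_eq_smul_transvectant (2 * k) isHomogeneous_genericForm isHomogeneous_genericForm

lemma hessian_mem_Cov : hessian n k ∈ Cov n := by
  obtain ⟨c, h⟩ := transvectant_eq_smul_tau n n (2 * k) (genericForm n) (genericForm n)
  rw [hessian, h]
  exact Subalgebra.smul_mem _ (tau_mem_Cov _ genericForm_mem_Cov genericForm_mem_Cov) c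

lemma isHomogeneous_hessian (hp : p + 4 * k = 2 * n) : (hessian n k).IsHomogeneous p := by
  have h := transvectant_isHomogeneous (2 * k) (isHomogeneous_genericForm (n := n))
    (isHomogeneous_genericForm (n := n))
  rwa [show n + n - 2 * (2 * k) = p by omega] at h

lemma isDegree_hessian : IsDegree 2 (hessian n k) :=
  isDegree_transvectant _ _ _ isDegree_genericForm isDegree_genericForm

lemma tau_genericForm_mem_covOf (hp : p + 4 * k = 2 * n) :
    tau (2 * k) (genericForm n) (genericForm n) ∈ covOf p (hessian n k) := by
  obtain ⟨c, h⟩ := exists_tau_eq_smul_hessian n k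
  rw [h]
  exact Subalgebra.smul_mem _ (self_mem_covOf (isHomogeneous_hessian hp)) c

end Hessian

/-! ### Reduction of transvectants -/

section Reduction

variable {n s q : ℕ}

/-- The sums of a polynomial in the members of `S` and of an element of Gordan's ideal. -/
def adjoinSup (S : Set (CoordRing n)) (r : ℕ) : Submodule ℂ (CoordRing n) :=
  Subalgebra.toSubmodule (Algebra.adjoin ℂ S) ⊔ gordanSpan n r

lemma mul_mem_adjoinSup {S : Set (CoordRing n)} (hS : S ⊆ Cov n) {r : ℕ} {P Q : CoordRing n}
    (hP : P ∈ adjoinSup S r) (hQ : Q ∈ adjoinSup S r) : P * Q ∈ adjoinSup S r := by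
  obtain ⟨x, hx, y, hy, rfl⟩ := Submodule.mem_sup.1 hP
  obtain ⟨z, hz, w, hw, rfl⟩ := Submodule.mem_sup.1 hQ
  have hSC : Algebra.adjoin ℂ S ≤ Cov n := Algebra.adjoin_le hS
  have hmul {y z : CoordRing n} (hy : y ∈ gordanSpan n r) (hz : z ∈ Cov n) :
      y * z ∈ gordanSpan n r := by
    have h := tau_mem_gordanSpan 0 hy hz
    rwa [tau_zero_apply] at h
  have h1 : (x + y) * (z + w) = x * z + (w * x + y * (z + w)) := by ring
  rw [h1]
  exact add_mem (Submodule.mem_sup_left (Subalgebra.mul_mem _ hx hz)) (Submodule.mem_sup_right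
    (add_mem (hmul hw (hSC hx)) (hmul hy (add_mem (hSC hz) (gordanSpan_le_Cov r hw)))))

lemma isHomogeneous_prod_pow {R : Type*} [CommRing R] {F : Fin s → MvPolynomial (Fin 2) R}
    {a : Fin s → ℕ} (hF : ∀ i, (F i).IsHomogeneous (a i)) (α : Fin s → ℕ) :
    (∏ i, F i ^ α i).IsHomogeneous (∑ i, a i * α i) :=
  IsHomogeneous.prod _ _ _ fun i _ => (hF i).pow (α i)

lemma isDegree_prod_pow {F : Fin s → CoordRing n} {d : Fin s → ℕ} (hF : ∀ i, IsDegree (d i) (F i))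
    (α : Fin s → ℕ) : IsDegree (∑ i, α i * d i) (∏ i, F i ^ α i) :=
  isDegree_prod _ _ _ fun i _ => isDegree_pow (hF i) (α i)

lemma prod_pow_add {R : Type*} [CommRing R] (F : Fin s → R) (α α' : Fin s → ℕ) :
    ∏ i, F i ^ (α + α' : Fin s → ℕ) i = (∏ i, F i ^ α i) * ∏ i, F i ^ α' i := by
  simp only [Pi.add_apply, pow_add, Finset.prod_mul_distrib]

lemma substForm_prod_pow {p : ℕ} (H : CoordRing n) (G : Fin q → CoordRing p) (β : Fin q → ℕ) :
    substForm H (∏ j, G j ^ β j) = ∏ j, substForm H (G j) ^ β j := by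
  simp only [substForm, map_prod, map_pow]

/-- The transvectants attached to solutions with an admissible second component, under the
hypothesis that the transvectants of smaller degree or of the same degree and smaller index have
been treated. -/
lemma tau_prod_pow_mem {F : Fin s → CoordRing n} {a d : Fin s → ℕ}
    (hFa : ∀ i, (F i).IsHomogeneous (a i)) (hFd : ∀ i, IsDegree (d i) (F i))
    (hFC : ∀ i, F i ∈ Cov n) {A : Subalgebra ℂ (CoordRing n)}
    (hA : ∀ t, ∀ P ∈ A, ∀ Q ∈ A, tau t P Q ∈ A) {B : Fin q → CoordRing n} {b : Fin q → ℕ}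
    (hBb : ∀ j, (B j).IsHomogeneous (b j)) (hBA : ∀ j, B j ∈ A) {Red : (Fin q → ℕ) → Prop}
    (hRed : ∀ β γ, Red β → γ ≤ β → Red γ) {S : Set (CoordRing n)} (hSC : S ⊆ Cov n) {r₀ : ℕ}
    (hS : ∀ κ : Tuple s q, IsIrredSol a b κ → Red κ.2.1 → solTransvectant F a B b κ ∈ S) {D r : ℕ}
    (ih₁ : ∀ D' < D, ∀ r', ∀ U ∈ Cov n, IsDegree D' U → ∀ V ∈ A, tau r' U V ∈ adjoinSup S r₀)
    (ih₂ : ∀ r' < r, ∀ U ∈ Cov n, IsDegree D U → ∀ V ∈ A, tau r' U V ∈ adjoinSup S r₀)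
    (κ : Tuple s q) (hκ : IsSol a b κ) (hκR : Red κ.2.1) (hD : ∑ i, κ.1 i * d i ≤ D)
    (hr : κ.2.2.2.2 ≤ r) :
    tau κ.2.2.2.2 (∏ i, F i ^ κ.1 i) (∏ j, B j ^ κ.2.1 j) ∈ adjoinSup S r₀ := by
  have hU (α : Fin s → ℕ) : ∏ i, F i ^ α i ∈ Cov n := prod_mem fun i _ => pow_mem (hFC i) _
  have hV (β : Fin q → ℕ) : ∏ j, B j ^ β j ∈ A := prod_mem fun j _ => pow_mem (hBA j) _
  induction κ using WellFoundedLT.induction with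
  | _ κ ih =>
  -- Only the extreme case of degree exactly `D` and index exactly `r` needs an argument; the
  -- summands of a solution may fall below either bound.
  rcases hD.lt_or_eq with hD' | hD'
  · exact ih₁ _ hD' _ _ (hU _) (isDegree_prod_pow hFd _) _ (hV _)
  rcases hr.lt_or_eq with hr' | hr'
  · exact ih₂ _ hr' _ (hU _) (hD' ▸ isDegree_prod_pow hFd _) _ (hV _)
  by_cases hκ0 : κ = 0
  · subst hκ0
    refine Submodule.mem_sup_left ?_
    simp [one_mem]
  by_cases hirr : IsIrredSol a b κ
  · obtain ⟨c, hc⟩ := exists_tau_eq_smul_transvectant κ.2.2.2.2 (isHomogeneous_prod_pow hFa κ.1)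
      (isHomogeneous_prod_pow hBb κ.2.1)
    rw [hc]
    exact Submodule.smul_mem _ _ (Submodule.mem_sup_left
      (Algebra.subset_adjoin (hS κ hirr hκR)))
  · simp only [IsIrredSol, not_and, not_forall, not_or] at hirr
    obtain ⟨κ₁, κ₂, h₁, h₂, rfl, h₁0, h₂0⟩ := hirr hκ hκ0
    have hlt₁ : κ₁ < κ₁ + κ₂ := lt_of_le_of_ne le_self_add fun h => h₂0 (left_eq_add.1 h)
    have hlt₂ : κ₂ < κ₁ + κ₂ := lt_of_le_of_ne le_add_self fun h => h₁0 (right_eq_add.1 h)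
    have hs₁ := isSol_iff.1 h₁
    have hs₂ := isSol_iff.1 h₂
    simp only [Prod.fst_add, Prod.snd_add, Pi.add_apply, add_mul,
      Finset.sum_add_distrib] at hD hr hD' hr'
    have m₁ := ih κ₁ hlt₁ h₁ (hRed _ _ hκR le_self_add) (by omega) (by omega)
    have m₂ := ih κ₂ hlt₂ h₂ (hRed _ _ hκR le_add_self) (by omega) (by omega)
    -- The error terms pair transvectants of the two parts of `U` with those of the two parts of
    -- `V`: the degree is still `D` and the second argument stays in `A`, but the index is below
    -- `r`, so `ih₂` applies.
    obtain ⟨c, hc⟩ := exists_tau_mul_sub_mem (r₁ := κ₁.2.2.2.2) (r₂ := κ₂.2.2.2.2)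
      (isHomogeneous_prod_pow hFa κ₁.1) (isHomogeneous_prod_pow hFa κ₂.1)
      (isHomogeneous_prod_pow hBb κ₁.2.1) (isHomogeneous_prod_pow hBb κ₂.2.1)
      (by omega) (by omega) (by omega) (by omega)
    simp only [Prod.fst_add, Prod.snd_add, prod_pow_add]
    rw [← sub_add_cancel (tau _ _ _) (c • _)]
    refine add_mem ?_ (Submodule.smul_mem _ c (mul_mem_adjoinSup hSC m₁ m₂))
    refine tauLT_le ?_ hc
    intro u hu x hx y hy
    refine tau_mem_of_span ?_ hx hy
    rintro _ ⟨i, rfl⟩ _ ⟨j, rfl⟩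
    refine ih₂ u (by omega) _ (tau_mem_Cov i (hU _) (hU _)) ?_ _ (hA j _ (hV _) _ (hV _))
    rw [← hD']
    exact isDegree_tau i (isDegree_prod_pow hFd _) (isDegree_prod_pow hFd _)

/-- The central induction, on `D` and then on `r`. Letting `V` be any covariant of the hessian is
essential: passing from `Q` in `I_{2k}` to smaller degree transfers a factor `H` from the first
argument to the second. -/
lemma tau_mem_adjoinSup {k p : ℕ} (hp : p + 4 * k = 2 * n) (hk : 1 ≤ k) {F : Fin s → CoordRing n}
    {a d : Fin s → ℕ} (hFa : ∀ i, (F i).IsHomogeneous (a i)) (hFd : ∀ i, IsDegree (d i) (F i))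
    (hf : genericForm n ∈ Set.range F)
    (hrel : IsRelComplete (Set.range F) (gordanIdeal n (2 * k)))
    {G : Fin q → CoordRing p} {b : Fin q → ℕ} (hGb : ∀ j, (G j).IsHomogeneous (b j))
    (hGC : ∀ j, G j ∈ Cov p) {Red : (Fin q → ℕ) → Prop} (hRed : ∀ β γ, Red β → γ ≤ β → Red γ)
    (hspan : Subalgebra.toSubmodule (Cov p) ≤
      Submodule.span ℂ {y | ∃ β : Fin q → ℕ, Red β ∧ y = ∏ j, G j ^ β j})
    {S : Set (CoordRing n)} (hSC : S ⊆ Cov n)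
    (hS : ∀ κ : Tuple s q, IsIrredSol a b κ → Red κ.2.1 →
      solTransvectant F a (fun j => substForm (hessian n k) (G j)) b κ ∈ S)
    (D r : ℕ) (U : CoordRing n) (hU : U ∈ Cov n) (hUD : IsDegree D U) (V : CoordRing n)
    (hV : V ∈ covOf p (hessian n k)) : tau r U V ∈ adjoinSup S (2 * k + 2) := by
  have hFC (i : Fin s) : F i ∈ Cov n := (hrel.2.1 _ ⟨i, rfl⟩).1
  have hVC := covOf_le_Cov (isHomogeneous_hessian hp) hessian_mem_Cov
  induction D using Nat.strong_induction_on generalizing r U V with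
  | _ D ih₁ =>
  induction r using Nat.strong_induction_on generalizing U V with
  | _ r ih₂ =>
  obtain ⟨P, hP, Q, hQ, hPD, hQD, rfl⟩ := hrel.2.2 D U (Cov_le_covAlg hf hU) hUD
  rw [map_add, LinearMap.add_apply]
  refine add_mem ?_ ?_
  -- Composing with `degComp D` discards the monomials of `P` of degree other than `D`, to which the
  -- induction would not apply.
  · have h1 : Subalgebra.toSubmodule (Algebra.adjoin ℂ (Set.range F)) ≤
        (adjoinSup S (2 * k + 2)).comap ((tau r).flip V ∘ₗ degComp D) := by
      refine (adjoin_le_span_prod_pow F).trans (Submodule.span_le.2 ?_)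
      rintro _ ⟨α, rfl⟩
      have hα := isDegree_prod_pow hFd α
      dsimp only
      rw [SetLike.mem_coe, Submodule.mem_comap, LinearMap.comp_apply, LinearMap.flip_apply,
        degComp_of_isDegree hα]
      split_ifs with hD
      · obtain ⟨V, hV, rfl⟩ := hV
        have h2 : Subalgebra.toSubmodule (Cov p) ≤ (adjoinSup S (2 * k + 2)).comap
            ((tau r) (∏ i, F i ^ α i) ∘ₗ
              (mapAlgHom (aeval (formCoeff p (hessian n k)))).toLinearMap) := by
          refine hspan.trans (Submodule.span_le.2 ?_)
          rintro _ ⟨β, hβ, rfl⟩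
          rw [SetLike.mem_coe, Submodule.mem_comap, LinearMap.comp_apply,
            AlgHom.toLinearMap_apply, ← substForm_eq_mapAlgHom, substForm_prod_pow]
          have hBb (j : Fin q) : (substForm (hessian n k) (G j)).IsHomogeneous (b j) :=
            (hGb j).map _
          -- When the index exceeds neither order, the differences supply `u` and `v` and the
          -- exponents extend to a solution; otherwise the transvectant is zero.
          by_cases hr : r ≤ ∑ i, a i * α i ∧ r ≤ ∑ j, b j * β j
          · exact tau_prod_pow_mem hFa hFd hFC (fun t P hP Q hQ => tau_mem_covOf t hP hQ) hBb
              (fun j => ⟨G j, hGC j, rfl⟩) hRed hSC hS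
              (fun D' hD' r' U hU hUD V hV => ih₁ D' hD' r' U hU hUD V hV)
              (fun r' hr' U hU hUD V hV => ih₂ r' hr' U hU hUD V hV)
              (α, β, ∑ i, a i * α i - r, ∑ j, b j * β j - r, r)
              ⟨(Nat.sub_add_cancel hr.1).symm, (Nat.sub_add_cancel hr.2).symm⟩ hβ hD.ge le_rfl
          · rw [not_and_or, not_le, not_le] at hr
            rcases hr with hr | hr
            · rw [tau_eq_zero_left (isHomogeneous_prod_pow hFa α) hr]; exact zero_mem _
            · rw [tau_eq_zero_right (isHomogeneous_prod_pow hBb β) hr]; exact zero_mem _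
        exact h2 hV
      · rw [map_zero, LinearMap.zero_apply]; exact zero_mem _
    have h3 := h1 hP
    rwa [Submodule.mem_comap, LinearMap.comp_apply, LinearMap.flip_apply, degComp_self hPD] at h3
  · have hQ' := degComp_mem_gordanSpanDeg (coe_mem_gordanSpan (by omega) hQ) D
    rw [degComp_self hQD] at hQ'
    have h1 : gordanSpanDeg n (2 * k) D ≤ (adjoinSup S (2 * k + 2)).comap ((tau r).flip V) := by
      refine (gordanSpanDeg_le k D).trans (sup_le (Submodule.span_le.2 ?_) fun x hx => ?_)
      · rintro _ ⟨t, M, hM, d', hd', hlt, rfl⟩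
        rw [SetLike.mem_coe, Submodule.mem_comap, LinearMap.flip_apply]
        -- Now `M`, of degree `d' < D`, plays the part of `U`; there is no restriction on the new
        -- index `u`.
        refine Submodule.span_le.2 ?_ (tau_tau_mem_span r t _ M V)
        rintro _ ⟨u, i, c, j, l, rfl⟩
        exact ih₁ d' hlt u _ (homogeneousComponent_mem_Cov hM i)
          (isDegree_homogeneousComponent hd' i) _ (tau_mem_covOf c
            (homogeneousComponent_mem_covOf j (tau_genericForm_mem_covOf hp))
            (homogeneousComponent_mem_covOf l hV))
      · rw [Submodule.mem_comap, LinearMap.flip_apply]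
        exact Submodule.mem_sup_right (tau_mem_gordanSpan r hx (hVC hV))
    have h2 := h1 hQ'
    rwa [Submodule.mem_comap, LinearMap.flip_apply] at h2

end Reduction

/-! ### The family of reduced irreducible transvectants -/

section ReducedFamily

variable {n s q : ℕ} {a : Fin s → ℕ} {b : Fin q → ℕ}

/-- The solution that yields the member `F i` of `A`. A summand with vanishing `α` and `β` is zero,
since the equations then force `u`, `v` and `r` to vanish. -/
lemma isIrredSol_single (i : Fin s) :
    IsIrredSol a b (Pi.single i 1, 0, a i, 0, 0) := by
  refine ⟨⟨?_, ?_⟩, fun h => ?_, ?_⟩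
  · rw [Finset.sum_eq_single i]
    · simp
    · intro j _ hj
      rw [Pi.single_eq_of_ne hj, mul_zero]
    · simp
  · simp
  · have := congrFun (congrArg Prod.fst h) i
    simp at this
  · have hzero {κ : Tuple s q} (h : IsSol a b κ) (h₁ : κ.1 = 0) (h₂ : κ.2.1 = 0) : κ = 0 := by
      rw [isSol_iff] at h
      simp only [h₁, h₂, Pi.zero_apply, mul_zero, Finset.sum_const_zero] at h
      refine Prod.ext h₁ (Prod.ext h₂ (Prod.ext ?_ (Prod.ext ?_ ?_)))
      · change κ.2.2.1 = 0; omega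
      · change κ.2.2.2.1 = 0; omega
      · change κ.2.2.2.2 = 0; omega
    intro κ₁ κ₂ h₁ h₂ h
    have hα : Pi.single i 1 = κ₁.1 + κ₂.1 := congrArg Prod.fst h
    have hβ : (0 : Fin q → ℕ) = κ₁.2.1 + κ₂.2.1 := congrArg (fun κ => κ.2.1) h
    have hβ' := add_eq_zero.1 hβ.symm
    have hi : 1 = κ₁.1 i + κ₂.1 i := by simpa using congrFun hα i
    have hj (j : Fin s) (hj : j ≠ i) : κ₁.1 j = 0 ∧ κ₂.1 j = 0 := by
      have := congrFun hα j
      rw [Pi.single_eq_of_ne hj, Pi.add_apply] at this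
      omega
    rcases Nat.eq_zero_or_pos (κ₁.1 i) with h0 | h0
    · refine Or.inl (hzero h₁ (funext fun j => ?_) hβ'.1)
      by_cases hji : j = i
      · rw [hji, h0]; rfl
      · exact (hj j hji).1
    · refine Or.inr (hzero h₂ (funext fun j => ?_) hβ'.2)
      by_cases hji : j = i
      · rw [hji, Pi.zero_apply]; omega
      · exact (hj j hji).2

lemma solTransvectant_single (F : Fin s → CoordRing n) (B : Fin q → CoordRing n) (i : Fin s) :
    solTransvectant F a B b (Pi.single i 1, 0, a i, 0, 0) = ((a i)! : ℂ) • F i := by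
  have h1 : ∏ j, F j ^ (Pi.single i 1 : Fin s → ℕ) j = F i := by
    simpa using prod_pow_add_single F 0 i 1
  have h2 : ∑ j, a j * (Pi.single i 1 : Fin s → ℕ) j = a i := by
    rw [Finset.sum_eq_single i]
    · simp
    · intro j _ hj
      rw [Pi.single_eq_of_ne hj, mul_zero]
    · simp
  rw [solTransvectant, h1, h2, tau_eq_transvectant (Nat.zero_le _) (Nat.zero_le _), tau_zero_apply]
  simp

lemma isReduced_zero {R : Type*} [CommRing R] [Algebra ℂ R] {t : ℕ} {x : Fin q → R}
    {I : Finset (Fin q)} {e : Fin q → ℕ} (hI : PowerRelations x I e) {jb jc : Fin t → Fin q}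
    {eb ec : Fin t → ℕ} (hJ : PairRelations x jb jc eb ec) : IsReduced I e jb jc eb ec 0 := by
  refine ⟨fun i hi h => ?_, fun j h => ?_⟩
  · have h1 : (Pi.single i (e i) : Fin q → ℕ) i ≤ 0 := h i
    have h2 := (hI i hi).2.1
    rw [Pi.single_eq_same] at h1
    exact absurd (h2.trans h1) (by norm_num)
  · have h1 : (Pi.single (jb j) (eb j) : Fin q → ℕ) (jb j) +
        (Pi.single (jc j) (ec j) : Fin q → ℕ) (jb j) ≤ 0 := h (jb j)
    have h2 := (hJ j).2.1
    rw [Pi.single_eq_same] at h1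
    exact absurd (h2.trans ((Nat.le_add_right _ _).trans h1)) (by norm_num)

/-- A family of homogeneous covariants is relatively complete as soon as every covariant is the sum
of a polynomial in its members and of an element of the span of Gordan's ideal. -/
lemma isRelComplete_of_Cov_le {S : Set (CoordRing n)} (hfin : S.Finite)
    (hS : ∀ F ∈ S, F ∈ Cov n ∧ (∃ d, IsDegree d F) ∧ ∃ m, F.IsHomogeneous m) {r : ℕ}
    {J : Ideal (Cov n)} (hJ : gordanIdeal n r ≤ J)
    (h : Subalgebra.toSubmodule (Cov n) ≤ adjoinSup S r) : IsRelComplete S J := by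
  refine ⟨hfin, hS, fun d P hP hd => ?_⟩
  obtain ⟨x, hx, y, hy, rfl⟩ := Submodule.mem_sup.1
    (h (covAlg_le_Cov (fun F hF => (hS F hF).1) hP))
  obtain ⟨Q, hQ, hQy⟩ := exists_gordanIdeal_of_mem (degComp_mem_gordanSpan hy d)
  refine ⟨degComp d x, degComp_mem_adjoin (fun F hF => (hS F hF).2.1) hx d, Q, hJ hQ,
    isDegree_degComp d x, ?_, ?_⟩
  · rw [hQy]; exact isDegree_degComp d y
  · rw [hQy, ← map_add, degComp_self hd]

end ReducedFamily

end BinaryCov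

end

/-! ### The main theorem -/

open BinaryCov in
theorem mainTheorem7
    (n k p : ℕ) (hp : p + 4 * k = 2 * n) (hpn : p < n)
    -- the family `A`, with its orders, relatively complete modulo `I_{2k}` and containing `f`
    {s : ℕ} (F : Fin s → CoordRing n) (a : Fin s → ℕ)
    (hFa : ∀ i, (F i).IsHomogeneous (a i))
    (hf : genericForm n ∈ Set.range F)
    (hA : IsRelComplete (Set.range F) (gordanIdeal n (2 * k)))
    -- a covariant basis of `S_p`, with its orders
    {q : ℕ} (G : Fin q → CoordRing p) (b : Fin q → ℕ)
    (hGb : ∀ j, (G j).IsHomogeneous (b j))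
    (hGd : ∀ j, ∃ d, IsDegree d (G j))
    (hG : Algebra.adjoin ℂ (Set.range G) = Cov p)
    -- the relations in `Cov(S_p)`
    (I : Finset (Fin q)) (e : Fin q → ℕ) (hI : PowerRelations G I e)
    {t : ℕ} (jb jc : Fin t → Fin q) (eb ec : Fin t → ℕ) (hJ : PairRelations G jb jc eb ec)
    -- the ideal `J_{2k+2}`
    (J : Ideal (Cov n))
    (hJ2 : J = gordanIdeal n (2 * k + 2) ∨
      ∃ Δ : Cov n, IsInvariant Δ ∧ J = gordanIdeal n (2 * k + 2) ⊔ Ideal.span {Δ})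
    -- the family `B`, and the reduced family of transvectants
    (B : Fin q → CoordRing n) (hB : ∀ j, B j = substForm (hessian n k) (G j))
    (Cred : Set (CoordRing n))
    (hC : Cred = {T | ∃ κ : Tuple s q, IsIrredSol a b κ ∧ IsReduced I e jb jc eb ec κ.2.1 ∧
      T = solTransvectant F a B b κ}) :
    IsRelComplete Cred J ∧
      covAlg Cred = covAlg (Set.range F ∪ Set.range B) ∧
      covAlg (Set.range F ∪ Set.range B) = Cov n := by
  -- For `k = 0` the order would be `p = 2 * n`, contradicting `p < n`.
  have hk : 1 ≤ k := by omega
  obtain rfl : B = fun j => substForm (hessian n k) (G j) := funext hB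
  have hFC (i : Fin s) := hA.2.1 (F i) ⟨i, rfl⟩
  choose d hd using fun i => (hFC i).2.1
  choose d' hd' using hGd
  have hGC (j : Fin q) : G j ∈ Cov p := hG ▸ Algebra.subset_adjoin ⟨j, rfl⟩
  have hBC (j : Fin q) : substForm (hessian n k) (G j) ∈ Cov n :=
    covOf_le_Cov (isHomogeneous_hessian hp) hessian_mem_Cov ⟨G j, hGC j, rfl⟩
  have hUC (α : Fin s → ℕ) : ∏ i, F i ^ α i ∈ Cov n := prod_mem fun i _ => pow_mem (hFC i).1 _
  have hVC (β : Fin q → ℕ) : ∏ j, substForm (hessian n k) (G j) ^ β j ∈ Cov n :=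
    prod_mem fun j _ => pow_mem (hBC j) _
  have hCred : ∀ T ∈ Cred, T ∈ Cov n ∧ (∃ d, IsDegree d T) ∧ ∃ m, T.IsHomogeneous m := by
    rw [hC]
    rintro _ ⟨⟨α, β, u, v, r⟩, -, -, rfl⟩
    rw [solTransvectant]
    refine ⟨?_, ⟨_, isDegree_transvectant _ _ _ (isDegree_prod_pow hd α)
      (isDegree_prod_pow (fun j => isDegree_substForm isDegree_hessian (hd' j)) β)⟩,
      ⟨_, transvectant_isHomogeneous r (isHomogeneous_prod_pow hFa α)
        (isHomogeneous_prod_pow (fun j => (hGb j).map _) β)⟩⟩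
    obtain ⟨c, h⟩ := transvectant_eq_smul_tau (∑ i, a i * α i) (∑ j, b j * β j) r
      (∏ i, F i ^ α i) (∏ j, substForm (hessian n k) (G j) ^ β j)
    rw [h]
    exact Subalgebra.smul_mem _ (tau_mem_Cov r (hUC α) (hVC β)) c
  have hCC : Cred ⊆ Cov n := fun T hT => (hCred T hT).1
  have hfin : Cred.Finite := by
    refine ((finite_isIrredSol a b).image
      (solTransvectant F a (fun j => substForm (hessian n k) (G j)) b)).subset ?_
    rw [hC]
    rintro _ ⟨κ, hκ, -, rfl⟩
    exact ⟨κ, hκ, rfl⟩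
  have hspan := adjoin_le_span_isReduced hI hJ
  rw [hG] at hspan
  have hcov : Subalgebra.toSubmodule (Cov n) ≤ adjoinSup Cred (2 * k + 2) := by
    intro P hP
    obtain ⟨N, h⟩ := exists_sum_degComp P
    rw [h]
    refine Submodule.sum_mem _ fun D _ => ?_
    -- The second argument `1` is a covariant of the hessian, and the transvectant of index `0` with
    -- it is the covariant itself.
    have h1 := tau_mem_adjoinSup hp hk hFa hd hf hA hGb hGC (fun β γ h hγ => h.mono hγ) hspan hCC
      (fun κ hκ hκR => hC ▸ ⟨κ, hκ, hκR, rfl⟩) D 0 (degComp D P) (degComp_mem_Cov hP D)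
      (isDegree_degComp D P) 1 (one_mem _)
    rwa [tau_zero_apply, mul_one] at h1
  have hJle : gordanIdeal n (2 * k + 2) ≤ J := by
    rcases hJ2 with rfl | ⟨Δ, -, rfl⟩
    · exact le_rfl
    · exact le_sup_left
  have hAB : covAlg (Set.range F ∪ Set.range fun j => substForm (hessian n k) (G j)) = Cov n := by
    refine le_antisymm (covAlg_le_Cov ?_) (Cov_le_covAlg (Or.inl hf))
    rintro _ (⟨i, rfl⟩ | ⟨j, rfl⟩)
    · exact (hFC i).1
    · exact hBC j
  refine ⟨isRelComplete_of_Cov_le hfin hCred hJle hcov, ?_, hAB⟩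
  rw [hAB]
  obtain ⟨i, hi⟩ := hf
  -- The irreducible solution attached to the position `i` of `f` in `A` puts `(a i)! • f` into the
  -- reduced family: its exponents `β` vanish, so it is reduced. A nonzero multiple of `f` generates
  -- all covariants.
  refine le_antisymm (covAlg_le_Cov hCC) (Cov_le_covAlg_of_smul_mem (c := ((a i)! : ℂ))
    (Nat.cast_ne_zero.2 (Nat.factorial_ne_zero _)) ?_)
  rw [hC, ← hi]
  exact ⟨_, isIrredSol_single i, isReduced_zero hI hJ, (solTransvectant_single F _ i).symm⟩
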